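/- A supervised RBM with $n$ visible units, $n_2$ hidden units and a label is a joint law of $X\in\{\pm1\}^{n}$, $H\in\{\pm1\}^{n_2}$, $Y\in\{\pm1\}$ of the form \[\Pr[X=x,H=h,Y=y]\propto\exp\big(\langle x,Wh\rangle+\langle h,w\rangle y+\langle b^{(1)},x\rangle+\langle b^{(2)},h\rangle+b^{(3)}y\big).\] Let $\ell(v,y)=\log(1+e^{-2vy})$ be the logistic loss. Theorem. There are absolute constants $C,c_1>0$ and $c_2,c_3,K,k\in\mathbb N$ and an algorithm (a single real RAM program, with unit-cost arithmetic, comparison, exponential and logarithm of reals, without rounding, and with addition and subtraction of integer counters and addresses) such that the following holds. Let $n\ge1$, $\alpha,\beta,B,\varepsilon>0$ and $0<\delta<1$ (with $\delta\le1/2$ if $n=1$), and consider any supervised RBM such that 1. (minimum ferromagnetic interaction) for all $i,j$, either $W_{ij}=0$ or $W_{ij}\ge\alpha$; 2. (conditional sparsity) $\sum_jW_{ij}+|b^{(1)}_i|\le\lambda$ for all $i$, and for at least one $y\in\{\pm1\}$, $\sum_iW_{ij}+|b^{(2)}_j+yw_j|\le\lambda$ for all $j$; 3. (balanced label) $\Pr[Y=y]\ge\beta$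 for both $y\in\{\pm1\}$; 4. (bounded bias) $\mathbb E[Y\mid X=x]=\tanh(f^*(x)+b^*)$ with $|b^*|\le B$, where $f^*$ is a multilinear polynomial without constant term. Given $n,\lambda,\alpha,\beta,B,\varepsilon,\delta$ and any number \[m\;\ge\;C\,n^2\exp(\lambda)^{\exp(c_1\lambda)\,(1/\alpha)^{c_2}\,(1/\beta)^{c_3}}\;\frac{\log(n/\delta)}{\varepsilon^2}\] of independent samples of $(X,Y)$, the algorithm always halts within $K m^k$ steps and outputs a hypothesis $h:\{\pm1\}^n\to\mathbb R$, written as an explicit list of monomials with real coefficients, and with probability at least $1-\delta$ over the samples \[\mathbb E[\ell(h(X),Y)]-\mathbb E[\ell(g(X),Y)]\le\varepsilon\quad\text{for every } g:\{\pm1\}^n\to\mathbb R,\] in particular for the minimizer $g=h^*$ of the logistic loss. -/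

import Mathlib

open scoped Matrix

/-! ### Real RAM programs with a step count

The machine has a memory of natural numbers, used for counters and addresses, and a memory of
real numbers, both with indirect addressing. Natural numbers can only be added and (truncatedly)
subtracted; real numbers can be added, subtracted, multiplied, divided, exponentiated, compared,
and their logarithm can be taken. There is no rounding and no conversion from reals to naturals,
and the only constants are natural numbers. Every operation costs one step. -/

namespace RealRAM

/-- The contents of the two memories. -/
structure State where
  nat : ℕ → ℕ
  real : ℕ → ℝ

/-- Expressions for natural numbers; `cell a` reads the natural-number memory at address `a`. -/
inductive NatExpr where
  | const (k : ℕ)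
  | cell (a : NatExpr)
  | add (a b : NatExpr)
  | sub (a b : NatExpr)

/-- Expressions for real numbers; `cell a` reads the real memory at address `a`. -/
inductive RealExpr where
  | ofNat (a : NatExpr)
  | cell (a : NatExpr)
  | add (u v : RealExpr)
  | sub (u v : RealExpr)
  | mul (u v : RealExpr)
  | div (u v : RealExpr)
  | exp (u : RealExpr)
  | log (u : RealExpr)

/-- Conditions of branches and loops. -/
inductive Test where
  | natLE (a b : NatExpr)
  | realLE (u v : RealExpr)
  | not (p : Test)
  | and (p q : Test)

/-- Programs. -/
inductive Program where
  | skip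
  | setNat (address value : NatExpr)
  | setReal (address : NatExpr) (value : RealExpr)
  | seq (P Q : Program)
  | ite (p : Test) (P Q : Program)
  | loop (p : Test) (P : Program)

def NatExpr.eval (σ : State) : NatExpr → ℕ
  | .const k => k
  | .cell a => σ.nat (a.eval σ)
  | .add a b => a.eval σ + b.eval σ
  | .sub a b => a.eval σ - b.eval σ

noncomputable def RealExpr.eval (σ : State) : RealExpr → ℝ
  | .ofNat a => (a.eval σ : ℝ)
  | .cell a => σ.real (a.eval σ)
  | .add u v => u.eval σ + v.eval σ
  | .sub u v => u.eval σ - v.eval σ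
  | .mul u v => u.eval σ * v.eval σ
  | .div u v => u.eval σ / v.eval σ
  | .exp u => Real.exp (u.eval σ)
  | .log u => Real.log (u.eval σ)

def Test.Holds (σ : State) : Test → Prop
  | .natLE a b => a.eval σ ≤ b.eval σ
  | .realLE u v => u.eval σ ≤ v.eval σ
  | .not p => ¬ p.Holds σ
  | .and p q => p.Holds σ ∧ q.Holds σ

/-- The number of operations in an expression. -/
def NatExpr.cost : NatExpr → ℕ
  | .const _ => 1
  | .cell a => a.cost + 1
  | .add a b => a.cost + b.cost + 1
  | .sub a b => a.cost + b.cost + 1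

/-- The number of operations in an expression. -/
def RealExpr.cost : RealExpr → ℕ
  | .ofNat a => a.cost + 1
  | .cell a => a.cost + 1
  | .add u v => u.cost + v.cost + 1
  | .sub u v => u.cost + v.cost + 1
  | .mul u v => u.cost + v.cost + 1
  | .div u v => u.cost + v.cost + 1
  | .exp u => u.cost + 1
  | .log u => u.cost + 1

/-- The number of operations in a condition. -/
def Test.cost : Test → ℕ
  | .natLE a b => a.cost + b.cost + 1
  | .realLE u v => u.cost + v.cost + 1
  | .not p => p.cost + 1
  | .and p q => p.cost + q.cost + 1

/-- `Runs P σ t τ`: started in the state `σ`, the program `P` halts in the state `τ` after exactly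
`t` steps. -/
inductive Runs : Program → State → ℕ → State → Prop
  | skip (σ : State) : Runs .skip σ 1 σ
  | setNat (a v : NatExpr) (σ : State) :
      Runs (.setNat a v) σ (a.cost + v.cost + 1)
        { σ with nat := Function.update σ.nat (a.eval σ) (v.eval σ) }
  | setReal (a : NatExpr) (v : RealExpr) (σ : State) :
      Runs (.setReal a v) σ (a.cost + v.cost + 1)
        { σ with real := Function.update σ.real (a.eval σ) (v.eval σ) }
  | seq {P Q : Program} {σ σ' σ'' : State} {t t' : ℕ} :
      Runs P σ t σ' → Runs Q σ' t' σ'' → Runs (.seq P Q) σ (t + t') σ''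
  | iteTrue {p : Test} {P Q : Program} {σ σ' : State} {t : ℕ} :
      p.Holds σ → Runs P σ t σ' → Runs (.ite p P Q) σ (p.cost + t) σ'
  | iteFalse {p : Test} {P Q : Program} {σ σ' : State} {t : ℕ} :
      ¬ p.Holds σ → Runs Q σ t σ' → Runs (.ite p P Q) σ (p.cost + t) σ'
  | loopTrue {p : Test} {P : Program} {σ σ' σ'' : State} {t t' : ℕ} :
      p.Holds σ → Runs P σ t σ' → Runs (.loop p P) σ' t' σ'' →
        Runs (.loop p P) σ (p.cost + t + t') σ''
  | loopFalse {p : Test} {P : Program} {σ : State} :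
      ¬ p.Holds σ → Runs (.loop p P) σ p.cost σ

end RealRAM

/-! ### Supervised restricted Boltzmann machines -/

/-- The real number `1` or `-1` given by an element of `{±1}`. -/
def spin (u : ℤˣ) : ℝ := ((u : ℤ) : ℝ)

/-- The vector in `ℝⁿ` given by an element of `{±1}ⁿ`. -/
def spins {n : ℕ} (x : Fin n → ℤˣ) : Fin n → ℝ := fun i => spin (x i)

/-- The parameters of a supervised RBM with `n₁` visible units, `n₂` hidden units and a label:
the interaction matrix `W`, the weights `w` between hidden units and label, and the biases of
visible units, hidden units and label. -/
structure SupervisedRBM (n₁ n₂ : ℕ) where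
  W : Matrix (Fin n₁) (Fin n₂) ℝ
  w : Fin n₂ → ℝ
  b₁ : Fin n₁ → ℝ
  b₂ : Fin n₂ → ℝ
  b₃ : ℝ

namespace SupervisedRBM

variable {n₁ n₂ : ℕ} (R : SupervisedRBM n₁ n₂)

/-- The unnormalized probability of `X = x, H = h, Y = y`. -/
noncomputable def weight (x : Fin n₁ → ℤˣ) (h : Fin n₂ → ℤˣ) (y : ℤˣ) : ℝ :=
  Real.exp (spins x ⬝ᵥ (R.W *ᵥ spins h) + (spins h ⬝ᵥ R.w) * spin y
    + R.b₁ ⬝ᵥ spins x + R.b₂ ⬝ᵥ spins h + R.b₃ * spin y)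

/-- The normalizing constant. -/
noncomputable def partition : ℝ :=
  ∑ x : Fin n₁ → ℤˣ, ∑ h : Fin n₂ → ℤˣ, ∑ y : ℤˣ, R.weight x h y

/-- `Pr[X = x, H = h, Y = y]`. -/
noncomputable def jointProb (x : Fin n₁ → ℤˣ) (h : Fin n₂ → ℤˣ) (y : ℤˣ) : ℝ :=
  R.weight x h y / R.partition

/-- `Pr[X = x, Y = y]`, the law of an observed labelled example. -/
noncomputable def obsProb (x : Fin n₁ → ℤˣ) (y : ℤˣ) : ℝ :=
  ∑ h : Fin n₂ → ℤˣ, R.jointProb x h y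

/-- `Pr[Y = y]`. -/
noncomputable def labelProb (y : ℤˣ) : ℝ :=
  ∑ x : Fin n₁ → ℤˣ, R.obsProb x y

/-- `E[Y | X = x]`. -/
noncomputable def condLabelMean (x : Fin n₁ → ℤˣ) : ℝ :=
  (∑ y : ℤˣ, spin y * R.obsProb x y) / ∑ y : ℤˣ, R.obsProb x y

/-- Ferromagnetic interactions of minimum strength `α` between visible and hidden units. -/
def MinFerromagnetic (α : ℝ) : Prop :=
  ∀ i j, R.W i j = 0 ∨ α ≤ R.W i j

/-- Sparsity of the visible units, and of the hidden units after conditioning on one of the two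
values of the label. -/
def CondSparse (lam : ℝ) : Prop :=
  (∀ i, ∑ j, R.W i j + |R.b₁ i| ≤ lam) ∧
    ∃ y : ℤˣ, ∀ j, ∑ i, R.W i j + |R.b₂ j + spin y * R.w j| ≤ lam

/-- Both label values have probability at least `β`. -/
def BalancedLabel (β : ℝ) : Prop :=
  ∀ y : ℤˣ, β ≤ R.labelProb y

/-- `E[Y | X = x] = tanh (f x + b)` with `|b| ≤ B`, where `f` is a multilinear polynomial without
constant term. -/
def BoundedBias (B : ℝ) : Prop :=
  ∃ (c : Finset (Fin n₁) → ℝ) (b : ℝ), c ∅ = 0 ∧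
    (∀ x, R.condLabelMean x = Real.tanh (∑ S, c S * ∏ i ∈ S, spin (x i) + b)) ∧ |b| ≤ B

end SupervisedRBM

/-- The logistic loss `ℓ(v, y) = log (1 + exp (-2 v y))`. -/
noncomputable def logisticLoss (v : ℝ) (y : ℤˣ) : ℝ :=
  Real.log (1 + Real.exp (-2 * v * spin y))

namespace SupervisedRBM

variable {n₁ n₂ : ℕ} (R : SupervisedRBM n₁ n₂)

/-- The expected logistic loss `E[ℓ(g(X), Y)]`. -/
noncomputable def risk (g : (Fin n₁ → ℤˣ) → ℝ) : ℝ :=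
  ∑ x : Fin n₁ → ℤˣ, ∑ y : ℤˣ, R.obsProb x y * logisticLoss (g x) y

/-- The probability of the event `E` about `m` independent labelled examples. -/
noncomputable def sampleProb {m : ℕ} (E : Set (Fin m → (Fin n₁ → ℤˣ) × ℤˣ)) : ℝ :=
  ∑ s : Fin m → (Fin n₁ → ℤˣ) × ℤˣ,
    E.indicator (fun s => ∏ t, R.obsProb (s t).1 (s t).2) s

end SupervisedRBM

/-! ### Input and output of a learning program -/

namespace RealRAM

/-- The initial state: the natural-number memory holds `n` and the number `m` of examples; the
real memory holds the six parameters and then the examples one after the other, the `n` features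
of an example followed by its label. All other cells are `0`. -/
noncomputable def input {n m : ℕ} (params : Fin 6 → ℝ)
    (s : Fin m → (Fin n → ℤˣ) × ℤˣ) : State where
  nat := fun a => if a = 0 then n else if a = 1 then m else 0
  real := fun a =>
    if ha : a < 6 then params ⟨a, ha⟩
    else if ht : (a - 6) / (n + 1) < m then
      if hi : (a - 6) % (n + 1) < n then spin ((s ⟨(a - 6) / (n + 1), ht⟩).1 ⟨(a - 6) % (n + 1), hi⟩)
      else spin (s ⟨(a - 6) / (n + 1), ht⟩).2
    else 0

/-- The predictor described by a final state: cell `0` of the natural-number memory holds the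
number of monomials; monomial number `t` has its coefficient in cell `t` of the real memory, and
contains the variable `x i` if and only if cell `1 + t * n + i` of the natural-number memory is
not `0`. -/
noncomputable def hypothesis (n : ℕ) (σ : State) (x : Fin n → ℤˣ) : ℝ :=
  ∑ t ∈ Finset.range (σ.nat 0),
    σ.real t * ∏ i : Fin n, if σ.nat (1 + t * n + i) = 0 then 1 else spin (x i)

end RealRAM

/-- `C n² exp(λ) ^ (exp(c₁ λ) (1/α)^c₂ (1/β)^c₃) log(n/δ) / ε²`. -/
noncomputable def sampleBound (C c₁ : ℝ) (c₂ c₃ : ℕ) (n : ℕ) (lam α β ε δ : ℝ) : ℝ :=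
  C * (n : ℝ) ^ 2 * Real.exp lam ^ (Real.exp (c₁ * lam) * (1 / α) ^ c₂ * (1 / β) ^ c₃)
    * Real.log (n / δ) / ε ^ 2

/-! ### A small language of array programs, compiled to real RAM programs -/

namespace ArrayProg

set_option linter.constructorNameAsVariable false
set_option linter.unusedSimpArgs false

open RealRAM

/-! Given features and label, the hidden units are independent, so summing them out leaves an
exponential times a product of hyperbolic cosines (`sum_weight`). The minimizer of the logistic loss
is half the log odds of the label (`lawRisk_logOdds_le`), and it equals a constant plus one function
per hidden unit, depending only on the visible neighbours of that unit (`logOdds_eq`). A unit has at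
most λ/α such neighbours, so the minimizer is a polynomial of controlled ℓ¹ norm whose monomials are
subsets of neighbourhoods (`exists_logOdds_coeff`). It remains to find a short list containing these
monomials and to do ℓ¹-bounded logistic regression on it; the two halves of the sample serve these
two purposes.

Structure. Because the interactions are ferromagnetic, the law of the visible units given the label
is log-supermodular, and the four functions theorem makes all conditional covariances nonnegative,
whatever visible units are conditioned on. If `u` and `v` share a hidden neighbour, then for the
label at which the hidden units are sparse the inequality is strict by a definite factor; no flip of
a single spin changes a probability by a factor above e^{2λ}, so the averaged covariance is at least
2θ with θ = `thrVal`, uniformly in the conditioning set (`lawStat_ge`). For each `u`, one pass over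
all `v` adds `v` to the set S when the empirical averaged covariance given S and the label reaches
θ. Off a rare event this misses no unit sharing a hidden neighbour with `u` (`mem_scan_of_near`).
The set stays small: every accepted unit lowers the empirical conditional variance of bit `u` by θ²
(`pot_insert_le`), so at most 1/θ² units enter (`card_scan_le`). Hence only events on about 1/θ²
features need to concentrate, which Hoeffding's inequality and a union bound give
(`iidProb_not_near_le`). The monomials are all subsets of S together with `u`.

Prediction. Exponentiated gradient with signed weights has regret logarithmic in the number of
monomials (`eg_regret`). Its predictor at each time depends on the past only, so Azuma's inequality
compares empirical and true excess risk (`eg_deviation`), and convexity passes to the averaged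
predictor (`eg_risk_le`).

Two regimes are separate. If ε ≥ 1, the zero predictor suffices. If λ < α, there are no
interactions, and a constant built from a smoothed label frequency is nearly optimal
(`const_success`).

The algorithm is written in a small array language whose loops are bounded by `n` or `m`; compiled
programs therefore halt in polynomial time and compute what the mathematical description says
(`Cmd.compile_runs`, `learnProg_run`). -/

/-- Names of arrays of natural numbers. Scalars are stored at index `0`. -/
inductive NV
  | n | m | X | rowX | M | half | cnt | start | top | rowF | F | S | par | u | v | s | r | i | t
  | agree | cN | cA | cB | cD
  deriving DecidableEq

/-- Names of arrays of real numbers. Scalars are stored at index `0`. -/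
inductive RV
  | lam | al | be | B | eps | del | thr | rad | eta | stat | Z | h | g | W | acc | chi
  deriving DecidableEq

def NV.idx : NV → ℕ
  | n => 0 | m => 1 | X => 2 | rowX => 3 | M => 4 | half => 5 | cnt => 6 | start => 7 | top => 8
  | rowF => 9 | F => 10 | S => 11 | par => 12 | u => 13 | v => 14 | s => 15 | r => 16 | i => 17
  | t => 18 | agree => 19 | cN => 20 | cA => 21 | cB => 22 | cD => 23

def RV.idx : RV → ℕ
  | lam => 0 | al => 1 | be => 2 | B => 3 | eps => 4 | del => 5 | thr => 6 | rad => 7 | eta => 8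
  | stat => 9 | Z => 10 | h => 11 | g => 12 | W => 13 | acc => 14 | chi => 15

def NV.ofIdx (k : ℕ) : NV :=
  [NV.n, .m, .X, .rowX, .M, .half, .cnt, .start, .top, .rowF, .F, .S, .par, .u, .v, .s, .r, .i, .t,
    .agree, .cN, .cA, .cB, .cD].getD k .n

def RV.ofIdx (k : ℕ) : RV :=
  [RV.lam, .al, .be, .B, .eps, .del, .thr, .rad, .eta, .stat, .Z, .h, .g, .W, .acc, .chi].getD k .lam

theorem NV.ofIdx_idx (a : NV) : NV.ofIdx a.idx = a := by cases a <;> rfl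
theorem RV.ofIdx_idx (a : RV) : RV.ofIdx a.idx = a := by cases a <;> rfl
theorem NV.idx_inj {a b : NV} (h : a.idx = b.idx) : a = b := by
  rw [← NV.ofIdx_idx a, h, NV.ofIdx_idx]
theorem RV.idx_inj {a b : RV} (h : a.idx = b.idx) : a = b := by
  rw [← RV.ofIdx_idx a, h, RV.ofIdx_idx]
theorem NV.idx_lt (a : NV) : a.idx < 32 := by cases a <;> decide
theorem RV.idx_lt (a : RV) : a.idx < 32 := by cases a <;> decide

/-- The contents of all arrays. -/
structure Env where
  N : NV → ℕ → ℕ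
  R : RV → ℕ → ℝ

/-- Arrays are interleaved with period 32, more than the number of names, so each is unbounded and
no two overlap. The cells holding `n`, `m` and the six parameters in the input are exactly the
scalars of the same names. -/
def envOf (σ : State) : Env :=
  ⟨fun a j => σ.nat (32 * j + a.idx), fun a j => σ.real (32 * j + a.idx)⟩

def Env.setN (e : Env) (a : NV) (j v : ℕ) : Env :=
  ⟨Function.update e.N a (Function.update (e.N a) j v), e.R⟩

def Env.setR (e : Env) (a : RV) (j : ℕ) (v : ℝ) : Env :=
  ⟨e.N, Function.update e.R a (Function.update (e.R a) j v)⟩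

@[simp] theorem Env.setN_R (e : Env) (a : NV) (j v : ℕ) : (e.setN a j v).R = e.R := rfl
@[simp] theorem Env.setR_N (e : Env) (a : RV) (j : ℕ) (v : ℝ) : (e.setR a j v).N = e.N := rfl
@[simp] theorem Env.setN_N_self (e : Env) (a : NV) (j v : ℕ) :
    (e.setN a j v).N a = Function.update (e.N a) j v := by simp [Env.setN]
@[simp] theorem Env.setN_N_ne (e : Env) {a b : NV} (h : b ≠ a) (j v : ℕ) :
    (e.setN a j v).N b = e.N b := by simp [Env.setN, h]
@[simp] theorem Env.setR_R_self (e : Env) (a : RV) (j : ℕ) (v : ℝ) :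
    (e.setR a j v).R a = Function.update (e.R a) j v := by simp [Env.setR]
@[simp] theorem Env.setR_R_ne (e : Env) {a b : RV} (h : b ≠ a) (j : ℕ) (v : ℝ) :
    (e.setR a j v).R b = e.R b := by simp [Env.setR, h]

theorem envOf_setNat (σ : State) (a : NV) (j v : ℕ) :
    envOf { σ with nat := Function.update σ.nat (32 * j + a.idx) v } = (envOf σ).setN a j v := by
  have h2 : (fun (b : NV) (k : ℕ) => Function.update σ.nat (32 * j + a.idx) v (32 * k + b.idx))
      = Function.update (envOf σ).N a (Function.update ((envOf σ).N a) j v) := by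
    funext b k
    by_cases hb : b = a
    · subst hb
      by_cases hk : k = j
      · subst hk; simp
      · simp [Function.update_apply, hk, envOf]
    · have : 32 * k + b.idx ≠ 32 * j + a.idx := by
        intro h
        have h1 := NV.idx_lt a
        have h3 := NV.idx_lt b
        exact hb (NV.idx_inj (by omega))
      simp [Function.update_apply, hb, this, envOf]
  simp only [envOf, Env.setN] at h2 ⊢
  rw [h2]

theorem envOf_setReal (σ : State) (a : RV) (j : ℕ) (v : ℝ) :
    envOf { σ with real := Function.update σ.real (32 * j + a.idx) v } = (envOf σ).setR a j v := by
  have h2 : (fun (b : RV) (k : ℕ) => Function.update σ.real (32 * j + a.idx) v (32 * k + b.idx))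
      = Function.update (envOf σ).R a (Function.update ((envOf σ).R a) j v) := by
    funext b k
    by_cases hb : b = a
    · subst hb
      by_cases hk : k = j
      · subst hk; simp
      · simp [Function.update_apply, hk, envOf]
    · have : 32 * k + b.idx ≠ 32 * j + a.idx := by
        intro h
        have h1 := RV.idx_lt a
        have h3 := RV.idx_lt b
        exact hb (RV.idx_inj (by omega))
      simp [Function.update_apply, hb, this, envOf]
  simp only [envOf, Env.setR] at h2 ⊢
  rw [h2]

/-- Expressions for natural numbers. -/
inductive NE
  | const (k : ℕ)
  | get (a : NV) (j : NE)
  | add (x y : NE)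

/-- Expressions for real numbers. -/
inductive RE
  | ofNat (x : NE)
  | get (a : RV) (j : NE)
  | add (x y : RE)
  | sub (x y : RE)
  | mul (x y : RE)
  | div (x y : RE)
  | exp (x : RE)
  | log (x : RE)

/-- Conditions. -/
inductive BE
  | le (x y : NE)
  | rle (x y : RE)
  | not (p : BE)
  | and (p q : BE)

@[simp] def NE.eval (e : Env) : NE → ℕ
  | .const k => k
  | .get a j => e.N a (j.eval e)
  | .add x y => x.eval e + y.eval e

@[simp] noncomputable def RE.eval (e : Env) : RE → ℝ
  | .ofNat x => (x.eval e : ℝ)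
  | .get a j => e.R a (j.eval e)
  | .add x y => x.eval e + y.eval e
  | .sub x y => x.eval e - y.eval e
  | .mul x y => x.eval e * y.eval e
  | .div x y => x.eval e / y.eval e
  | .exp x => Real.exp (x.eval e)
  | .log x => Real.log (x.eval e)

@[simp] def BE.Holds (e : Env) : BE → Prop
  | .le x y => x.eval e ≤ y.eval e
  | .rle x y => x.eval e ≤ y.eval e
  | .not p => ¬ p.Holds e
  | .and p q => p.Holds e ∧ q.Holds e

/-- Naturals cannot be multiplied on the machine; five doublings give the factor 32 of an address.
-/
def double (x : NatExpr) : NatExpr := .add x x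

/-- The address of entry `j` of the array number `a`. -/
def addr (a : ℕ) (j : NatExpr) : NatExpr :=
  .add (double (double (double (double (double j))))) (.const a)

theorem addr_eval (σ : State) (a : ℕ) (j : NatExpr) :
    (addr a j).eval σ = 32 * j.eval σ + a := by
  simp only [addr, double, NatExpr.eval]; ring

def NE.compile : NE → NatExpr
  | .const k => .const k
  | .get a j => .cell (addr a.idx j.compile)
  | .add x y => .add x.compile y.compile

def RE.compile : RE → RealExpr
  | .ofNat x => .ofNat x.compile
  | .get a j => .cell (addr a.idx j.compile)
  | .add x y => .add x.compile y.compile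
  | .sub x y => .sub x.compile y.compile
  | .mul x y => .mul x.compile y.compile
  | .div x y => .div x.compile y.compile
  | .exp x => .exp x.compile
  | .log x => .log x.compile

def BE.compile : BE → Test
  | .le x y => .natLE x.compile y.compile
  | .rle x y => .realLE x.compile y.compile
  | .not p => .not p.compile
  | .and p q => .and p.compile q.compile

theorem NE.compile_eval (σ : State) (x : NE) : x.compile.eval σ = x.eval (envOf σ) := by
  induction x with
  | const k => rfl
  | get a j ih => simp [compile, NatExpr.eval, addr_eval, ih, envOf]
  | add x y hx hy => simp [compile, NatExpr.eval, hx, hy]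

theorem RE.compile_eval (σ : State) (x : RE) : x.compile.eval σ = x.eval (envOf σ) := by
  induction x with
  | ofNat x => simp [compile, RealExpr.eval, NE.compile_eval]
  | get a j => simp [compile, RealExpr.eval, addr_eval, NE.compile_eval, envOf]
  | _ => simp [compile, RealExpr.eval, *]

theorem BE.compile_holds (σ : State) (p : BE) : p.compile.Holds σ ↔ p.Holds (envOf σ) := by
  induction p with
  | le x y => simp [compile, Test.Holds, NE.compile_eval]
  | rle x y => simp [compile, Test.Holds, RE.compile_eval]
  | _ => simp [compile, Test.Holds, *]

/-- Commands; `loop i hi c` runs `c` with `i` running from `0` up to the value of `hi`. -/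
inductive Cmd
  | skip
  | setN (a : NV) (j v : NE)
  | setR (a : RV) (j : NE) (v : RE)
  | seq (c d : Cmd)
  | ite (p : BE) (c d : Cmd)
  | loop (i hi : NV) (c : Cmd)

infixr:60 " ;; " => Cmd.seq

-- The bound of a loop is read once, before the first pass, so every command is a total function.
-- The compiled loop rereads its bound; `Cmd.wf` ensures that the body does not change it.
open Classical in
noncomputable def Cmd.run : Cmd → Env → Env
  | .skip, e => e
  | .setN a j v, e => e.setN a (j.eval e) (v.eval e)
  | .setR a j v, e => e.setR a (j.eval e) (v.eval e)
  | .seq c d, e => d.run (c.run e)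
  | .ite p c d, e => if p.Holds e then c.run e else d.run e
  | .loop i hi c, e =>
      (fun e => (c.run e).setN i 0 ((c.run e).N i 0 + 1))^[e.N hi 0] (e.setN i 0 0)

def Cmd.writesN : Cmd → List NV
  | .setN a _ _ => [a]
  | .seq c d => c.writesN ++ d.writesN
  | .ite _ c d => c.writesN ++ d.writesN
  | .loop i _ c => i :: c.writesN
  | _ => []

def Cmd.writesR : Cmd → List RV
  | .setR a _ _ => [a]
  | .seq c d => c.writesR ++ d.writesR
  | .ite _ c d => c.writesR ++ d.writesR
  | .loop _ _ c => c.writesR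
  | _ => []

/-- No command writes to `n` or `m`, every loop has bound `n` or `m`, and the body of a loop does
not change the loop variable. -/
def Cmd.wf : Cmd → Bool
  | .setN a _ _ => decide (a ≠ .n ∧ a ≠ .m)
  | .seq c d => c.wf && d.wf
  | .ite _ c d => c.wf && d.wf
  | .loop i hi c =>
      c.wf && decide (i ≠ .n ∧ i ≠ .m ∧ (hi = .n ∨ hi = .m) ∧ i ∉ c.writesN)
  | _ => true

def Cmd.compile : Cmd → Program
  | .skip => .skip
  | .setN a j v => .setNat (addr a.idx j.compile) v.compile
  | .setR a j v => .setReal (addr a.idx j.compile) v.compile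
  | .seq c d => .seq c.compile d.compile
  | .ite p c d => .ite p.compile c.compile d.compile
  | .loop i hi c =>
      .seq (.setNat (addr i.idx (.const 0)) (.const 0))
        (.loop (.natLE (.add (.cell (addr i.idx (.const 0))) (.const 1))
            (.cell (addr hi.idx (.const 0))))
          (.seq c.compile
            (.setNat (addr i.idx (.const 0)) (.add (.cell (addr i.idx (.const 0))) (.const 1)))))

/-- Frame rule: the arrays a command can touch are visible from its syntax, so claims that others
are unchanged reduce to a decidable membership. -/
theorem Cmd.run_N (c : Cmd) : ∀ (e : Env) (a : NV), a ∉ c.writesN → (c.run e).N a = e.N a := by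
  induction c with
  | skip => intros; rfl
  | setN b j v => intro e a h; simp [writesN] at h; simp [run, h]
  | setR b j v => intros; simp [run]
  | seq c d hc hd => intro e a h; simp [writesN] at h; simp [run, hc _ _ h.1, hd _ _ h.2]
  | ite p c d hc hd =>
    intro e a h; simp [writesN] at h
    simp only [run]; split_ifs
    · exact hc _ _ h.1
    · exact hd _ _ h.2
  | loop i hi c hc =>
    intro e a h; simp [writesN] at h
    simp only [run]
    generalize e.N hi 0 = k
    have : ∀ e' : Env, ((fun e => (c.run e).setN i 0 ((c.run e).N i 0 + 1))^[k] e').N a = e'.N a := by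
      induction k with
      | zero => intro e'; rfl
      | succ k ih => intro e'; rw [Function.iterate_succ_apply, ih]; simp [h.1, hc _ _ h.2]
    rw [this]; simp [h.1]

theorem Cmd.run_R (c : Cmd) : ∀ (e : Env) (a : RV), a ∉ c.writesR → (c.run e).R a = e.R a := by
  induction c with
  | skip => intros; rfl
  | setR b j v => intro e a h; simp [writesR] at h; simp [run, h]
  | setN b j v => intros; simp [run]
  | seq c d hc hd => intro e a h; simp [writesR] at h; simp [run, hc _ _ h.1, hd _ _ h.2]
  | ite p c d hc hd =>
    intro e a h; simp [writesR] at h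
    simp only [run]; split_ifs
    · exact hc _ _ h.1
    · exact hd _ _ h.2
  | loop i hi c hc =>
    intro e a h; simp only [writesR] at h
    simp only [run]
    generalize e.N hi 0 = k
    have : ∀ e' : Env, ((fun e => (c.run e).setN i 0 ((c.run e).N i 0 + 1))^[k] e').R a = e'.R a := by
      induction k with
      | zero => intro e'; rfl
      | succ k ih => intro e'; rw [Function.iterate_succ_apply, ih]; simp [hc _ _ h]
    rw [this]; simp

theorem Cmd.not_mem_writesN (c : Cmd) (h : c.wf = true) : NV.n ∉ c.writesN ∧ NV.m ∉ c.writesN := by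
  induction c with
  | setN a j v => simp [wf] at h; simp [writesN]; exact ⟨Ne.symm h.1, Ne.symm h.2⟩
  | seq c d hc hd => simp [wf] at h; simp [writesN, hc h.1, hd h.2]
  | ite p c d hc hd => simp [wf] at h; simp [writesN, hc h.1, hd h.2]
  | loop i hi c hc =>
    simp [wf] at h; simp [writesN, hc h.1]
    exact ⟨Ne.symm h.2.1, Ne.symm h.2.2.1⟩
  | _ => simp [writesN]

/-- Loop invariants. -/
theorem Cmd.loop_inv {i hi : NV} {c : Cmd} (hi' : i ∉ c.writesN) (e : Env) (P : ℕ → Env → Prop)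
    (h0 : P 0 (e.setN i 0 0))
    (hs : ∀ k < e.N hi 0, ∀ e' : Env, (∀ a, a ≠ i → a ∉ c.writesN → e'.N a = e.N a) →
      (∀ a, a ∉ c.writesR → e'.R a = e.R a) → e'.N i 0 = k → P k e' →
      P (k + 1) ((c.run e').setN i 0 (k + 1))) :
    P (e.N hi 0) ((Cmd.loop i hi c).run e) := by
  simp only [run]
  -- The counter value and the frame conditions travel with the invariant through the induction, so
  -- that users of the rule get them for free.
  have key : ∀ k ≤ e.N hi 0, ∀ e', e' = ((fun e => (c.run e).setN i 0 ((c.run e).N i 0 + 1))^[k]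
      (e.setN i 0 0)) →
      P k e' ∧ e'.N i 0 = k ∧ (∀ a, a ≠ i → a ∉ c.writesN → e'.N a = e.N a) ∧
      (∀ a, a ∉ c.writesR → e'.R a = e.R a) := by
    intro k
    induction k with
    | zero =>
      rintro - e' rfl
      refine ⟨h0, by simp, ?_, ?_⟩
      · intro a ha _; simp [ha]
      · intro a _; simp
    | succ k ih =>
      intro hk e' he'
      rw [Function.iterate_succ_apply'] at he'
      obtain ⟨h1, h2, h3, h4⟩ := ih (by omega) _ rfl
      have h5 := hs k (by omega) _ h3 h4 h2 h1
      have h6 := congrFun (c.run_N ((fun e => (c.run e).setN i 0 ((c.run e).N i 0 + 1))^[k]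
        (e.setN i 0 0)) i hi') 0
      rw [h2] at h6
      rw [h6] at he'
      subst he'
      refine ⟨h5, by simp, ?_, ?_⟩
      · intro a ha hc; simp [ha, c.run_N _ _ hc, h3 a ha hc]
      · intro a hc; simp [c.run_R _ _ hc, h4 a hc]
  exact (key _ le_rfl _ rfl).1

theorem poly_le {K k K' k' B : ℕ} (hB : 1 ≤ B) (hK : K ≤ K') (hk : k ≤ k') :
    K * B ^ k ≤ K' * B ^ k' :=
  Nat.mul_le_mul hK (Nat.pow_le_pow_right hB hk)

/-- Compiled commands compute what they should, in polynomial time. -/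
theorem Cmd.compile_runs (c : Cmd) (h : c.wf = true) :
    ∃ K k : ℕ, ∀ (σ : State) (B : ℕ), 1 ≤ B → σ.nat 0 ≤ B → σ.nat 1 ≤ B →
      ∃ t ≤ K * B ^ k, ∃ τ, Runs c.compile σ t τ ∧ envOf τ = c.run (envOf σ) ∧
        (c.writesR = [] → τ.real = σ.real) := by
  induction c with
  | skip =>
    exact ⟨1, 0, fun σ B _ _ _ => ⟨1, by simp, σ, Runs.skip σ, rfl, fun _ => rfl⟩⟩
  | setN a j v =>
    refine ⟨(addr a.idx j.compile).cost + v.compile.cost + 1, 0, fun σ B _ _ _ =>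
      ⟨_, by simp, _, Runs.setNat _ _ σ, ?_, fun _ => rfl⟩⟩
    rw [addr_eval, envOf_setNat, NE.compile_eval, NE.compile_eval]; rfl
  | setR a j v =>
    refine ⟨(addr a.idx j.compile).cost + v.compile.cost + 1, 0, fun σ B _ _ _ =>
      ⟨_, by simp, _, Runs.setReal _ _ σ, ?_, fun h => by simp [writesR] at h⟩⟩
    rw [addr_eval, envOf_setReal, NE.compile_eval, RE.compile_eval]; rfl
  | seq c d hc hd =>
    simp [wf] at h
    obtain ⟨K, k, hc'⟩ := hc h.1
    obtain ⟨K', k', hd'⟩ := hd h.2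
    refine ⟨K + K', max k k', fun σ B hB h0 h1 => ?_⟩
    obtain ⟨t, ht, τ, hr, he, hf⟩ := hc' σ B hB h0 h1
    have hn : τ.nat 0 = σ.nat 0 := by
      have := congrFun (c.run_N (envOf σ) .n (c.not_mem_writesN h.1).1) 0
      rw [← he] at this; simpa [envOf, NV.idx] using this
    have hm : τ.nat 1 = σ.nat 1 := by
      have := congrFun (c.run_N (envOf σ) .m (c.not_mem_writesN h.1).2) 0
      rw [← he] at this; simpa [envOf, NV.idx] using this
    obtain ⟨t', ht', τ', hr', he', hf'⟩ := hd' τ B hB (hn ▸ h0) (hm ▸ h1)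
    refine ⟨t + t', ?_, τ', Runs.seq hr hr', ?_, ?_⟩
    · have := poly_le hB (le_refl K) (le_max_left k k')
      have := poly_le hB (le_refl K') (le_max_right k k')
      rw [add_mul]; omega
    · rw [he', he]; rfl
    · intro hw; simp [writesR] at hw; rw [hf' hw.2, hf hw.1]
  | ite p c d hc hd =>
    simp [wf] at h
    obtain ⟨K, k, hc'⟩ := hc h.1
    obtain ⟨K', k', hd'⟩ := hd h.2
    refine ⟨p.compile.cost + (K + K'), max k k', fun σ B hB h0 h1 => ?_⟩
    have e1 := poly_le hB (le_refl K) (le_max_left k k')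
    have e2 := poly_le hB (le_refl K') (le_max_right k k')
    have e3 := poly_le hB (le_refl p.compile.cost) (Nat.zero_le (max k k'))
    rw [pow_zero, mul_one] at e3
    by_cases hp : p.Holds (envOf σ)
    · obtain ⟨t, ht, τ, hr, he, hf⟩ := hc' σ B hB h0 h1
      refine ⟨_, ?_, τ, Runs.iteTrue ((p.compile_holds σ).2 hp) hr, ?_, ?_⟩
      · rw [add_mul, add_mul]; omega
      · simp [run, hp, he]
      · intro hw; simp [writesR] at hw; rw [hf hw.1]
    · obtain ⟨t, ht, τ, hr, he, hf⟩ := hd' σ B hB h0 h1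
      refine ⟨_, ?_, τ, Runs.iteFalse (fun h => hp ((p.compile_holds σ).1 h)) hr, ?_, ?_⟩
      · rw [add_mul, add_mul]; omega
      · simp [run, hp, he]
      · intro hw; simp [writesR] at hw; rw [hf hw.2]
  | loop i hi c hc =>
    simp [wf] at h
    obtain ⟨hcw, hin, him, hhi, hiw⟩ := h
    obtain ⟨K, k, hc'⟩ := hc hcw
    have hhiw : hi ∉ c.writesN := by
      rcases hhi with rfl | rfl
      exacts [(c.not_mem_writesN hcw).1, (c.not_mem_writesN hcw).2]
    have hihi : hi ≠ i := by rcases hhi with rfl | rfl; exacts [Ne.symm hin, Ne.symm him]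
    set test : Test := .natLE (.add (.cell (addr i.idx (.const 0))) (.const 1))
            (.cell (addr hi.idx (.const 0))) with htest
    set inc : Program :=
      .setNat (addr i.idx (.const 0)) (.add (.cell (addr i.idx (.const 0))) (.const 1)) with hinc
    set ic : ℕ := (addr i.idx (.const 0)).cost +
      (NatExpr.add (.cell (addr i.idx (.const 0))) (.const 1)).cost + 1 with hic
    set f : Env → Env := fun e => (c.run e).setN i 0 ((c.run e).N i 0 + 1) with hf
    -- Induction on the number `d` of passes left. The same bound for one pass applies throughout,
    -- since the body leaves `n` and `m` alone.
    have main : ∀ d : ℕ, ∀ (σ : State) (B : ℕ), 1 ≤ B → σ.nat 0 ≤ B → σ.nat 1 ≤ B →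
        (envOf σ).N i 0 + d = (envOf σ).N hi 0 →
        ∃ t ≤ d * (test.cost + K * B ^ k + ic) + test.cost, ∃ τ,
          Runs (.loop test (.seq c.compile inc)) σ t τ ∧ envOf τ = f^[d] (envOf σ) ∧
            (c.writesR = [] → τ.real = σ.real) := by
      intro d
      induction d with
      | zero =>
        intro σ B hB h0 h1 hd
        refine ⟨test.cost, by simp, σ, Runs.loopFalse ?_, rfl, fun _ => rfl⟩
        simp only [htest, Test.Holds, NatExpr.eval, addr_eval]
        simp only [envOf] at hd; omega
      | succ d ih =>
        intro σ B hB h0 h1 hd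
        obtain ⟨t, ht, τ, hr, he, hfr⟩ := hc' σ B hB h0 h1
        have hkeep : ∀ a, a ∉ c.writesN → (envOf τ).N a = (envOf σ).N a := fun a ha => by
          rw [he, c.run_N _ _ ha]
        have hinc' := Runs.setNat (addr i.idx (.const 0))
          (.add (.cell (addr i.idx (.const 0))) (.const 1)) τ
        set τ' : State := _ with hτ'
        change Runs inc τ ic τ' at hinc'
        have heτ' : envOf τ' = f (envOf σ) := by
          rw [hτ', addr_eval, envOf_setNat]
          simp only [hf, ← he]
          simp [NatExpr.eval, addr_eval, envOf]
        have hnn : ∀ a, a ≠ i → a ∉ c.writesN → (envOf τ').N a = (envOf σ).N a := fun a ha hw => by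
          rw [heτ']; simp [hf, ha, c.run_N _ _ hw]
        have hii : (envOf τ').N i 0 = (envOf σ).N i 0 + 1 := by
          rw [heτ']; simp [hf, c.run_N _ _ hiw]
        have h0' : τ'.nat 0 = σ.nat 0 := by
          have := congrFun (hnn .n (Ne.symm hin) (c.not_mem_writesN hcw).1) 0
          simpa [envOf, NV.idx] using this
        have h1' : τ'.nat 1 = σ.nat 1 := by
          have := congrFun (hnn .m (Ne.symm him) (c.not_mem_writesN hcw).2) 0
          simpa [envOf, NV.idx] using this
        obtain ⟨t', ht', τ'', hr'', he'', hf''⟩ := ih τ' B hB (h0' ▸ h0) (h1' ▸ h1) (by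
          rw [hii, hnn hi hihi hhiw]; omega)
        refine ⟨_, ?_, τ'', Runs.loopTrue ?_ (Runs.seq hr hinc') hr'', ?_, ?_⟩
        · have : (d + 1) * (test.cost + K * B ^ k + ic)
            = d * (test.cost + K * B ^ k + ic) + (test.cost + K * B ^ k + ic) := by ring
          omega
        · simp only [htest, Test.Holds, NatExpr.eval, addr_eval]
          simp only [envOf] at hd; omega
        · rw [he'', heτ', Function.iterate_succ_apply]
        · intro hw; rw [hf'' hw, hτ']; exact hfr hw
    set st : ℕ := (addr i.idx (.const 0)).cost + (NatExpr.const 0).cost + 1 with hst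
    -- A loop makes at most `B` passes, so nesting costs one more power of `B`.
    refine ⟨st + (test.cost + K + ic) + test.cost, k + 1, fun σ B hB h0 h1 => ?_⟩
    have hset := Runs.setNat (addr i.idx (.const 0)) (.const 0) σ
    set τ : State := _ with hτ
    change Runs _ σ st τ at hset
    have heτ : envOf τ = (envOf σ).setN i 0 0 := by
      rw [hτ, addr_eval, envOf_setNat]; rfl
    have hnn : ∀ a, a ≠ i → (envOf τ).N a = (envOf σ).N a := fun a ha => by
      rw [heτ]; simp [ha]
    have h0' : τ.nat 0 = σ.nat 0 := by
      have := congrFun (hnn .n (Ne.symm hin)) 0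
      simpa [envOf, NV.idx] using this
    have h1' : τ.nat 1 = σ.nat 1 := by
      have := congrFun (hnn .m (Ne.symm him)) 0
      simpa [envOf, NV.idx] using this
    have hhiB : (envOf σ).N hi 0 ≤ B := by
      rcases hhi with rfl | rfl
      · simpa [envOf, NV.idx] using h0
      · simpa [envOf, NV.idx] using h1
    obtain ⟨t, ht, τ', hr, he, hfr⟩ := main ((envOf σ).N hi 0) τ B hB (h0' ▸ h0) (h1' ▸ h1) (by
      rw [hnn hi hihi, heτ]; simp)
    refine ⟨_, ?_, τ', Runs.seq hset hr, ?_, ?_⟩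
    · have h2 : (envOf σ).N hi 0 * (test.cost + K * B ^ k + ic) ≤
          B * ((test.cost + K + ic) * B ^ k) := by
        apply Nat.mul_le_mul hhiB
        have := Nat.one_le_pow k B hB
        nlinarith
      have h3 : 1 ≤ B ^ (k + 1) := Nat.one_le_pow _ B hB
      have h4 : B * ((test.cost + K + ic) * B ^ k) = (test.cost + K + ic) * B ^ (k + 1) := by ring
      nlinarith
    · rw [he, heτ]; rfl
    · intro hw; rw [hfr hw, hτ]

end ArrayProg

/-! ### The learning algorithm as a function of the sample -/

namespace RBMLearn

/-- A labelled example. -/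
abbrev Example (n : ℕ) := (Fin n → ℤˣ) × ℤˣ

/-- The restriction of an example to the features in `S` and the label. -/
def key {n : ℕ} (S : Finset (Fin n)) (z : Example n) : Example n :=
  (fun i => if i ∈ S then z.1 i else 1, z.2)

theorem key_eq_iff {n : ℕ} {S : Finset (Fin n)} {z z' : Example n} :
    key S z = key S z' ↔ z.2 = z'.2 ∧ ∀ i ∈ S, z.1 i = z'.1 i := by
  simp only [key, Prod.mk.injEq, funext_iff]
  constructor
  · rintro ⟨h, h'⟩
    refine ⟨h', fun i hi => ?_⟩
    simpa [hi] using h i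
  · rintro ⟨h, h'⟩
    refine ⟨fun i => ?_, h⟩
    split_ifs with hi
    exacts [h' i hi, rfl]

/-- `1` for the spin `1` and `0` for the spin `-1`. -/
def bit (u : ℤˣ) : ℕ := if u = 1 then 1 else 0

theorem bit_inj {u v : ℤˣ} : bit u = bit v ↔ u = v := by
  rcases Int.units_eq_one_or u with rfl | rfl <;> rcases Int.units_eq_one_or v with rfl | rfl <;>
    simp [bit]

theorem spin_eq_bit (u : ℤˣ) : spin u = (bit u + bit u : ℕ) - 1 := by
  rcases Int.units_eq_one_or u with rfl | rfl <;> norm_num [bit, spin]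

/-- The sum over the first `M` examples of the conditional covariance of the bits number `u` and
`v` given the features in `S` and the label, under the empirical law. -/
noncomputable def empStat {n : ℕ} (z : ℕ → Example n) (M : ℕ) (S : Finset (Fin n)) (u v : Fin n) :
    ℝ :=
  ∑ s ∈ Finset.range M,
    ((∑ r ∈ Finset.range M with key S (z s) = key S (z r), bit ((z r).1 u) * bit ((z r).1 v) : ℕ) /
      (∑ r ∈ Finset.range M with key S (z s) = key S (z r), 1 : ℕ) -
    (∑ r ∈ Finset.range M with key S (z s) = key S (z r), bit ((z r).1 u) : ℕ) *
      (∑ r ∈ Finset.range M with key S (z s) = key S (z r), bit ((z r).1 v) : ℕ) /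
      ((∑ r ∈ Finset.range M with key S (z s) = key S (z r), 1 : ℕ) *
        (∑ r ∈ Finset.range M with key S (z s) = key S (z r), 1 : ℕ)) : ℝ)

/-- The features selected for the unit `u` among the first `k` ones, and the list of all subsets of
these features and `u`. -/
noncomputable def scan {n : ℕ} (z : ℕ → Example n) (M : ℕ) (th : ℝ) (u : Fin n) :
    ℕ → Finset (Fin n) × List (Finset (Fin n))
  | 0 => (∅, [∅])
  | k + 1 =>
    if h : k < n then
      -- The unit `u` may occur in every monomial but is never conditioned on.
      if (⟨k, h⟩ : Fin n) = u then
        ((scan z M th u k).1, (scan z M th u k).2 ++ (scan z M th u k).2.map (insert ⟨k, h⟩))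
      else if th ≤ empStat z M (scan z M th u k).1 u ⟨k, h⟩ then
        (insert ⟨k, h⟩ (scan z M th u k).1,
          (scan z M th u k).2 ++ (scan z M th u k).2.map (insert ⟨k, h⟩))
      else scan z M th u k
    else scan z M th u k

/-- The monomials used for prediction, from the first `k` units. -/
noncomputable def feats {n : ℕ} (z : ℕ → Example n) (M : ℕ) (th : ℝ) : ℕ → List (Finset (Fin n))
  | 0 => [∅]
  | k + 1 => if h : k < n then feats z M th k ++ (scan z M th ⟨k, h⟩ n).2 else feats z M th k

/-- The monomial given by a set of variables. -/
noncomputable def monom {n : ℕ} (A : Finset (Fin n)) (x : Fin n → ℤˣ) : ℝ := ∏ i ∈ A, spin (x i)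

/-- The normalization of the exponential weights. -/
noncomputable def egNorm (N : ℕ) (W : ℕ → ℝ) : ℝ :=
  ∑ j ∈ Finset.range N, (Real.exp (W j) + Real.exp (-W j))

/-- The prediction of the exponentiated gradient algorithm with parameters `W`. -/
noncomputable def egPred {n : ℕ} (L : List (Finset (Fin n))) (rad : ℝ) (W : ℕ → ℝ)
    (x : Fin n → ℤˣ) : ℝ :=
  rad * (∑ j ∈ Finset.range L.length, (Real.exp (W j) - Real.exp (-W j)) * monom (L.getD j ∅) x) /
    egNorm L.length W

/-- The derivative of the logistic loss. -/
noncomputable def lossDeriv (v : ℝ) (y : ℤˣ) : ℝ :=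
  -2 * spin y / (1 + Real.exp (2 * spin y * v))

/-- The parameters of the exponentiated gradient algorithm, which ignores the first `M` examples. -/
noncomputable def egW {n : ℕ} (L : List (Finset (Fin n))) (M : ℕ) (rad eta : ℝ)
    (z : ℕ → Example n) : ℕ → ℕ → ℝ
  | 0 => fun _ => 0
  | s + 1 => fun j =>
    if M ≤ s then
      egW L M rad eta z s j - eta * lossDeriv (egPred L rad (egW L M rad eta z s) (z s).1) (z s).2 *
        monom (L.getD j ∅) (z s).1
    else egW L M rad eta z s j

/-- The sum of the coefficients of the monomial number `j` in the predictors used for the examples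
from number `M` on and before number `s`. -/
noncomputable def egAcc {n : ℕ} (L : List (Finset (Fin n))) (M : ℕ) (rad eta : ℝ)
    (z : ℕ → Example n) (s j : ℕ) : ℝ :=
  ∑ t ∈ Finset.Ico M s,
    rad * (Real.exp (egW L M rad eta z t j) - Real.exp (-egW L M rad eta z t j)) /
      egNorm L.length (egW L M rad eta z t)

end RBMLearn

/-! ### Programs for the empirical conditional covariances -/

namespace ArrayProg

set_option linter.constructorNameAsVariable false
set_option linter.unusedSimpArgs false

open RBMLearn

/-- A scalar. -/
abbrev sc (a : NV) : NE := .get a (.const 0)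
abbrev rsc (a : RV) : RE := .get a (.const 0)
abbrev rc (k : ℕ) : RE := .ofNat (.const k)
abbrev assign (a : NV) (v : NE) : Cmd := .setN a (.const 0) v
abbrev rassign (a : RV) (v : RE) : Cmd := .setR a (.const 0) v
abbrev incr (a : NV) : Cmd := assign a (.add (sc a) (.const 1))
abbrev BE.eq (x y : NE) : BE := .and (.le x y) (.le y x)
abbrev BE.lt (x y : NE) : BE := .le (.add x (.const 1)) y
/-- Bit number `i` of example number `s`. -/
abbrev xbit (s i : NE) : NE := .get .X (.add (.get .rowX s) i)
/-- Bit number `i` of feature number `t`. -/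
abbrev fbit (t i : NE) : NE := .get .F (.add (.get .rowF t) i)

/-- Do the examples `s` and `r` agree on `S` and the label? -/
def agreeCmd : Cmd :=
  .ite (.eq (xbit (sc .s) (sc .n)) (xbit (sc .r) (sc .n)))
    (assign .agree (.const 1)) (assign .agree (.const 0)) ;;
  .loop .i .n (.ite (.and (.le (.const 1) (.get .S (sc .i)))
      (.not (.eq (xbit (sc .s) (sc .i)) (xbit (sc .r) (sc .i)))))
    (assign .agree (.const 0)) .skip)

/-- The four counters are the size of the cell of example `s` and the numbers of its members with
bit `u`, with bit `v`, and with both. The product of two bits is a conditional addition, for lack of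
multiplication of naturals. -/
def countCmd : Cmd :=
  assign .cN (.const 0) ;; assign .cA (.const 0) ;; assign .cB (.const 0) ;;
  assign .cD (.const 0) ;;
  .loop .r .m (.ite (.lt (sc .r) (sc .half))
    (agreeCmd ;; .ite (.le (.const 1) (sc .agree))
      (incr .cN ;; assign .cA (.add (sc .cA) (xbit (sc .r) (sc .u))) ;;
        assign .cB (.add (sc .cB) (xbit (sc .r) (sc .v))) ;;
        .ite (.le (.const 1) (xbit (sc .r) (sc .u)))
          (assign .cD (.add (sc .cD) (xbit (sc .r) (sc .v)))) .skip) .skip) .skip)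

/-- Each example contributes the covariance within its own cell. A cell is thereby weighted by its
size, and the cells need not be enumerated. -/
def statCmd : Cmd :=
  rassign .stat (rc 0) ;;
  .loop .s .m (.ite (.lt (sc .s) (sc .half))
    (countCmd ;; rassign .stat (.add (rsc .stat)
      (.sub (.div (.ofNat (sc .cD)) (.ofNat (sc .cN)))
        (.div (.mul (.ofNat (sc .cA)) (.ofNat (sc .cB)))
          (.mul (.ofNat (sc .cN)) (.ofNat (sc .cN))))))) .skip)

/-- The arrays hold `m` examples. -/
structure Data {n : ℕ} (m : ℕ) (z : ℕ → Example n) (e : Env) : Prop where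
  hn : e.N .n 0 = n
  hm : e.N .m 0 = m
  row : ∀ s < m, e.N .rowX s = s * (n + 1)
  feat : ∀ s < m, ∀ i : Fin n, e.N .X (s * (n + 1) + i) = bit ((z s).1 i)
  label : ∀ s < m, e.N .X (s * (n + 1) + n) = bit (z s).2

theorem Data.congr {n m : ℕ} {z : ℕ → Example n} {e e' : Env} (h : Data m z e)
    (hn : e'.N .n = e.N .n) (hm : e'.N .m = e.N .m) (hr : e'.N .rowX = e.N .rowX)
    (hX : e'.N .X = e.N .X) : Data m z e' :=
  ⟨hn ▸ h.hn, hm ▸ h.hm, hr ▸ h.row, hX ▸ h.feat, hX ▸ h.label⟩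

/-- The arrays hold the set `S`. -/
def SetRep {n : ℕ} (S : Finset (Fin n)) (e : Env) : Prop :=
  ∀ i : Fin n, e.N .S i = if i ∈ S then 1 else 0

theorem agreeCmd_run {n m : ℕ} {z : ℕ → Example n} {e : Env} (hD : Data m z e)
    {S : Finset (Fin n)} (hS : SetRep S e) {s r : ℕ} (hs : s < m) (hr : r < m)
    (es : e.N .s 0 = s) (er : e.N .r 0 = r) :
    (agreeCmd.run e).N .agree 0 = if key S (z s) = key S (z r) then 1 else 0 := by
  rw [agreeCmd, Cmd.run]
  set e1 := Cmd.run _ e with he1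
  have h1 : e1.N .agree 0 = if (z s).2 = (z r).2 then 1 else 0 := by
    simp only [he1, Cmd.run, BE.eq, BE.Holds, NE.eval, es, er, hD.row s hs, hD.row r hr, hD.hn,
      hD.label s hs, hD.label r hr, ← le_antisymm_iff, bit_inj]
    split_ifs <;> simp
  have f1 : ∀ a, a ≠ .agree → e1.N a = e.N a := fun a ha => Cmd.run_N _ _ _ (by
    simp [Cmd.writesN, ha])
  have inv := Cmd.loop_inv (i := .i) (hi := .n) (c := .ite (.and (.le (.const 1) (.get .S (sc .i)))
      (.not (.eq (xbit (sc .s) (sc .i)) (xbit (sc .r) (sc .i)))))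
    (assign .agree (.const 0)) .skip) (by decide) e1
    (fun k e' => e'.N .agree 0 = if (z s).2 = (z r).2 ∧
      ∀ i : Fin n, i.1 < k → i ∈ S → (z s).1 i = (z r).1 i then 1 else 0) (by simp [h1]) (by
    intro k hk e' hN hR hik hP
    have f2 : ∀ a, a ≠ .agree → a ≠ .i → e'.N a = e.N a := fun a ha ha' => by
      rw [hN a ha' (by simp [Cmd.writesN, ha]), f1 a ha]
    rw [f1 _ (by decide), hD.hn] at hk
    have hX := f2 .X (by decide) (by decide)
    have hrow := f2 .rowX (by decide) (by decide)
    have hS' := hS ⟨k, hk⟩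
    simp only at hS'
    have x1 := hD.feat s hs ⟨k, hk⟩
    have x2 := hD.feat r hr ⟨k, hk⟩
    simp only at x1 x2
    simp only [Cmd.run, BE.Holds, NE.eval, hik, hX, hrow, f2 .s (by decide) (by decide), es,
      f2 .r (by decide) (by decide), er, hD.row s hs, hD.row r hr, x1, x2,
      f2 .S (by decide) (by decide), hS', ← le_antisymm_iff, bit_inj]
    have split : (∀ i : Fin n, i.1 < k + 1 → i ∈ S → (z s).1 i = (z r).1 i) ↔
        (∀ i : Fin n, i.1 < k → i ∈ S → (z s).1 i = (z r).1 i) ∧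
          (⟨k, hk⟩ ∈ S → (z s).1 ⟨k, hk⟩ = (z r).1 ⟨k, hk⟩) := by
      constructor
      · exact fun h => ⟨fun i hi => h i (by omega), h _ (by simp)⟩
      · rintro ⟨h, h'⟩ i hi
        rcases Nat.lt_succ_iff_lt_or_eq.1 hi with hi | hi
        · exact h i hi
        · obtain rfl : i = ⟨k, hk⟩ := Fin.ext hi
          exact h'
    simp only [split]
    by_cases hkS : (⟨k, hk⟩ : Fin n) ∈ S <;>
      by_cases hkk : (z s).1 ⟨k, hk⟩ = (z r).1 ⟨k, hk⟩ <;> simp [hkS, hkk, hP])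
  simp only [inv, key_eq_iff, f1 .n (by decide), hD.hn]
  simp

end ArrayProg

namespace ArrayProg

set_option linter.constructorNameAsVariable false
set_option linter.unusedSimpArgs false

open RBMLearn

theorem bit_one : bit 1 = 1 := rfl
theorem bit_neg_one : bit (-1) = 0 := rfl

/-- Loops can only run up to `m`; a guard inside the body restricts them to the first half of the
sample. -/
theorem sum_range_guard {M m : ℕ} (hM : M ≤ m) (p : ℕ → Prop) [DecidablePred p] {α : Type*}
    [AddCommMonoid α] (f : ℕ → α) :
    ∑ r ∈ Finset.range m, (if r < M ∧ p r then f r else 0) =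
      ∑ r ∈ Finset.range M with p r, f r := by
  rw [← Finset.sum_filter]
  congr 1
  ext r
  simp only [Finset.mem_filter, Finset.mem_range]
  constructor
  · rintro ⟨_, h, h'⟩; exact ⟨h, h'⟩
  · rintro ⟨h, h'⟩; exact ⟨by omega, h, h'⟩

theorem countCmd_run {n m M : ℕ} {z : ℕ → Example n} {e : Env} (hD : Data m z e)
    {S : Finset (Fin n)} (hS : SetRep S e) {s : ℕ} {u v : Fin n} (hs : s < m)
    (es : e.N .s 0 = s) (eu : e.N .u 0 = u) (ev : e.N .v 0 = v) (eM : e.N .half 0 = M)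
    (hM : M ≤ m) :
    (countCmd.run e).N .cN 0 = ∑ r ∈ Finset.range M with key S (z s) = key S (z r), 1 ∧
    (countCmd.run e).N .cA 0 =
      ∑ r ∈ Finset.range M with key S (z s) = key S (z r), bit ((z r).1 u) ∧
    (countCmd.run e).N .cB 0 =
      ∑ r ∈ Finset.range M with key S (z s) = key S (z r), bit ((z r).1 v) ∧
    (countCmd.run e).N .cD 0 =
      ∑ r ∈ Finset.range M with key S (z s) = key S (z r), bit ((z r).1 u) * bit ((z r).1 v) := by
  simp only [countCmd, Cmd.run.eq_4]
  set e1 := Cmd.run (assign .cD (.const 0)) _ with he1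
  have f1 : ∀ a, a ≠ .cN → a ≠ .cA → a ≠ .cB → a ≠ .cD → e1.N a = e.N a := by
    intro a h1 h2 h3 h4; simp [he1, Cmd.run, h1, h2, h3, h4]
  have z1 : e1.N .cN 0 = 0 ∧ e1.N .cA 0 = 0 ∧ e1.N .cB 0 = 0 ∧ e1.N .cD 0 = 0 := by
    simp [he1, Cmd.run]
  clear_value e1
  simp only [← sum_range_guard hM]
  rw [← hD.hm, ← f1 .m (by decide) (by decide) (by decide) (by decide)]
  refine Cmd.loop_inv (i := .r) (hi := .m) (by decide) e1 (fun k e' =>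
    e'.N .cN 0 = ∑ r ∈ Finset.range k, (if r < M ∧ key S (z s) = key S (z r) then 1 else 0) ∧
    e'.N .cA 0 = ∑ r ∈ Finset.range k,
      (if r < M ∧ key S (z s) = key S (z r) then bit ((z r).1 u) else 0) ∧
    e'.N .cB 0 = ∑ r ∈ Finset.range k,
      (if r < M ∧ key S (z s) = key S (z r) then bit ((z r).1 v) else 0) ∧
    e'.N .cD 0 = ∑ r ∈ Finset.range k,
      (if r < M ∧ key S (z s) = key S (z r) then bit ((z r).1 u) * bit ((z r).1 v) else 0)) ?_ ?_
  · simp [z1]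
  · intro k hk e' hN hR hik ⟨h1, h2, h3, h4⟩
    have f2 : ∀ a, a ∉ [NV.cN, .cA, .cB, .cD, .r, .agree, .i] → e'.N a = e.N a := by
      intro a ha
      simp at ha
      obtain ⟨a1, a2, a3, a4, a5, a6, a7⟩ := ha
      rw [hN a a5 (by simp [agreeCmd, Cmd.writesN]; tauto), f1 a a1 a2 a3 a4]
    rw [f1 _ (by decide) (by decide) (by decide) (by decide), hD.hm] at hk
    have eM' : e'.N .half 0 = M := by rw [f2 _ (by decide), eM]
    simp only [Finset.sum_range_succ]
    rw [Cmd.run]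
    by_cases hkM : k < M
    swap
    · simp [hik, eM', hkM, Cmd.run, h1, h2, h3, h4]
    have hD' : Data m z e' := hD.congr (f2 _ (by decide)) (f2 _ (by decide)) (f2 _ (by decide))
      (f2 _ (by decide))
    have hS' : SetRep S e' := fun i => by rw [f2 _ (by decide)]; exact hS i
    have hag := agreeCmd_run hD' hS' hs hk (by rw [f2 _ (by decide), es]) hik
    rw [if_pos (by simp [hik, eM']; omega), Cmd.run]
    set e2 := agreeCmd.run e' with he2
    have f3 : ∀ a, a ∉ [NV.agree, .i] → e2.N a = e'.N a := by
      intro a ha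
      simp at ha
      exact Cmd.run_N _ _ _ (by simp [agreeCmd, Cmd.writesN]; tauto)
    have xu := hD'.feat k hk u
    have xv := hD'.feat k hk v
    have hrow := hD'.row k hk
    have hu := (f2 .u (by decide))
    have hv := (f2 .v (by decide))
    rw [Cmd.run]
    have g1 := f3 .cN (by decide)
    have g2 := f3 .cA (by decide)
    have g3 := f3 .cB (by decide)
    have g4 := f3 .cD (by decide)
    have g5 := f3 .X (by decide)
    have g6 := f3 .rowX (by decide)
    have g7 := f3 .r (by decide)
    have g8 := f3 .u (by decide)
    have g9 := f3 .v (by decide)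
    clear_value e2
    by_cases hkey : key S (z s) = key S (z k)
    · rw [if_pos hkey] at hag
      rw [if_pos (by simp [hag])]
      simp only [if_pos (show k < M ∧ key S (z s) = key S (z k) from ⟨hkM, hkey⟩)]
      rw [Cmd.run.eq_4, Cmd.run.eq_4, Cmd.run.eq_4, Cmd.run.eq_5]
      rcases Int.units_eq_one_or ((z k).1 u) with hb | hb <;>
      · simp only [hb] at xu ⊢
        simp only [bit_one, bit_neg_one] at xu
        simp [Cmd.run, bit_one, bit_neg_one, g1, g2, g3, g4, g5, g6, g7, g8, g9, h1, h2, h3, h4, hu, hv, hrow, hik, eu,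
          ev, xu, xv]
    · rw [if_neg hkey] at hag
      rw [if_neg (by simp [hag])]
      simp [Cmd.run, hkey, h1, h2, h3, h4, g1, g2, g3, g4]

theorem statCmd_run {n m M : ℕ} {z : ℕ → Example n} {e : Env} (hD : Data m z e)
    {S : Finset (Fin n)} (hS : SetRep S e) {u v : Fin n}
    (eu : e.N .u 0 = u) (ev : e.N .v 0 = v) (eM : e.N .half 0 = M) (hM : M ≤ m) :
    (statCmd.run e).R .stat 0 = empStat z M S u v := by
  rw [statCmd, Cmd.run.eq_4]
  set e1 := Cmd.run (rassign .stat (rc 0)) e with he1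
  have f1 : e1.N = e.N := by simp [he1, Cmd.run]
  have z1 : e1.R .stat 0 = 0 := by simp [he1, Cmd.run]
  clear_value e1
  set f : ℕ → ℝ := fun s =>
    ((∑ r ∈ Finset.range M with key S (z s) = key S (z r), bit ((z r).1 u) * bit ((z r).1 v) : ℕ) /
      (∑ r ∈ Finset.range M with key S (z s) = key S (z r), 1 : ℕ) -
    (∑ r ∈ Finset.range M with key S (z s) = key S (z r), bit ((z r).1 u) : ℕ) *
      (∑ r ∈ Finset.range M with key S (z s) = key S (z r), bit ((z r).1 v) : ℕ) /
      ((∑ r ∈ Finset.range M with key S (z s) = key S (z r), 1 : ℕ) *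
        (∑ r ∈ Finset.range M with key S (z s) = key S (z r), 1 : ℕ)) : ℝ) with hf
  have e0 : empStat z M S u v = ∑ s ∈ Finset.range (e1.N .m 0), if s < M ∧ True then f s else 0 := by
    rw [f1, hD.hm, sum_range_guard hM]; simp [empStat, hf]
  rw [e0]
  refine Cmd.loop_inv (i := .s) (hi := .m) (by decide) e1 (fun k e' =>
    e'.R .stat 0 = ∑ s ∈ Finset.range k, if s < M ∧ True then f s else 0) ?_ ?_
  · simp [z1]
  · intro k hk e' hN hR hik h1
    have f2 : ∀ a, a ∉ [NV.s, .cN, .cA, .cB, .cD, .r, .agree, .i] → e'.N a = e.N a := by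
      intro a ha
      simp at ha
      obtain ⟨a1, a2, a3, a4, a5, a6, a7, a8⟩ := ha
      rw [hN a a1 (by simp [countCmd, agreeCmd, Cmd.writesN]; tauto), f1]
    rw [f1, hD.hm] at hk
    have eM' : e'.N .half 0 = M := by rw [f2 _ (by decide), eM]
    rw [Finset.sum_range_succ, Cmd.run]
    by_cases hkM : k < M
    swap
    · simp [hik, eM', hkM, Cmd.run, h1]
    have hD' : Data m z e' := hD.congr (f2 _ (by decide)) (f2 _ (by decide)) (f2 _ (by decide))
      (f2 _ (by decide))
    have hS' : SetRep S e' := fun i => by rw [f2 _ (by decide)]; exact hS i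
    obtain ⟨c1, c2, c3, c4⟩ := countCmd_run hD' hS' hk hik (by rw [f2 _ (by decide), eu])
      (by rw [f2 _ (by decide), ev]) eM' hM
    have c5 : (countCmd.run e').R = e'.R := by
      funext a; exact Cmd.run_R _ _ _ (by simp [countCmd, agreeCmd, Cmd.writesR])
    rw [if_pos (by simp [hik, eM']; omega), Cmd.run]
    simp only [Cmd.run, Env.setN_R, Env.setR_R_self, RE.eval, NE.eval, c1, c2, c3, c4, c5, h1,
      Function.update_self]
    simp [hkM, hf]

end ArrayProg

/-! ### Programs for the selection of features -/

namespace ArrayProg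

set_option linter.constructorNameAsVariable false
set_option linter.unusedSimpArgs false

open RBMLearn

/-- The arrays hold the list `L` of sets of variables, numbered from `32` on. -/
structure FeatRep {n : ℕ} (L : List (Finset (Fin n))) (e : Env) : Prop where
  -- Starting at 32 keeps the final places of the rows, which begin beyond cell 32, away from the
  -- cells of the scalars when the output is moved.
  cnt : e.N .cnt 0 = 32 + L.length
  -- The case `j = L.length` is included: the start of the free row is stored as well, since row
  -- starts are obtained only by adding `n` to the previous one.
  row : ∀ j ≤ L.length, e.N .rowF (32 + j) = (32 + j) * n
  bits : ∀ j < L.length, ∀ i : Fin n, e.N .F ((32 + j) * n + i) = if i ∈ L.getD j ∅ then 1 else 0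
  -- Clean cells beyond the list already represent the empty set, which can be appended without
  -- writing bits.
  zero : ∀ q, (32 + L.length) * n ≤ q → e.N .F q = 0

theorem FeatRep.congr {n : ℕ} {L : List (Finset (Fin n))} {e e' : Env} (h : FeatRep L e)
    (hc : e'.N .cnt = e.N .cnt) (hr : e'.N .rowF = e.N .rowF) (hF : e'.N .F = e.N .F) :
    FeatRep L e' :=
  ⟨hc ▸ h.cnt, hr ▸ h.row, hF ▸ h.bits, hF ▸ h.zero⟩

/-- Append a copy of feature number `t`, with `v` inserted. -/
def appendCmd : Cmd :=
  .loop .i .n (.setN .F (.add (.get .rowF (sc .cnt)) (sc .i)) (fbit (sc .t) (sc .i))) ;;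
  .setN .F (.add (.get .rowF (sc .cnt)) (sc .v)) (.const 1) ;;
  .setN .rowF (.add (sc .cnt) (.const 1)) (.add (.get .rowF (sc .cnt)) (sc .n)) ;;
  incr .cnt

theorem block_lt {n a b i : ℕ} (hab : a < b) (hi : i < n) : a * n + i < b * n := by
  have : (a + 1) * n ≤ b * n := Nat.mul_le_mul_right _ hab
  rw [add_mul] at this; omega

theorem appendCmd_run {n : ℕ} {L : List (Finset (Fin n))} {e : Env} (h : FeatRep L e)
    (hn : e.N .n 0 = n) {v : Fin n} (hv : e.N .v 0 = v) {j : ℕ} (hj : j < L.length)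
    (ht : e.N .t 0 = 32 + j) : FeatRep (L ++ [insert v (L.getD j ∅)]) (appendCmd.run e) := by
  rw [appendCmd, Cmd.run.eq_4]
  set e1 := Cmd.run (.loop .i .n _) e with he1
  have f1 : ∀ a, a ≠ .F → a ≠ .i → e1.N a = e.N a := fun a h1 h2 =>
    Cmd.run_N _ _ _ (by simp [Cmd.writesN, h1, h2])
  have inv : ∀ q, e1.N .F q = if (32 + L.length) * n ≤ q ∧ q < (32 + L.length) * n + e.N .n 0 then
      e.N .F ((32 + j) * n + (q - (32 + L.length) * n)) else e.N .F q := by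
    refine Cmd.loop_inv (i := .i) (hi := .n) (by decide) e (fun k e' => ∀ q, e'.N .F q =
      if (32 + L.length) * n ≤ q ∧ q < (32 + L.length) * n + k then
      e.N .F ((32 + j) * n + (q - (32 + L.length) * n)) else e.N .F q) ?_ ?_
    · intro q
      rw [if_neg (by omega)]; simp
    · intro k hk e' hN hR hik hP q
      rw [hn] at hk
      have f2 : ∀ a, a ≠ .F → a ≠ .i → e'.N a = e.N a := fun a h1 h2 =>
        hN a h2 (by simp [Cmd.writesN, h1])
      have hb := block_lt (show 32 + j < 32 + L.length by omega) hk
      have hsrc := hP ((32 + j) * n + k)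
      rw [if_neg (by omega)] at hsrc
      simp only [Cmd.run, NE.eval, hik, f2 .rowF (by decide) (by decide),
        f2 .cnt (by decide) (by decide), f2 .t (by decide) (by decide), h.cnt, ht,
        h.row j hj.le, h.row _ le_rfl, hsrc]
      by_cases hq : q = (32 + L.length) * n + k
      · subst hq
        simp
      · rw [Env.setN_N_ne _ (by decide), Env.setN_N_self, Function.update_of_ne hq, hP q]
        apply if_congr _ rfl rfl
        omega
  have hb := block_lt (show 32 + j < 32 + L.length by omega) v.2
  clear_value e1
  rw [hn] at inv
  have hF : ∀ q, ((Cmd.setN .F (.add (.get .rowF (sc .cnt)) (sc .v)) (.const 1) ;;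
      .setN .rowF (.add (sc .cnt) (.const 1)) (.add (.get .rowF (sc .cnt)) (sc .n)) ;;
      incr .cnt).run e1).N .F q = if q = (32 + L.length) * n + v then 1 else e1.N .F q := by
    intro q
    simp [Cmd.run, f1, hv, h.cnt, h.row _ le_rfl, Function.update_apply]
  refine ⟨?_, ?_, ?_, ?_⟩
  · simp [Cmd.run, f1, h.cnt]; omega
  · intro k hk
    simp only [List.length_append, List.length_cons, List.length_nil, zero_add] at hk
    simp [Cmd.run, f1, h.cnt, h.row _ le_rfl, Function.update_apply, hn]
    split_ifs with h1
    · obtain rfl : k = L.length + 1 := by omega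
      ring
    · exact h.row k (by omega)
  · intro k hk i
    rw [hF, inv]
    simp only [List.length_append, List.length_cons, List.length_nil, zero_add] at hk
    by_cases hkL : k < L.length
    · have := block_lt (show 32 + k < 32 + L.length by omega) i.2
      rw [if_neg (by omega), if_neg (by omega), h.bits k hkL, List.getD_append _ _ _ _ hkL]
    · obtain rfl : k = L.length := by omega
      rw [List.getD_append_right _ _ _ _ le_rfl]
      simp only [Nat.sub_self, List.getD_cons_zero, add_right_inj, Finset.mem_insert]
      by_cases hiv : i = v
      · simp [hiv]
      · rw [if_neg (fun hh => hiv (Fin.ext hh)), if_pos ⟨by omega, by omega⟩,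
          Nat.add_sub_cancel_left, h.bits j hj]
        simp [hiv]
  · intro q hq
    simp only [List.length_append, List.length_cons, List.length_nil, zero_add] at hq
    have e2 : (32 + (L.length + 1)) * n = (32 + L.length) * n + n := by ring
    have := v.2
    rw [hF, inv, if_neg (by omega), if_neg (by omega)]
    exact h.zero q (by omega)

/-- Append copies of all features from number `start` on, with `v` inserted. -/
def dblCmd : Cmd :=
  -- The old end is frozen, so that the copies are not copied in turn.
  assign .top (sc .cnt) ;;
  .loop .t .m (.ite (.and (.le (sc .start) (sc .t)) (.lt (sc .t) (sc .top))) appendCmd .skip)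

theorem dblCmd_run {n m : ℕ} {L blk : List (Finset (Fin n))} {e : Env} (h : FeatRep (L ++ blk) e)
    (hn : e.N .n 0 = n) (hm : e.N .m 0 = m) {v : Fin n} (hv : e.N .v 0 = v)
    (hs : e.N .start 0 = 32 + L.length) (hle : 32 + (L ++ blk).length ≤ m) :
    FeatRep (L ++ (blk ++ blk.map (insert v))) (dblCmd.run e) := by
  rw [dblCmd, Cmd.run.eq_4]
  set e1 := Cmd.run (assign .top (sc .cnt)) e with he1
  have f1 : ∀ a, a ≠ .top → e1.N a = e.N a := fun a h1 =>
    Cmd.run_N _ _ _ (by simp [Cmd.writesN, h1])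
  have htop : e1.N .top 0 = 32 + (L ++ blk).length := by simp [he1, Cmd.run, h.cnt]
  clear_value e1
  have inv : FeatRep (L ++ blk ++ (blk.take (e1.N .m 0 - (32 + L.length))).map (insert v))
      (Cmd.run (.loop .t .m (.ite (.and (.le (sc .start) (sc .t)) (.lt (sc .t) (sc .top)))
        appendCmd .skip)) e1) := by
    refine Cmd.loop_inv (i := .t) (hi := .m) (by decide) e1 (fun k e' =>
      FeatRep (L ++ blk ++ (blk.take (k - (32 + L.length))).map (insert v)) e') ?_ ?_
    · simp only [Nat.zero_sub, List.take_zero, List.map_nil, List.append_nil]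
      exact h.congr (by simp [f1]) (by simp [f1]) (by simp [f1])
    · intro k hk e' hN hR hik hP
      have f2 : ∀ a, a ∉ [NV.F, .i, .t, .rowF, .cnt] → e'.N a = e1.N a := by
        intro a ha
        simp at ha
        exact hN a ha.2.2.1 (by simp [appendCmd, Cmd.writesN]; tauto)
      have h1 := f2 .start (by decide)
      have h2 := f2 .top (by decide)
      have h3 := f2 .n (by decide)
      have h4 := f2 .v (by decide)
      rw [f1 _ (by decide)] at h1 h3 h4
      simp only [List.length_append] at htop
      rw [Cmd.run.eq_5]
      by_cases hk1 : 32 + L.length ≤ k ∧ k < 32 + (L.length + blk.length)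
      · rw [if_pos (by simp [h1, h2, hs, htop, hik]; omega)]
        obtain ⟨d, rfl⟩ := Nat.exists_eq_add_of_le hk1.1
        have hd : d < blk.length := by omega
        have := appendCmd_run hP (h3 ▸ hn) (h4 ▸ hv) (j := L.length + d) (by simp; omega)
          (by rw [hik]; ring)
        have e3 : 32 + L.length + d + 1 - (32 + L.length) = d + 1 := by omega
        have e4 : 32 + L.length + d - (32 + L.length) = d := by omega
        rw [e4] at this
        rw [e3]
        refine FeatRep.congr (e := appendCmd.run e') ?_ (by simp) (by simp) (by simp)
        have e5 : (L ++ blk ++ (blk.take d).map (insert v)).getD (L.length + d) ∅ = blk[d] := by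
          rw [List.append_assoc, List.getD_append_right _ _ _ _ (by omega), Nat.add_sub_cancel_left,
            List.getD_append _ _ _ _ hd, List.getD_eq_getElem _ _ hd]
        rw [e5] at this
        rw [List.take_succ_eq_append_getElem hd, List.map_append, ← List.append_assoc]
        exact this
      · rw [if_neg (by simp [h1, h2, hs, htop, hik]; omega), Cmd.run.eq_1]
        refine FeatRep.congr (e := e') ?_ (by simp) (by simp) (by simp)
        have : blk.take (k + 1 - (32 + L.length)) = blk.take (k - (32 + L.length)) := by
          by_cases hk2 : k < 32 + L.length
          · congr 1; omega
          · rw [List.take_of_length_le (by omega), List.take_of_length_le (by omega)]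
        rw [this]; exact hP
  -- All row numbers are below `m` by `hle`, so the loop passes the whole block.
  rw [f1 _ (by decide), hm, List.take_of_length_le (by simp at hle; omega)] at inv
  rw [← List.append_assoc]; exact inv

/-- Scan all units for those related to the unit `u`. -/
def scanCmd : Cmd :=
  assign .start (sc .cnt) ;;
  -- The empty set starts the block of `u`; advancing the counters is enough, its bits being zero
  -- already.
  .setN .rowF (.add (sc .cnt) (.const 1)) (.add (.get .rowF (sc .cnt)) (sc .n)) ;;
  incr .cnt ;;
  .loop .i .n (.setN .S (sc .i) (.const 0)) ;;
  .loop .v .n (.ite (.eq (sc .v) (sc .u)) dblCmd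
    (statCmd ;; .ite (.rle (rsc .thr) (rsc .stat))
      (.setN .S (sc .v) (.const 1) ;; dblCmd) .skip))

theorem scanCmd_run {n m M : ℕ} {z : ℕ → Example n} {th : ℝ} {L : List (Finset (Fin n))} {e : Env}
    (hD : Data m z e) (h : FeatRep L e) {u : Fin n} (hu : e.N .u 0 = u) (eM : e.N .half 0 = M)
    (hM : M ≤ m) (hth : e.R .thr 0 = th)
    (hle : ∀ k ≤ n, 32 + (L ++ (scan z M th u k).2).length ≤ m) :
    FeatRep (L ++ (scan z M th u n).2) (scanCmd.run e) := by
  rw [scanCmd, Cmd.run.eq_4, Cmd.run.eq_4, Cmd.run.eq_4]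
  set e1 := Cmd.run (incr .cnt) _ with he1
  have f1 : ∀ a, a ∉ [NV.start, .rowF, .cnt] → e1.N a = e.N a := by
    intro a ha; simp at ha; simp [he1, Cmd.run, ha]
  have hs1 : e1.N .start 0 = 32 + L.length := by simp [he1, Cmd.run, h.cnt]
  have r1 : e1.R = e.R := by simp [he1, Cmd.run]
  have h1 : FeatRep (L ++ [∅]) e1 := by
    refine ⟨?_, ?_, ?_, ?_⟩
    · simp [he1, Cmd.run, h.cnt]; omega
    · intro k hk
      simp only [List.length_append, List.length_cons, List.length_nil, zero_add] at hk
      simp [he1, Cmd.run, h.cnt, h.row _ le_rfl, Function.update_apply, hD.hn]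
      split_ifs with h1
      · obtain rfl : k = L.length + 1 := by omega
        ring
      · exact h.row k (by omega)
    · intro k hk i
      simp only [List.length_append, List.length_cons, List.length_nil, zero_add] at hk
      rw [f1 _ (by decide)]
      by_cases hkL : k < L.length
      · rw [h.bits k hkL, List.getD_append _ _ _ _ hkL]
      · obtain rfl : k = L.length := by omega
        rw [List.getD_append_right _ _ _ _ le_rfl, h.zero _ (by omega)]
        simp
    · intro q hq
      rw [f1 _ (by decide)]
      refine h.zero q (le_trans ?_ hq)
      exact Nat.mul_le_mul_right _ (by simp)
  clear_value e1
  rw [Cmd.run.eq_4]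
  set e2 := Cmd.run (.loop .i .n (.setN .S (sc .i) (.const 0))) e1 with he2
  have f2 : ∀ a, a ∉ [NV.S, .i] → e2.N a = e1.N a := by
    intro a ha; simp at ha; exact Cmd.run_N _ _ _ (by simp [Cmd.writesN]; tauto)
  have r2 : e2.R = e.R := by
    rw [← r1]; funext a; exact Cmd.run_R _ _ _ (by simp [Cmd.writesR])
  have hS2 : SetRep (∅ : Finset (Fin n)) e2 := by
    have : ∀ i < e1.N .n 0, e2.N .S i = 0 := by
      refine Cmd.loop_inv (i := .i) (hi := .n) (by decide) e1 (fun k e' =>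
        ∀ i < k, e'.N .S i = 0) (by simp) ?_
      intro k hk e' hN hR hik hP i hi
      simp [Cmd.run, hik, Function.update_apply]
      intro hne; exact hP i (by omega)
    intro i
    rw [f1 _ (by decide), hD.hn] at this
    simp [this i i.2]
  clear_value e2
  have hn2 : e2.N .n 0 = n := by rw [f2 _ (by decide), f1 _ (by decide), hD.hn]
  have key := Cmd.loop_inv (i := .v) (hi := .n) (c := .ite (.eq (sc .v) (sc .u)) dblCmd
    (statCmd ;; .ite (.rle (rsc .thr) (rsc .stat))
      (.setN .S (sc .v) (.const 1) ;; dblCmd) .skip)) (by decide) e2 (fun k e' =>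
      FeatRep (L ++ (scan z M th u k).2) e' ∧ SetRep (scan z M th u k).1 e') ?_ ?_
  · rw [hn2] at key; exact key.1
  · refine ⟨?_, ?_⟩
    · exact h1.congr (by simp [f2]) (by simp [f2]) (by simp [f2])
    · intro i; simp [hS2 i, scan]
  · intro k hk e' hN hR hik ⟨hF, hS⟩
    have f3 : ∀ a, a ∈ [NV.n, .m, .X, .rowX, .half, .start, .u] → e'.N a = e2.N a := by
      intro a ha
      simp at ha
      rcases ha with rfl | rfl | rfl | rfl | rfl | rfl | rfl <;>
        exact hN _ (by decide) (by decide)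
    have f4 : ∀ a, a ∈ [NV.n, .m, .X, .rowX, .half, .u] → e'.N a = e.N a := by
      intro a ha
      simp at ha
      rcases ha with rfl | rfl | rfl | rfl | rfl | rfl <;>
        rw [f3 _ (by decide), f2 _ (by decide), f1 _ (by decide)]
    rw [hn2] at hk
    have hD' : Data m z e' := hD.congr (f4 _ (by decide)) (f4 _ (by decide)) (f4 _ (by decide))
      (f4 _ (by decide))
    have hst : e'.N .start 0 = 32 + L.length := by rw [f3 _ (by decide), f2 _ (by decide), hs1]
    have hu' : e'.N .u 0 = u := by rw [f4 _ (by decide), hu]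
    have hM' : e'.N .half 0 = M := by rw [f4 _ (by decide), eM]
    have hth' : e'.R .thr 0 = th := by rw [hR _ (by decide), r2, hth]
    have hlen := hle k hk.le
    rw [Cmd.run, scan, dif_pos hk]
    by_cases hku : (⟨k, hk⟩ : Fin n) = u
    · rw [if_pos hku, if_pos (by simp [hik, hu', ← hku])]
      have := dblCmd_run (v := ⟨k, hk⟩) hF hD'.hn hD'.hm hik hst hlen
      refine ⟨this.congr (by simp) (by simp) (by simp), fun i => ?_⟩
      rw [Env.setN_N_ne _ (by decide), Cmd.run_N _ _ _ (by decide)]; exact hS i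
    · have hne : k ≠ u := fun hh => hku (Fin.ext hh)
      have hb : ¬ BE.Holds e' (.eq (sc .v) (sc .u)) := by simp [hik, hu']; omega
      rw [if_neg hku, if_neg hb, Cmd.run]
      have hstat := statCmd_run hD' hS hu' (v := ⟨k, hk⟩) hik hM' hM
      have g1 : ∀ a, a ∉ [NV.s, .cN, .cA, .cB, .cD, .r, .agree, .i] →
          (statCmd.run e').N a = e'.N a := by
        intro a ha
        simp at ha
        exact Cmd.run_N _ _ _ (by simp [statCmd, countCmd, agreeCmd, Cmd.writesN]; tauto)
      have g2 : (statCmd.run e').R .thr 0 = th := by rw [Cmd.run_R _ _ _ (by decide), hth']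
      set e3 := statCmd.run e' with he3
      clear_value e3
      have hF3 : FeatRep (L ++ (scan z M th u k).2) e3 :=
        hF.congr (g1 _ (by decide)) (g1 _ (by decide)) (g1 _ (by decide))
      rw [Cmd.run]
      by_cases hc : th ≤ empStat z M (scan z M th u k).1 u ⟨k, hk⟩
      · rw [if_pos hc, if_pos (by simp [g2, hstat, hc]), Cmd.run]
        set e4 := Cmd.run (.setN .S (sc .v) (.const 1)) e3 with he4
        have g4 : ∀ a, a ≠ .S → e4.N a = e3.N a := fun a ha =>
          Cmd.run_N _ _ _ (by simp [Cmd.writesN, ha])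
        have hS4 : SetRep (insert ⟨k, hk⟩ (scan z M th u k).1) e4 := by
          intro i
          have := hS i
          simp [he4, Cmd.run, g1, hik, Function.update_apply]
          by_cases hi : i = ⟨k, hk⟩
          · simp [hi]
          · rw [if_neg (fun hh => hi (Fin.ext hh)), this]; simp [hi]
        clear_value e4
        have := dblCmd_run (v := ⟨k, hk⟩) (e := e4)
          (hF3.congr (g4 _ (by decide)) (g4 _ (by decide)) (g4 _ (by decide)))
          (by rw [g4 _ (by decide), g1 _ (by decide), hD'.hn])
          (by rw [g4 _ (by decide), g1 _ (by decide), hD'.hm])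
          (by rw [g4 _ (by decide), g1 _ (by decide), hik])
          (by rw [g4 _ (by decide), g1 _ (by decide), hst]) hlen
        refine ⟨this.congr (by simp) (by simp) (by simp), fun i => ?_⟩
        rw [Env.setN_N_ne _ (by decide), Cmd.run_N _ _ _ (by decide)]; exact hS4 i
      · rw [if_neg hc, if_neg (by simp [g2, hstat]; exact not_le.1 hc), Cmd.run]
        refine ⟨hF3.congr (by simp) (by simp) (by simp), fun i => ?_⟩
        rw [Env.setN_N_ne _ (by decide), g1 _ (by decide)]; exact hS i

def NE.mul32 (x : NE) : NE :=
  let d := fun y : NE => NE.add y y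
  d (d (d (d (d x))))

theorem NE.mul32_eval (e : Env) (x : NE) : x.mul32.eval e = 32 * x.eval e := by
  simp only [mul32, NE.eval]; ring

/-- Compute all features. -/
def featCmd : Cmd :=
  assign .cnt (.const 33) ;;
  .setN .rowF (.const 32) (NE.mul32 (sc .n)) ;;
  .setN .rowF (.const 33) (.add (NE.mul32 (sc .n)) (sc .n)) ;;
  .loop .u .n scanCmd

theorem featCmd_run {n m M : ℕ} {z : ℕ → Example n} {th : ℝ} {e : Env}
    (hD : Data m z e) (hF0 : ∀ q, e.N .F q = 0) (eM : e.N .half 0 = M)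
    (hM : M ≤ m) (hth : e.R .thr 0 = th)
    (hle : ∀ k, ∀ hk : k < n, ∀ l ≤ n,
      32 + (feats z M th k ++ (scan z M th ⟨k, hk⟩ l).2).length ≤ m) :
    FeatRep (feats z M th n) (featCmd.run e) := by
  rw [featCmd, Cmd.run.eq_4, Cmd.run.eq_4, Cmd.run.eq_4]
  set e1 := Cmd.run (.setN .rowF (.const 33) (.add (NE.mul32 (sc .n)) (sc .n))) _ with he1
  have f1 : ∀ a, a ∉ [NV.rowF, .cnt] → e1.N a = e.N a := by
    intro a ha; simp at ha; simp [he1, Cmd.run, ha]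
  have r1 : e1.R = e.R := by simp [he1, Cmd.run]
  have h1 : FeatRep [(∅ : Finset (Fin n))] e1 := by
    refine ⟨?_, ?_, ?_, ?_⟩
    · simp [he1, Cmd.run]
    · intro k hk
      simp only [List.length_cons, List.length_nil, zero_add] at hk
      interval_cases k
      · simp [he1, Cmd.run, hD.hn, NE.mul32_eval]
      · simp [he1, Cmd.run, hD.hn, NE.mul32_eval]; ring
    · intro k hk i
      simp only [List.length_cons, List.length_nil, zero_add, Nat.lt_one_iff] at hk
      subst hk
      rw [f1 _ (by decide), hF0]; simp
    · intro q hq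
      rw [f1 _ (by decide), hF0]
  clear_value e1
  have hn1 : e1.N .n 0 = n := by rw [f1 _ (by decide), hD.hn]
  have goal : FeatRep (feats z M th (e1.N .n 0)) (Cmd.run (.loop .u .n scanCmd) e1) := by
   refine Cmd.loop_inv (i := .u) (hi := .n) (by decide) e1 (fun k e' =>
      FeatRep (feats z M th k) e') (h1.congr (by simp) (by simp) (by simp)) ?_
   intro k hk e' hN hR hik hF
   rw [hn1] at hk
   have f4 : ∀ a, a ∈ [NV.n, .m, .X, .rowX, .half] → e'.N a = e.N a := by
     intro a ha
     simp at ha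
     rcases ha with rfl | rfl | rfl | rfl | rfl <;>
       rw [hN _ (by decide) (by decide), f1 _ (by decide)]
   have hD' : Data m z e' := hD.congr (f4 _ (by decide)) (f4 _ (by decide)) (f4 _ (by decide))
     (f4 _ (by decide))
   have := scanCmd_run hD' hF (u := ⟨k, hk⟩) hik (by rw [f4 _ (by decide), eM]) hM
     (by rw [hR _ (by decide), r1, hth]) (hle k hk)
   rw [feats, dif_pos hk]
   exact this.congr (by simp) (by simp) (by simp)
  rwa [hn1] at goal

end ArrayProg

/-! ### Programs for the exponentiated gradient algorithm -/

namespace ArrayProg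

set_option linter.constructorNameAsVariable false
set_option linter.unusedSimpArgs false

open RBMLearn

/-- The parity of the number of entries `-1` among the variables of monomial number `t`. -/
def parCmd : Cmd :=
  assign .par (.const 0) ;;
  .loop .i .n (.ite (.and (.le (.const 1) (fbit (sc .t) (sc .i)))
      (.le (xbit (sc .s) (sc .i)) (.const 0)))
    (.ite (.le (.const 1) (sc .par)) (assign .par (.const 0)) (assign .par (.const 1))) .skip)

/-- A monomial in signs is 1 minus twice the parity of its negative factors. The parity is toggled
as the variables are met, which multiplies the partial product by -1. -/
theorem parCmd_run {n m : ℕ} {z : ℕ → Example n} {L : List (Finset (Fin n))} {e : Env}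
    (hD : Data m z e) (h : FeatRep L e) {s j : ℕ} (hs : s < m) (es : e.N .s 0 = s)
    (hj : j < L.length) (ht : e.N .t 0 = 32 + j) :
    (1 : ℝ) - ((parCmd.run e).N .par 0 + (parCmd.run e).N .par 0 : ℕ) =
      monom (L.getD j ∅) (z s).1 := by
  rw [parCmd, Cmd.run.eq_4]
  set e1 := Cmd.run (assign .par (.const 0)) e with he1
  have f1 : ∀ a, a ≠ .par → e1.N a = e.N a := fun a h1 =>
    Cmd.run_N _ _ _ (by simp [Cmd.writesN, h1])
  have z1 : e1.N .par 0 = 0 := by simp [he1, Cmd.run]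
  clear_value e1
  have inv := Cmd.loop_inv (i := .i) (hi := .n)
    (c := (.ite (.and (.le (.const 1) (fbit (sc .t) (sc .i)))
      (.le (xbit (sc .s) (sc .i)) (.const 0)))
    (.ite (.le (.const 1) (sc .par)) (assign .par (.const 0)) (assign .par (.const 1))) .skip))
    (by decide) e1 (fun k e' =>
    (e'.N .par 0 = 0 ∨ e'.N .par 0 = 1) ∧ (1 : ℝ) - (e'.N .par 0 + e'.N .par 0 : ℕ) =
      ∏ i ∈ (L.getD j ∅).filter (fun i => i.1 < k), spin ((z s).1 i)) ?_ ?_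
  · rw [inv.2, f1 _ (by decide), hD.hn, monom]
    congr 1
    exact Finset.filter_true_of_mem (fun i _ => i.2)
  · simp [z1]
  · intro k hk e' hN hR hik ⟨hP1, hP2⟩
    have f2 : ∀ a, a ∉ [NV.par, .i] → e'.N a = e.N a := by
      intro a ha
      simp at ha
      rw [hN a ha.2 (by simp [Cmd.writesN]; tauto), f1 _ ha.1]
    rw [f1 _ (by decide), hD.hn] at hk
    have hb := h.bits j hj ⟨k, hk⟩
    have hx := hD.feat s hs ⟨k, hk⟩
    simp only at hb hx
    have hsplit : (L.getD j ∅).filter (fun i : Fin n => i.1 < k + 1) =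
        if (⟨k, hk⟩ : Fin n) ∈ L.getD j ∅ then
          insert ⟨k, hk⟩ ((L.getD j ∅).filter (fun i : Fin n => i.1 < k))
        else (L.getD j ∅).filter (fun i : Fin n => i.1 < k) := by
      ext i
      have hi : i = ⟨k, hk⟩ ↔ i.1 = k := ⟨fun h => by simp [h], fun h => Fin.ext h⟩
      split_ifs with hm
      · simp only [Finset.mem_filter, Finset.mem_insert]
        constructor
        · rintro ⟨h1, h2⟩
          rcases Nat.lt_succ_iff_lt_or_eq.1 h2 with h3 | h3
          · exact Or.inr ⟨h1, h3⟩
          · exact Or.inl (hi.2 h3)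
        · rintro (h1 | ⟨h1, h2⟩)
          · subst h1; exact ⟨hm, by simp⟩
          · exact ⟨h1, by omega⟩
      · simp only [Finset.mem_filter]
        constructor
        · rintro ⟨h1, h2⟩
          refine ⟨h1, ?_⟩
          rcases Nat.lt_succ_iff_lt_or_eq.1 h2 with h3 | h3
          · exact h3
          · exact absurd (hi.2 h3 ▸ h1) hm
        · rintro ⟨h1, h2⟩; exact ⟨h1, by omega⟩
    have hnot : (⟨k, hk⟩ : Fin n) ∉ (L.getD j ∅).filter (fun i : Fin n => i.1 < k) := by simp
    rw [hsplit]
    have c1 : (fbit (sc .t) (sc .i)).eval e' = if (⟨k, hk⟩ : Fin n) ∈ L.getD j ∅ then 1 else 0 := by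
      simp [f2, hik, ht, h.row j hj.le, hb]
    have c2 : (xbit (sc .s) (sc .i)).eval e' = bit ((z s).1 ⟨k, hk⟩) := by
      simp [f2, hik, es, hD.row s hs, hx]
    simp only [Cmd.run, BE.Holds, c1, c2]
    by_cases hm : (⟨k, hk⟩ : Fin n) ∈ L.getD j ∅
    · rw [if_pos hm, if_pos hm, Finset.prod_insert hnot, ← hP2]
      rcases Int.units_eq_one_or ((z s).1 ⟨k, hk⟩) with hu | hu <;>
        rcases hP1 with h0 | h0 <;> simp [hu, h0, bit, spin]
      all_goals norm_num
    · rw [if_neg hm, if_neg hm, ← hP2]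
      simp [hP1]

/-- Compute the values of all monomials at example number `s`, the normalization and the
unnormalized prediction. -/
def predCmd : Cmd :=
  rassign .Z (rc 0) ;; rassign .h (rc 0) ;;
  .loop .t .m (.ite (.and (.le (.const 32) (sc .t)) (.lt (sc .t) (sc .cnt)))
    (parCmd ;;
      .setR .chi (sc .t) (.sub (rc 1) (.ofNat (.add (sc .par) (sc .par)))) ;;
      rassign .Z (.add (rsc .Z) (.add (.exp (.get .W (sc .t)))
        (.exp (.sub (rc 0) (.get .W (sc .t)))))) ;;
      rassign .h (.add (rsc .h) (.mul (.sub (.exp (.get .W (sc .t)))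
        (.exp (.sub (rc 0) (.get .W (sc .t))))) (.get .chi (sc .t))))) .skip)

theorem sum_range_sub_guard {N m : ℕ} (h : 32 + N ≤ m) (f : ℕ → ℝ) :
    ∑ j ∈ Finset.range (m - 32), (if j < N then f j else 0) = ∑ j ∈ Finset.range N, f j := by
  rw [← Finset.sum_filter]
  congr 1
  ext j; simp only [Finset.mem_filter, Finset.mem_range]; omega

theorem predCmd_run {n m : ℕ} {z : ℕ → Example n} {L : List (Finset (Fin n))} {e : Env}
    (hD : Data m z e) (h : FeatRep L e) {s : ℕ} (hs : s < m) (es : e.N .s 0 = s)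
    (hle : 32 + L.length ≤ m) {W : ℕ → ℝ} (hW : ∀ j < L.length, e.R .W (32 + j) = W j) :
    (∀ j < L.length, (predCmd.run e).R .chi (32 + j) = monom (L.getD j ∅) (z s).1) ∧
    (predCmd.run e).R .Z 0 = egNorm L.length W ∧
    (predCmd.run e).R .h 0 = ∑ j ∈ Finset.range L.length,
      (Real.exp (W j) - Real.exp (-W j)) * monom (L.getD j ∅) (z s).1 := by
  rw [predCmd, Cmd.run.eq_4, Cmd.run.eq_4]
  set e1 := Cmd.run (rassign .h (rc 0)) _ with he1
  have f1 : e1.N = e.N := by simp [he1, Cmd.run]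
  have r1 : ∀ a, a ∉ [RV.Z, .h] → e1.R a = e.R a := by
    intro a ha; simp at ha; simp [he1, Cmd.run, ha]
  have z1 : e1.R .Z 0 = 0 ∧ e1.R .h 0 = 0 := by simp [he1, Cmd.run]
  clear_value e1
  have inv := Cmd.loop_inv (i := .t) (hi := .m)
    (c := .ite (.and (.le (.const 32) (sc .t)) (.lt (sc .t) (sc .cnt)))
    (parCmd ;;
      .setR .chi (sc .t) (.sub (rc 1) (.ofNat (.add (sc .par) (sc .par)))) ;;
      rassign .Z (.add (rsc .Z) (.add (.exp (.get .W (sc .t)))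
        (.exp (.sub (rc 0) (.get .W (sc .t)))))) ;;
      rassign .h (.add (rsc .h) (.mul (.sub (.exp (.get .W (sc .t)))
        (.exp (.sub (rc 0) (.get .W (sc .t))))) (.get .chi (sc .t))))) .skip)
    (by decide) e1 (fun k e' =>
      (∀ j < L.length, 32 + j < k → e'.R .chi (32 + j) = monom (L.getD j ∅) (z s).1) ∧
      e'.R .Z 0 = ∑ j ∈ Finset.range (k - 32), (if j < L.length then
        Real.exp (W j) + Real.exp (-W j) else 0) ∧
      e'.R .h 0 = ∑ j ∈ Finset.range (k - 32), (if j < L.length then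
        (Real.exp (W j) - Real.exp (-W j)) * monom (L.getD j ∅) (z s).1 else 0)) ?_ ?_
  · rw [f1, hD.hm] at inv
    obtain ⟨i1, i2, i3⟩ := inv
    refine ⟨fun j hj => i1 j hj (by omega), ?_, ?_⟩
    · rw [i2, sum_range_sub_guard hle, egNorm]
    · rw [i3, sum_range_sub_guard hle]
  · simp [z1]
  · intro k hk e' hN hR hik ⟨h1, h2, h3⟩
    have f2 : ∀ a, a ∉ [NV.par, .i, .t] → e'.N a = e.N a := by
      intro a ha
      simp at ha
      rw [hN a ha.2.2 (by simp [parCmd, Cmd.writesN]; tauto), f1]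
    rw [f1, hD.hm] at hk
    have hc := f2 .cnt (by decide)
    rw [Cmd.run.eq_5]
    by_cases hk1 : 32 ≤ k ∧ k < 32 + L.length
    · rw [if_pos (by simp [hik, hc, h.cnt]; omega)]
      obtain ⟨j, rfl⟩ := Nat.exists_eq_add_of_le hk1.1
      have hj : j < L.length := by omega
      have hpar := parCmd_run (hD.congr (f2 _ (by decide)) (f2 _ (by decide)) (f2 _ (by decide))
        (f2 _ (by decide))) (h.congr (f2 _ (by decide)) (f2 _ (by decide)) (f2 _ (by decide)))
        hs (by rw [f2 _ (by decide), es]) hj hik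
      rw [Cmd.run.eq_4]
      have g1 : (parCmd.run e').R = e'.R := by
        funext a; exact Cmd.run_R _ _ _ (by simp [parCmd, Cmd.writesR])
      have g2 : (parCmd.run e').N .t 0 = 32 + j := by rw [Cmd.run_N _ _ _ (by decide), hik]
      set e2 := parCmd.run e' with he2
      clear_value e2
      have hWj : e'.R .W (32 + j) = W j := by
        rw [hR _ (by decide), r1 _ (by decide), hW j hj]
      have e3 : 32 + j + 1 - 32 = j + 1 := by omega
      have e4 : 32 + j - 32 = j := by omega
      rw [e4] at h2 h3
      rw [e3, Finset.sum_range_succ, Finset.sum_range_succ, if_pos hj, if_pos hj, ← h2, ← h3]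
      push_cast at hpar
      refine ⟨?_, ?_, ?_⟩
      · intro l hl hlk
        simp [Cmd.run, g2, Function.update_apply]
        by_cases hlj : l = j
        · subst hlj; simp [hpar]
        · rw [if_neg hlj, g1]; exact h1 l hl (by omega)
      · simp [Cmd.run, g2, g1, hWj]
      · simp [Cmd.run, g2, g1, hWj, hpar]
    · rw [if_neg (by simp [hik, hc, h.cnt]; omega), Cmd.run.eq_1]
      refine ⟨?_, ?_, ?_⟩
      · intro j hj hjk; exact h1 j hj (by omega)
      · rw [Env.setN_R, h2]
        by_cases hk2 : 32 ≤ k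
        · rw [Nat.succ_sub hk2, Finset.sum_range_succ, if_neg (by omega), add_zero]
        · rw [show k + 1 - 32 = k - 32 by omega]
      · rw [Env.setN_R, h3]
        by_cases hk2 : 32 ≤ k
        · rw [Nat.succ_sub hk2, Finset.sum_range_succ, if_neg (by omega), add_zero]
        · rw [show k + 1 - 32 = k - 32 by omega]

/-- Update the parameters and the sums of coefficients. -/
def updateCmd : Cmd :=
  .loop .t .m (.ite (.and (.le (.const 32) (sc .t)) (.lt (sc .t) (sc .cnt)))
    -- The sum must receive the coefficient of the predictor just used, hence before the parameter
    -- changes.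
    (.setR .acc (sc .t) (.add (.get .acc (sc .t)) (.div (.mul (rsc .rad)
        (.sub (.exp (.get .W (sc .t))) (.exp (.sub (rc 0) (.get .W (sc .t)))))) (rsc .Z))) ;;
      .setR .W (sc .t) (.sub (.get .W (sc .t)) (.mul (.mul (rsc .eta) (rsc .g))
        (.get .chi (sc .t))))) .skip)

theorem updateCmd_run {N m : ℕ} {e : Env} (hm : e.N .m 0 = m) (hc : e.N .cnt 0 = 32 + N)
    (hle : 32 + N ≤ m) {W A χ : ℕ → ℝ} {Z g rad eta : ℝ} (hW : ∀ j < N, e.R .W (32 + j) = W j)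
    (hA : ∀ j < N, e.R .acc (32 + j) = A j) (hχ : ∀ j < N, e.R .chi (32 + j) = χ j)
    (hZ : e.R .Z 0 = Z) (hg : e.R .g 0 = g) (hr : e.R .rad 0 = rad) (he : e.R .eta 0 = eta) :
    (∀ j < N, (updateCmd.run e).R .W (32 + j) = W j - eta * g * χ j) ∧
    (∀ j < N, (updateCmd.run e).R .acc (32 + j) =
      A j + rad * (Real.exp (W j) - Real.exp (-W j)) / Z) := by
  have inv := Cmd.loop_inv (i := .t) (hi := .m)
    (c := .ite (.and (.le (.const 32) (sc .t)) (.lt (sc .t) (sc .cnt)))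
    (.setR .acc (sc .t) (.add (.get .acc (sc .t)) (.div (.mul (rsc .rad)
        (.sub (.exp (.get .W (sc .t))) (.exp (.sub (rc 0) (.get .W (sc .t)))))) (rsc .Z))) ;;
      .setR .W (sc .t) (.sub (.get .W (sc .t)) (.mul (.mul (rsc .eta) (rsc .g))
        (.get .chi (sc .t))))) .skip) (by decide) e (fun k e' =>
      (∀ j < N, e'.R .W (32 + j) = if 32 + j < k then W j - eta * g * χ j else W j) ∧
      (∀ j < N, e'.R .acc (32 + j) = if 32 + j < k then
        A j + rad * (Real.exp (W j) - Real.exp (-W j)) / Z else A j)) ?_ ?_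
  · rw [hm] at inv
    refine ⟨fun j hj => ?_, fun j hj => ?_⟩
    · have := inv.1 j hj; rw [if_pos (by omega)] at this; exact this
    · have := inv.2 j hj; rw [if_pos (by omega)] at this; exact this
  · refine ⟨fun j hj => ?_, fun j hj => ?_⟩
    · rw [if_neg (by omega)]; exact hW j hj
    · rw [if_neg (by omega)]; exact hA j hj
  · intro k hk e' hN hR hik ⟨h1, h2⟩
    have hc' : e'.N .cnt 0 = 32 + N := by rw [hN _ (by decide) (by decide), hc]
    have g1 := hR .Z (by decide)
    have g2 := hR .g (by decide)
    have g3 := hR .rad (by decide)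
    have g4 := hR .eta (by decide)
    have g5 := hR .chi (by decide)
    rw [Cmd.run.eq_5]
    by_cases hk1 : 32 ≤ k ∧ k < 32 + N
    · rw [if_pos (by simp [hik, hc']; omega)]
      obtain ⟨l, rfl⟩ := Nat.exists_eq_add_of_le hk1.1
      have hl : l < N := by omega
      have w1 := h1 l hl
      have w2 := h2 l hl
      rw [if_neg (by omega)] at w1 w2
      refine ⟨fun j hj => ?_, fun j hj => ?_⟩
      · simp [Cmd.run, hik, Function.update_apply]
        by_cases hjl : j = l
        · subst hjl
          simp [w1, g2, g4, g5, hχ j hj, hg, he]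
        · rw [if_neg hjl, h1 j hj]
          apply if_congr _ rfl rfl; omega
      · simp [Cmd.run, hik, Function.update_apply]
        by_cases hjl : j = l
        · subst hjl
          simp [w1, w2, g1, g3, hZ, hr]
        · rw [if_neg hjl, h2 j hj]
          apply if_congr _ rfl rfl; omega
    · rw [if_neg (by simp [hik, hc']; omega), Cmd.run.eq_1]
      refine ⟨fun j hj => ?_, fun j hj => ?_⟩
      · rw [Env.setN_R, h1 j hj]; apply if_congr _ rfl rfl; omega
      · rw [Env.setN_R, h2 j hj]; apply if_congr _ rfl rfl; omega

/-- The exponentiated gradient algorithm. -/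
def egCmd : Cmd :=
  -- These cells may still contain raw input examples, which share the real memory with the arrays.
  .loop .t .m (.setR .W (sc .t) (rc 0) ;; .setR .acc (sc .t) (rc 0)) ;;
  .loop .s .m (.ite (.le (sc .half) (sc .s))
    (predCmd ;; rassign .h (.div (.mul (rsc .rad) (rsc .h)) (rsc .Z)) ;;
      rassign .stat (.sub (.ofNat (.add (xbit (sc .s) (sc .n)) (xbit (sc .s) (sc .n)))) (rc 1)) ;;
      rassign .g (.div (.mul (.sub (rc 0) (rc 2)) (rsc .stat))
        (.add (rc 1) (.exp (.mul (.mul (rc 2) (rsc .stat)) (rsc .h))))) ;;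
      updateCmd) .skip)

theorem egCmd_run {n m M : ℕ} {z : ℕ → Example n} {L : List (Finset (Fin n))} {e : Env}
    (hD : Data m z e) (h : FeatRep L e) (hle : 32 + L.length ≤ m) {rad eta : ℝ}
    (hr : e.R .rad 0 = rad) (he : e.R .eta 0 = eta) (hM : e.N .half 0 = M) :
    ∀ j < L.length, (egCmd.run e).R .acc (32 + j) = egAcc L M rad eta z m j := by
  rw [egCmd, Cmd.run.eq_4]
  set e1 := Cmd.run (.loop .t .m _) e with he1
  have f1 : ∀ a, a ≠ .t → e1.N a = e.N a := fun a h1 =>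
    Cmd.run_N _ _ _ (by simp [Cmd.writesN, h1])
  have r1 : ∀ a, a ∉ [RV.W, .acc] → e1.R a = e.R a := by
    intro a ha; simp at ha; exact Cmd.run_R _ _ _ (by simp [Cmd.writesR, ha])
  have z1 : ∀ j < e.N .m 0, e1.R .W j = 0 ∧ e1.R .acc j = 0 := by
    refine Cmd.loop_inv (i := .t) (hi := .m) (by decide) e (fun k e' =>
      ∀ j < k, e'.R .W j = 0 ∧ e'.R .acc j = 0) (by simp) ?_
    intro k hk e' hN hR hik hP j hj
    simp [Cmd.run, hik, Function.update_apply]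
    by_cases hjk : j = k
    · simp [hjk]
    · simp [hjk, hP j (by omega)]
  clear_value e1
  rw [hD.hm] at z1
  have inv := Cmd.loop_inv (i := .s) (hi := .m) (c := .ite (.le (sc .half) (sc .s))
    (predCmd ;; rassign .h (.div (.mul (rsc .rad) (rsc .h)) (rsc .Z)) ;;
      rassign .stat (.sub (.ofNat (.add (xbit (sc .s) (sc .n)) (xbit (sc .s) (sc .n)))) (rc 1)) ;;
      rassign .g (.div (.mul (.sub (rc 0) (rc 2)) (rsc .stat))
        (.add (rc 1) (.exp (.mul (.mul (rc 2) (rsc .stat)) (rsc .h))))) ;;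
      updateCmd) .skip) (by decide) e1 (fun k e' =>
      (∀ j < L.length, e'.R .W (32 + j) = egW L M rad eta z k j) ∧
      (∀ j < L.length, e'.R .acc (32 + j) = egAcc L M rad eta z k j)) ?_ ?_
  · rw [f1 _ (by decide), hD.hm] at inv
    exact inv.2
  · refine ⟨fun j hj => ?_, fun j hj => ?_⟩
    · simp [egW, z1 (32 + j) (by omega)]
    · simp [egAcc, z1 (32 + j) (by omega)]
  · intro k hk e' hN hR hik ⟨h1, h2⟩
    rw [f1 _ (by decide), hD.hm] at hk
    have f2 : ∀ a, a ∉ [NV.par, .i, .t, .s] → e'.N a = e.N a := by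
      intro a ha
      simp at ha
      rw [hN a ha.2.2.2 (by simp [predCmd, updateCmd, parCmd, Cmd.writesN]; tauto), f1 _ ha.2.2.1]
    have hM' : e'.N .half 0 = M := by rw [f2 _ (by decide), hM]
    rw [Cmd.run.eq_5]
    by_cases hMk : M ≤ k
    swap
    · rw [if_neg (by simp [hM', hik]; omega), Cmd.run.eq_1]
      refine ⟨fun j hj => ?_, fun j hj => ?_⟩
      · rw [Env.setN_R, h1 j hj, egW]; exact (if_neg hMk).symm
      · rw [Env.setN_R, h2 j hj, egAcc, egAcc, Finset.Ico_eq_empty_of_le (by omega),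
          Finset.Ico_eq_empty_of_le (by omega)]
    rw [if_pos (by simp [hM', hik]; omega), Cmd.run.eq_4]
    have hD' : Data m z e' := hD.congr (f2 _ (by decide)) (f2 _ (by decide)) (f2 _ (by decide))
        (f2 _ (by decide))
    have hF' : FeatRep L e' := h.congr (f2 _ (by decide)) (f2 _ (by decide)) (f2 _ (by decide))
    obtain ⟨p1, p2, p3⟩ := predCmd_run hD' hF' hk hik hle h1
    have g1 : ∀ a, a ∉ [NV.par, .i, .t] → (predCmd.run e').N a = e'.N a := by
      intro a ha
      simp at ha
      exact Cmd.run_N _ _ _ (by simp [predCmd, parCmd, Cmd.writesN]; tauto)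
    have g2 : ∀ a, a ∉ [RV.Z, .h, .chi] → (predCmd.run e').R a = e'.R a := by
      intro a ha
      simp at ha
      exact Cmd.run_R _ _ _ (by simp [predCmd, parCmd, Cmd.writesR]; tauto)
    set e2 := predCmd.run e' with he2
    clear_value e2
    rw [Cmd.run.eq_4, Cmd.run.eq_4, Cmd.run.eq_4]
    set e3 := Cmd.run (rassign .h (.div (.mul (rsc .rad) (rsc .h)) (rsc .Z))) e2 with he3
    have k1 : e3.N = e2.N := by simp [he3, Cmd.run]
    have k2 : ∀ a, a ≠ .h → e3.R a = e2.R a := by intro a ha; simp [he3, Cmd.run, ha]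
    have hr2 : e2.R .rad 0 = rad := by
      rw [g2 _ (by decide), hR _ (by decide), r1 _ (by decide), hr]
    have k3 : e3.R .h 0 = egPred L rad (egW L M rad eta z k) (z k).1 := by
      simp [he3, Cmd.run, p2, p3, hr2, egPred]
    clear_value e3
    set e4 := Cmd.run (rassign .stat _) e3 with he4
    have l1 : e4.N = e2.N := by simp [he4, Cmd.run, k1]
    have l2 : ∀ a, a ≠ .stat → e4.R a = e3.R a := by intro a ha; simp [he4, Cmd.run, ha]
    have l3 : e4.R .stat 0 = spin (z k).2 := by
      have := hD'.label k hk
      simp [he4, Cmd.run, k1, g1, hik, hD'.row k hk, hD'.hn, this, spin_eq_bit]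
    clear_value e4
    set e5 := Cmd.run (rassign .g _) e4 with he5
    have m1 : e5.N = e2.N := by simp [he5, Cmd.run, l1]
    have m2 : ∀ a, a ≠ .g → e5.R a = e4.R a := by intro a ha; simp [he5, Cmd.run, ha]
    have m3 : e5.R .g 0 = lossDeriv (egPred L rad (egW L M rad eta z k) (z k).1) (z k).2 := by
      simp [he5, Cmd.run, l3, l2, k3, lossDeriv]
    clear_value e5
    have o1 : ∀ a, a ∉ [RV.g, .stat, .h, .Z, .chi] → e5.R a = e'.R a := by
      intro a ha
      simp at ha
      rw [m2 _ ha.1, l2 _ ha.2.1, k2 _ ha.2.2.1, g2 _ (by simp; tauto)]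
    obtain ⟨u1, u2⟩ := updateCmd_run (e := e5) (m := m) (N := L.length) (by rw [m1, g1 _ (by decide), hD'.hm])
      (by rw [m1, g1 _ (by decide), hF'.cnt]) hle
      (W := egW L M rad eta z k) (A := egAcc L M rad eta z k)
      (χ := fun j => monom (L.getD j ∅) (z k).1) (fun j hj => by rw [o1 _ (by decide), h1 j hj])
      (fun j hj => by rw [o1 _ (by decide), h2 j hj])
      (fun j hj => by rw [m2 _ (by decide), l2 _ (by decide), k2 _ (by decide), p1 j hj])
      (by rw [m2 _ (by decide), l2 _ (by decide), k2 _ (by decide), p2]) m3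
      (by rw [m2 _ (by decide), l2 _ (by decide), k2 _ (by decide), hr2])
      (by rw [o1 _ (by decide), hR _ (by decide), r1 _ (by decide), he])
    refine ⟨fun j hj => ?_, fun j hj => ?_⟩
    · rw [Env.setN_R, u1 j hj, egW]; exact (if_pos hMk).symm
    · rw [Env.setN_R, u2 j hj, egAcc, egAcc, Finset.sum_Ico_succ_top hMk]

end ArrayProg

/-! ### Parameters of the algorithm -/

namespace RBMLearn

/-- The threshold for the conditional covariance. -/
noncomputable def thrVal (lam al be : ℝ) : ℝ := be * al * al * Real.exp (-(10 * lam)) / 8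

/-- The bound on the sum of the absolute values of the coefficients. -/
noncomputable def radVal (n : ℕ) (lam al be : ℝ) : ℝ :=
  2 * n * lam + 1 / be + 2 * n * (lam * lam / al) * Real.exp (lam / al)

/-- The step size. -/
noncomputable def etaVal (eps rad : ℝ) : ℝ := eps / (16 * rad)

/-- The smoothed frequency of the label `1`, from `c` occurrences among `m` examples. -/
noncomputable def freqVal (eps c : ℝ) (m : ℕ) : ℝ := (1 - eps / 2) * (c / m) + eps / 4

/-- A sequence of examples that continues the given ones. -/
def extend {n m : ℕ} (s : Fin m → Example n) (t : ℕ) : Example n :=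
  if h : t < m then s ⟨t, h⟩ else (fun _ => 1, 1)

/-- The monomials computed from the first half of `m` examples. -/
noncomputable def learnedFeats {n : ℕ} (z : ℕ → Example n) (m : ℕ) (lam al be : ℝ) :
    List (Finset (Fin n)) :=
  feats z (m / 2) (thrVal lam al be * (m / 2 : ℕ)) n

end RBMLearn

/-! ### Preparation, the main command, loading of input and moving of output -/

namespace ArrayProg

set_option linter.constructorNameAsVariable false
set_option linter.unusedSimpArgs false

open RBMLearn RealRAM

/-- Without multiplication or division of naturals, `m / 2` is found by counting pairs and the row
starts by repeated addition. The last value of `M` is the number of spins to load. -/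
def initCmd : Cmd :=
  assign .half (.const 0) ;;
  .loop .s .m (.ite (.le (.add (.add (sc .half) (sc .half)) (.const 2)) (sc .m)) (incr .half)
    .skip) ;;
  assign .M (.const 0) ;;
  .loop .s .m (.setN .rowX (sc .s) (sc .M) ;;
    assign .M (.add (sc .M) (.add (sc .n) (.const 1))))

theorem initCmd_run {n m : ℕ} {e : Env} (hn : e.N .n 0 = n) (hm : e.N .m 0 = m) :
    (initCmd.run e).N .half 0 = m / 2 ∧ (initCmd.run e).N .M 0 = m * (n + 1) ∧
      ∀ s < m, (initCmd.run e).N .rowX s = s * (n + 1) := by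
  rw [initCmd, Cmd.run.eq_4, Cmd.run.eq_4, Cmd.run.eq_4]
  set e1 := Cmd.run (assign .half (.const 0)) e with he1
  have f1 : ∀ a, a ≠ .half → e1.N a = e.N a := fun a h1 =>
    Cmd.run_N _ _ _ (by simp [Cmd.writesN, h1])
  have z1 : e1.N .half 0 = 0 := by simp [he1, Cmd.run]
  clear_value e1
  set e2 := Cmd.run (.loop .s .m (.ite (.le (.add (.add (sc .half) (sc .half)) (.const 2)) (sc .m))
    (incr .half) .skip)) e1 with he2
  have f2 : ∀ a, a ∉ [NV.half, .s] → e2.N a = e.N a := by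
    intro a ha
    simp at ha
    rw [← f1 a ha.1]
    exact Cmd.run_N _ _ _ (by simp [Cmd.writesN]; tauto)
  have h2 : e2.N .half 0 = min (e1.N .m 0) (m / 2) := by
    refine Cmd.loop_inv (i := .s) (hi := .m) (by decide) e1 (fun k e' =>
      e'.N .half 0 = min k (m / 2)) (by simp [z1]) ?_
    intro k hk e' hN hR hik hP
    have : e'.N .m 0 = m := by rw [hN _ (by decide) (by decide), f1 _ (by decide), hm]
    simp only [Cmd.run, BE.Holds, NE.eval, this]
    split_ifs with hc
    · simp [hP] at hc ⊢; omega
    · simp [hP] at hc ⊢; omega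
  rw [f1 _ (by decide), hm] at h2
  clear_value e2
  set e3 := Cmd.run (assign .M (.const 0)) e2 with he3
  have f3 : ∀ a, a ≠ .M → e3.N a = e2.N a := fun a h1 =>
    Cmd.run_N _ _ _ (by simp [Cmd.writesN, h1])
  have z3 : e3.N .M 0 = 0 := by simp [he3, Cmd.run]
  clear_value e3
  have h4 := Cmd.loop_inv (i := .s) (hi := .m) (c := .setN .rowX (sc .s) (sc .M) ;;
    assign .M (.add (sc .M) (.add (sc .n) (.const 1)))) (by decide) e3 (fun k e' =>
      e'.N .M 0 = k * (n + 1) ∧ ∀ s < k, e'.N .rowX s = s * (n + 1)) (by simp [z3]) (by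
    intro k hk e' hN hR hik ⟨h1, h2⟩
    have hn' : e'.N .n 0 = n := by
      rw [hN _ (by decide) (by decide), f3 _ (by decide), f2 _ (by decide), hn]
    refine ⟨?_, fun s hs => ?_⟩
    · simp [Cmd.run, h1, hn']; ring
    · simp [Cmd.run, hik, h1, Function.update_apply]
      split_ifs with hsk
      · rw [hsk]
      · exact h2 s (by omega))
  rw [f3 _ (by decide), f2 _ (by decide), hm] at h4
  refine ⟨?_, h4⟩
  rw [Cmd.run_N _ _ _ (by decide), f3 _ (by decide), h2]
  omega

/-- The predictor if the label is independent of the features. -/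
def constCmd : Cmd :=
  assign .cN (.const 0) ;;
  .loop .s .m (assign .cN (.add (sc .cN) (xbit (sc .s) (sc .n)))) ;;
  rassign .Z (.add (.mul (.sub (rc 1) (.div (rsc .eps) (rc 2)))
    (.div (.ofNat (sc .cN)) (.ofNat (sc .m)))) (.div (rsc .eps) (rc 4))) ;;
  .setR .acc (.const 32) (.div (.log (.div (rsc .Z) (.sub (rc 1) (rsc .Z)))) (rc 2)) ;;
  assign .cnt (.const 33) ;;
  .setN .rowF (.const 32) (NE.mul32 (sc .n)) ;;
  .setN .rowF (.const 33) (.add (NE.mul32 (sc .n)) (sc .n))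

theorem constCmd_run {n m : ℕ} {z : ℕ → Example n} {e : Env} (hD : Data m z e)
    (hF0 : ∀ q, e.N .F q = 0) :
    FeatRep [(∅ : Finset (Fin n))] (constCmd.run e) ∧
    (constCmd.run e).R .acc 32 =
      Real.log (freqVal (e.R .eps 0) (∑ t ∈ Finset.range m, bit (z t).2 : ℕ) m /
        (1 - freqVal (e.R .eps 0) (∑ t ∈ Finset.range m, bit (z t).2 : ℕ) m)) / 2 := by
  rw [constCmd, Cmd.run.eq_4, Cmd.run.eq_4]
  set e1 := Cmd.run (assign .cN (.const 0)) e with he1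
  have f1 : ∀ a, a ≠ .cN → e1.N a = e.N a := fun a h1 =>
    Cmd.run_N _ _ _ (by simp [Cmd.writesN, h1])
  have r1 : e1.R = e.R := by simp [he1, Cmd.run]
  have z1 : e1.N .cN 0 = 0 := by simp [he1, Cmd.run]
  clear_value e1
  set e2 := Cmd.run (.loop .s .m _) e1 with he2
  have f2 : ∀ a, a ∉ [NV.cN, .s] → e2.N a = e.N a := by
    intro a ha
    simp at ha
    rw [← f1 a ha.1]
    exact Cmd.run_N _ _ _ (by simp [Cmd.writesN]; tauto)
  have r2 : e2.R = e.R := by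
    rw [← r1]; funext a; exact Cmd.run_R _ _ _ (by simp [Cmd.writesR])
  have h2 : e2.N .cN 0 = ∑ t ∈ Finset.range (e1.N .m 0), bit (z t).2 := by
    refine Cmd.loop_inv (i := .s) (hi := .m) (by decide) e1 (fun k e' =>
      e'.N .cN 0 = ∑ t ∈ Finset.range k, bit (z t).2) (by simp [z1]) ?_
    intro k hk e' hN hR hik hP
    rw [f1 _ (by decide), hD.hm] at hk
    have g : ∀ a, a ∉ [NV.cN, .s] → e'.N a = e.N a := by
      intro a ha
      simp at ha
      rw [hN a ha.2 (by simp [Cmd.writesN]; tauto), f1 a ha.1]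
    rw [Finset.sum_range_succ]
    simp [Cmd.run, hik, hP, g, hD.row k hk, hD.hn, hD.label k hk]
  rw [f1 _ (by decide), hD.hm] at h2
  clear_value e2
  refine ⟨⟨?_, ?_, ?_, ?_⟩, ?_⟩
  · simp [Cmd.run]
  · intro k hk
    simp only [List.length_cons, List.length_nil, zero_add] at hk
    interval_cases k
    · simp [Cmd.run, f2, hD.hn, NE.mul32_eval]
    · simp [Cmd.run, f2, hD.hn, NE.mul32_eval]; ring
  · intro k hk i
    simp only [List.length_cons, List.length_nil, zero_add, Nat.lt_one_iff] at hk
    subst hk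
    simp [Cmd.run, f2, hF0]
  · intro q _
    simp [Cmd.run, f2, hF0]
  · simp [Cmd.run, r2, h2, freqVal, f2, hD.hm]

def paramCmd : Cmd :=
  rassign .thr (.mul (.div (.mul (.mul (.mul (rsc .be) (rsc .al)) (rsc .al))
    (.exp (.sub (rc 0) (.mul (rc 10) (rsc .lam))))) (rc 8)) (.ofNat (sc .half))) ;;
  rassign .rad (.add (.add (.mul (.mul (rc 2) (.ofNat (sc .n))) (rsc .lam))
    (.div (rc 1) (rsc .be))) (.mul (.mul (.mul (rc 2) (.ofNat (sc .n)))
      (.div (.mul (rsc .lam) (rsc .lam)) (rsc .al))) (.exp (.div (rsc .lam) (rsc .al))))) ;;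
  rassign .eta (.div (rsc .eps) (.mul (rc 16) (rsc .rad)))

/-- Divide the sums of coefficients by the number of summands. -/
def averageCmd : Cmd :=
  .loop .t .m (.setR .acc (sc .t) (.div (.get .acc (sc .t))
    (.sub (.ofNat (sc .m)) (.ofNat (sc .half)))))

def mainCmd : Cmd :=
  .ite (.rle (rsc .al) (rsc .lam)) (paramCmd ;; featCmd ;; egCmd ;; averageCmd) constCmd

theorem mainCmd_run_pos {n m : ℕ} {z : ℕ → Example n} {e : Env} (hD : Data m z e)
    (hF0 : ∀ q, e.N .F q = 0) (hM : e.N .half 0 = m / 2) {lam al be eps : ℝ}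
    (h1 : e.R .lam 0 = lam) (h2 : e.R .al 0 = al) (h3 : e.R .be 0 = be) (h4 : e.R .eps 0 = eps)
    (hal : al ≤ lam)
    (hle : ∀ k, ∀ hk : k < n, ∀ l ≤ n, 32 + (feats z (m / 2) (thrVal lam al be * (m / 2 : ℕ)) k ++
      (scan z (m / 2) (thrVal lam al be * (m / 2 : ℕ)) ⟨k, hk⟩ l).2).length ≤ m)
    (hle' : 32 + (learnedFeats z m lam al be).length ≤ m) :
    FeatRep (learnedFeats z m lam al be) (mainCmd.run e) ∧
    ∀ j < (learnedFeats z m lam al be).length, (mainCmd.run e).R .acc (32 + j) =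
      egAcc (learnedFeats z m lam al be) (m / 2) (radVal n lam al be)
        (etaVal eps (radVal n lam al be)) z m j / (m - (m / 2 : ℕ)) := by
  rw [mainCmd, Cmd.run.eq_5, if_pos (by simp [h1, h2, hal]), Cmd.run.eq_4]
  set e1 := paramCmd.run e with he1
  have f1 : e1.N = e.N := by funext a; exact Cmd.run_N _ _ _ (by simp [paramCmd, Cmd.writesN])
  have t1 : e1.R .thr 0 = thrVal lam al be * (m / 2 : ℕ) := by
    simp [he1, paramCmd, Cmd.run, h1, h2, h3, hM, thrVal]
  have t2 : e1.R .rad 0 = radVal n lam al be := by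
    simp [he1, paramCmd, Cmd.run, h1, h2, h3, hD.hn, radVal]
  have t3 : e1.R .eta 0 = etaVal eps (radVal n lam al be) := by
    simp [he1, paramCmd, Cmd.run, h1, h2, h3, h4, hD.hn, radVal, etaVal]
  clear_value e1
  have hD1 : Data m z e1 := hD.congr (by rw [f1]) (by rw [f1]) (by rw [f1]) (by rw [f1])
  have hF := featCmd_run (M := m / 2) hD1 (by rw [f1]; exact hF0) (by rw [f1]; exact hM)
    (Nat.div_le_self _ _) t1 hle
  rw [Cmd.run.eq_4, Cmd.run.eq_4]
  set e2 := featCmd.run e1 with he2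
  have g2 : ∀ a, a ∈ [NV.n, .m, .X, .rowX, .half] → e2.N a = e1.N a := by
    intro a ha
    simp at ha
    rcases ha with rfl | rfl | rfl | rfl | rfl <;> exact Cmd.run_N _ _ _ (by decide)
  have r2 : ∀ a, a ≠ .stat → e2.R a = e1.R a := by
    intro a ha
    refine Cmd.run_R _ _ _ ?_
    simp [featCmd, scanCmd, dblCmd, appendCmd, statCmd, countCmd, agreeCmd, Cmd.writesR, ha]
  clear_value e2
  have hD2 : Data m z e2 := hD1.congr (g2 _ (by decide)) (g2 _ (by decide)) (g2 _ (by decide))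
    (g2 _ (by decide))
  have hE := egCmd_run hD2 hF hle' (by rw [r2 _ (by decide), t2]) (by rw [r2 _ (by decide), t3])
    (M := m / 2) (by rw [g2 _ (by decide), f1, hM])
  set e3 := egCmd.run e2 with he3
  have g3 : ∀ a, a ∈ [NV.m, .half, .cnt, .rowF, .F] → e3.N a = e2.N a := by
    intro a ha
    simp at ha
    rcases ha with rfl | rfl | rfl | rfl | rfl <;> exact Cmd.run_N _ _ _ (by decide)
  clear_value e3
  refine ⟨FeatRep.congr (e := e2) hF ?_ ?_ ?_, ?_⟩
  · rw [Cmd.run_N _ _ _ (by decide), g3 _ (by decide)]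
  · rw [Cmd.run_N _ _ _ (by decide), g3 _ (by decide)]
  · rw [Cmd.run_N _ _ _ (by decide), g3 _ (by decide)]
  · have inv : ∀ j, (averageCmd.run e3).R .acc j = if j < e3.N .m 0 then
        e3.R .acc j / (m - (m / 2 : ℕ)) else e3.R .acc j := by
      refine Cmd.loop_inv (i := .t) (hi := .m) (by decide) e3 (fun k e' =>
        ∀ j, e'.R .acc j = if j < k then e3.R .acc j / (m - (m / 2 : ℕ)) else e3.R .acc j)
        (by simp) ?_
      intro k hk e' hN hR hik hP j
      have hm' : e'.N .m 0 = m := by rw [hN _ (by decide) (by decide), g3 _ (by decide), hD2.hm]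
      have hh' : e'.N .half 0 = m / 2 := by
        rw [hN _ (by decide) (by decide), g3 _ (by decide), g2 _ (by decide), f1, hM]
      by_cases hjk : j = k
      · subst hjk
        simp [Cmd.run, hik, hm', hh', hP j]
      · simp [Cmd.run, hik, Function.update_apply, hjk, hP j]
        apply if_congr _ rfl rfl; omega
    intro j hj
    rw [inv, if_pos (by rw [g3 _ (by decide), hD2.hm]; omega), hE j hj]
    rfl

theorem mainCmd_run_neg {n m : ℕ} {z : ℕ → Example n} {e : Env} (hD : Data m z e)
    (hF0 : ∀ q, e.N .F q = 0) (hal : e.R .lam 0 < e.R .al 0) :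
    FeatRep [(∅ : Finset (Fin n))] (mainCmd.run e) ∧
    (mainCmd.run e).R .acc 32 =
      Real.log (freqVal (e.R .eps 0) (∑ t ∈ Finset.range m, bit (z t).2 : ℕ) m /
        (1 - freqVal (e.R .eps 0) (∑ t ∈ Finset.range m, bit (z t).2 : ℕ) m)) / 2 := by
  rw [mainCmd, Cmd.run.eq_5, if_neg (by simpa using hal)]
  exact constCmd_run hD hF0

/-- A loop whose counter, the cell `c`, runs from `a` up to the value `b` of the cell `d`. -/
theorem counter_loop {c d : ℕ} {P : Program} {a b T : ℕ} (I : ℕ → State → Prop)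
    (hI : ∀ k σ, I k σ → σ.nat c = k ∧ σ.nat d = b)
    (hs : ∀ k, a ≤ k → k < b → ∀ σ, I k σ → ∃ t ≤ T, ∃ τ, Runs P σ t τ ∧ I (k + 1) τ)
    (hab : a ≤ b) (σ : State) (h0 : I a σ) :
    ∃ t ≤ (b - a + 1) * (T + 7), ∃ τ,
      Runs (.loop (.natLE (.add (.cell (.const c)) (.const 1)) (.cell (.const d))) P) σ t τ ∧
        I b τ := by
  have main : ∀ l k, a ≤ k → k + l = b → ∀ σ, I k σ → ∃ t ≤ (l + 1) * (T + 7), ∃ τ,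
      Runs (.loop (.natLE (.add (.cell (.const c)) (.const 1)) (.cell (.const d))) P) σ t τ ∧
        I b τ := by
    intro l
    induction l with
    | zero =>
      intro k hak hk σ h
      obtain rfl : k = b := by omega
      obtain ⟨hc, hd⟩ := hI _ _ h
      refine ⟨_, ?_, σ, Runs.loopFalse ?_, h⟩
      · simp [Test.cost, NatExpr.cost]
      · simp [Test.Holds, NatExpr.eval, hc, hd]
    | succ l ih =>
      intro k hak hk σ h
      obtain ⟨hc, hd⟩ := hI _ _ h
      obtain ⟨t, ht, τ, hr, hτ⟩ := hs k hak (by omega) σ h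
      obtain ⟨t', ht', τ', hr', hτ'⟩ := ih (k + 1) (by omega) (by omega) τ hτ
      refine ⟨_, ?_, τ', Runs.loopTrue ?_ hr hr', hτ'⟩
      · simp only [Test.cost, NatExpr.cost]
        have : (l + 1 + 1) * (T + 7) = (l + 1) * (T + 7) + (T + 7) := by ring
        omega
      · simp [Test.Holds, NatExpr.eval, hc, hd]; omega
  exact main (b - a) a le_rfl (by omega) σ h0

/-- Convert the labelled examples to bits. -/
def loadProg : Program :=
  -- Machine code is used directly because the examples lie contiguously from real cell 6 on, not in
  -- an array layout. Cells 18 and 4 are the scalars `t` and `M`, and array 2 is `X`.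
  .seq (.setNat (.const 18) (.const 0))
    (.loop (.natLE (.add (.cell (.const 18)) (.const 1)) (.cell (.const 4)))
      (.seq (.ite (.realLE (.ofNat (.const 0)) (.cell (.add (.const 6) (.cell (.const 18)))))
        (.setNat (addr 2 (.cell (.const 18))) (.const 1))
        (.setNat (addr 2 (.cell (.const 18))) (.const 0)))
        (.setNat (.const 18) (.add (.cell (.const 18)) (.const 1)))))

theorem setNat_envOf_t (σ : State) (v : ℕ) :
    envOf { σ with nat := Function.update σ.nat 18 v } = (envOf σ).setN .t 0 v :=
  envOf_setNat σ .t 0 v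

theorem setNat_envOf_X (σ : State) (j v : ℕ) :
    envOf { σ with nat := Function.update σ.nat (32 * j + 2) v } = (envOf σ).setN .X j v :=
  envOf_setNat σ .X j v

open Classical in
theorem loadProg_run : ∃ K : ℕ, ∀ (σ : State) (b : ℕ), (envOf σ).N .M 0 = b →
    ∃ t ≤ K * (b + 1), ∃ τ, Runs loadProg σ t τ ∧ τ.real = σ.real ∧
      (∀ a, a ≠ NV.X → a ≠ .t → (envOf τ).N a = (envOf σ).N a) ∧
      ∀ q < b, (envOf τ).N .X q = if 0 ≤ σ.real (6 + q) then 1 else 0 := by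
  obtain ⟨T, hT⟩ : ∃ T : ℕ, T = 1000 := ⟨_, rfl⟩
  refine ⟨1 + 1 + 1 + (T + 7), fun σ b hb => ?_⟩
  set σ1 : State := { σ with nat := Function.update σ.nat 18 0 } with hσ1
  have h1 : Runs (.setNat (.const 18) (.const 0)) σ (1 + 1 + 1) σ1 :=
    Runs.setNat (.const 18) (.const 0) σ
  have H := counter_loop (c := 18) (d := 4) (a := 0) (b := b) (T := T)
    (P := .seq (.ite (.realLE (.ofNat (.const 0)) (.cell (.add (.const 6) (.cell (.const 18)))))
        (.setNat (addr 2 (.cell (.const 18))) (.const 1))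
        (.setNat (addr 2 (.cell (.const 18))) (.const 0)))
        (.setNat (.const 18) (.add (.cell (.const 18)) (.const 1))))
    (fun k τ => (envOf τ).N .t 0 = k ∧ τ.real = σ.real ∧
      (∀ a, a ≠ NV.X → a ≠ .t → (envOf τ).N a = (envOf σ).N a) ∧
      ∀ q < k, (envOf τ).N .X q = if 0 ≤ σ.real (6 + q) then 1 else 0) ?_ ?_ (Nat.zero_le _) σ1 ?_
  · obtain ⟨t, ht, τ, hr, hI⟩ := H
    refine ⟨_, ?_, τ, Runs.seq h1 hr, hI.2⟩
    rw [Nat.sub_zero] at ht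
    nlinarith
  · rintro k τ ⟨i1, i2, i3, i4⟩
    refine ⟨i1, ?_⟩
    have := congrFun (i3 .M (by decide) (by decide)) 0
    rw [hb] at this
    exact this
  · rintro k - hk τ ⟨i1, i2, i3, i4⟩
    have h18 : τ.nat 18 = k := i1
    obtain ⟨τ1, t1, ht1, hr1, hτ1⟩ : ∃ τ1 : State, ∃ t1 ≤ 500, Runs (.ite (.realLE (.ofNat (.const 0))
        (.cell (.add (.const 6) (.cell (.const 18)))))
        (.setNat (addr 2 (.cell (.const 18))) (.const 1))
        (.setNat (addr 2 (.cell (.const 18))) (.const 0))) τ t1 τ1 ∧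
        τ1 = { τ with
          nat := Function.update τ.nat (32 * k + 2) (if 0 ≤ σ.real (6 + k) then 1 else 0) } := by
      by_cases hc : 0 ≤ σ.real (6 + k)
      · refine ⟨_, _, ?_, Runs.iteTrue ?_ (Runs.setNat _ _ _), ?_⟩
        · decide
        · simp [Test.Holds, RealExpr.eval, NatExpr.eval, h18, i2, hc]
        · simp [addr_eval, NatExpr.eval, h18, hc]
      · refine ⟨_, _, ?_, Runs.iteFalse ?_ (Runs.setNat _ _ _), ?_⟩
        · decide
        · simp [Test.Holds, RealExpr.eval, NatExpr.eval, h18, i2]; exact not_le.1 hc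
        · simp [addr_eval, NatExpr.eval, h18, hc]
    have e1 : envOf τ1 = (envOf τ).setN .X k (if 0 ≤ σ.real (6 + k) then 1 else 0) := by
      rw [hτ1, setNat_envOf_X]
    have h18' : τ1.nat 18 = k := by
      have : (envOf τ1).N .t 0 = k := by rw [e1]; simpa using i1
      exact this
    have r1 : τ1.real = σ.real := by rw [hτ1]; exact i2
    clear hτ1
    refine ⟨_, ?_, _, Runs.seq hr1 (Runs.setNat (.const 18)
      (.add (.cell (.const 18)) (.const 1)) τ1), ?_⟩
    · simp [NatExpr.cost]; omega
    · simp only [NatExpr.eval, h18']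
      rw [setNat_envOf_t, e1]
      refine ⟨by simp, r1, ?_, ?_⟩
      · intro a h1 h2; simp [h1, h2, i3 a h1 h2]
      · intro q hq
        simp [Function.update_apply]
        by_cases hqk : q = k
        · simp [hqk]
        · rw [if_neg hqk, i4 q (by omega)]
  · rw [hσ1, setNat_envOf_t]
    refine ⟨by simp, rfl, ?_, by simp⟩
    intro a _ h2; simp [h2]

/-- Copy the coefficients to their final places. -/
def copyRealProg : Program :=
  .seq (.setNat (.const 18) (.const 0))
    (.loop (.natLE (.add (.cell (.const 18)) (.const 1)) (.cell (.const 6)))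
      (.seq (.ite (.natLE (.const 32) (.cell (.const 18)))
        (.setReal (.cell (.const 18)) (.cell (addr 14 (.cell (.const 18)))))
        (.setReal (.cell (.const 18)) (.ofNat (.const 0))))
        (.setNat (.const 18) (.add (.cell (.const 18)) (.const 1)))))

theorem copyRealProg_run : ∃ K : ℕ, ∀ (σ : State) (b : ℕ), σ.nat 6 = b →
    ∃ t ≤ K * (b + 1), ∃ τ, Runs copyRealProg σ t τ ∧ (∀ p, p ≠ 18 → τ.nat p = σ.nat p) ∧
      ∀ p < b, τ.real p = if 32 ≤ p then σ.real (32 * p + 14) else 0 := by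
  obtain ⟨T, hT⟩ : ∃ T : ℕ, T = 1000 := ⟨_, rfl⟩
  refine ⟨1 + 1 + 1 + (T + 7), fun σ b hb => ?_⟩
  set σ1 : State := { σ with nat := Function.update σ.nat 18 0 } with hσ1
  have h1 : Runs (.setNat (.const 18) (.const 0)) σ (1 + 1 + 1) σ1 :=
    Runs.setNat (.const 18) (.const 0) σ
  have H := counter_loop (c := 18) (d := 6) (a := 0) (b := b) (T := T)
    (P := .seq (.ite (.natLE (.const 32) (.cell (.const 18)))
        (.setReal (.cell (.const 18)) (.cell (addr 14 (.cell (.const 18)))))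
        (.setReal (.cell (.const 18)) (.ofNat (.const 0))))
        (.setNat (.const 18) (.add (.cell (.const 18)) (.const 1))))
    (fun k τ => τ.nat 18 = k ∧ (∀ p, p ≠ 18 → τ.nat p = σ.nat p) ∧
      (∀ p < k, τ.real p = if 32 ≤ p then σ.real (32 * p + 14) else 0) ∧
      -- Copying in place upwards is safe: the source `32 * k + 14` lies beyond all the cells
      -- written so far.
      ∀ p, k ≤ p → τ.real p = σ.real p) ?_ ?_ (Nat.zero_le _) σ1 ?_
  · obtain ⟨t, ht, τ, hr, hI⟩ := H
    refine ⟨_, ?_, τ, Runs.seq h1 hr, hI.2.1, hI.2.2.1⟩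
    rw [Nat.sub_zero] at ht
    nlinarith
  · rintro k τ ⟨i1, i2, i3, i4⟩
    exact ⟨i1, by rw [i2 _ (by decide), hb]⟩
  · rintro k - hk τ ⟨i1, i2, i3, i4⟩
    obtain ⟨τ1, t1, ht1, hr1, hτ1⟩ : ∃ τ1 : State, ∃ t1 ≤ 500, Runs (.ite (.natLE (.const 32)
        (.cell (.const 18)))
        (.setReal (.cell (.const 18)) (.cell (addr 14 (.cell (.const 18)))))
        (.setReal (.cell (.const 18)) (.ofNat (.const 0)))) τ t1 τ1 ∧
        τ1 = { τ with
          real := Function.update τ.real k (if 32 ≤ k then σ.real (32 * k + 14) else 0) } := by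
      by_cases hc : 32 ≤ k
      · refine ⟨_, _, ?_, Runs.iteTrue ?_ (Runs.setReal _ _ _), ?_⟩
        · decide
        · simp [Test.Holds, NatExpr.eval, i1, hc]
        · simp [addr_eval, RealExpr.eval, NatExpr.eval, i1, hc, i4 (32 * k + 14) (by omega)]
      · refine ⟨_, _, ?_, Runs.iteFalse ?_ (Runs.setReal _ _ _), ?_⟩
        · decide
        · simp [Test.Holds, NatExpr.eval, i1]; omega
        · simp [RealExpr.eval, NatExpr.eval, i1, hc]
    refine ⟨_, ?_, _, Runs.seq hr1 (Runs.setNat (.const 18)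
      (.add (.cell (.const 18)) (.const 1)) τ1), ?_⟩
    · simp [NatExpr.cost]; omega
    · subst hτ1
      simp only [NatExpr.eval, i1]
      refine ⟨by simp, ?_, ?_, ?_⟩
      · intro p hp; simp [Function.update_apply, hp, i2 p hp]
      · intro p hp
        by_cases hpk : p = k
        · simp [hpk]
        · simp only [Function.update_apply, if_neg hpk]; exact i3 p (by omega)
      · intro p hp
        simp only [Function.update_apply, if_neg (show p ≠ k by omega)]
        exact i4 p (by omega)
  · refine ⟨by simp [hσ1], ?_, by simp, by simp [hσ1]⟩
    intro p hp; simp [hσ1, hp]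

/-- The counter starts at `32 * n`, so the destinations are at least 33 and spare the cells 6, 8 and
18 that are still in use; each source cell lies ahead of the cells already overwritten. -/
def copyNatProg : Program :=
  .loop (.natLE (.add (.cell (.const 18)) (.const 1)) (.cell (.const 8)))
    (.seq (.setNat (.add (.const 1) (.cell (.const 18))) (.cell (addr 10 (.cell (.const 18)))))
      (.setNat (.const 18) (.add (.cell (.const 18)) (.const 1))))

theorem copyNatProg_run : ∃ K : ℕ, ∀ (σ : State) (a b : ℕ), σ.nat 18 = a → σ.nat 8 = b →
    32 ≤ a → a ≤ b →
    ∃ t ≤ K * (b + 1), ∃ τ, Runs copyNatProg σ t τ ∧ τ.real = σ.real ∧ τ.nat 6 = σ.nat 6 ∧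
      ∀ q, a ≤ q → q < b → τ.nat (1 + q) = σ.nat (32 * q + 10) := by
  obtain ⟨T, hT⟩ : ∃ T : ℕ, T = 1000 := ⟨_, rfl⟩
  refine ⟨T + 7, fun σ a b ha hb h32 hab => ?_⟩
  have H := counter_loop (c := 18) (d := 8) (a := a) (b := b) (T := T)
    (P := .seq (.setNat (.add (.const 1) (.cell (.const 18))) (.cell (addr 10 (.cell (.const 18)))))
      (.setNat (.const 18) (.add (.cell (.const 18)) (.const 1))))
    (fun k τ => 32 ≤ k ∧ τ.nat 18 = k ∧ τ.nat 6 = σ.nat 6 ∧ τ.nat 8 = b ∧ τ.real = σ.real ∧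
      (∀ q, a ≤ q → q < k → τ.nat (1 + q) = σ.nat (32 * q + 10)) ∧
      ∀ p, 1 + k ≤ p → τ.nat p = σ.nat p) ?_ ?_ hab σ ?_
  · obtain ⟨t, ht, τ, hr, hI⟩ := H
    refine ⟨t, ht.trans ?_, τ, hr, hI.2.2.2.2.1, hI.2.2.1, hI.2.2.2.2.2.1⟩
    rw [mul_comm]
    exact Nat.mul_le_mul_left _ (by omega)
  · rintro k τ ⟨_, i1, _, i2, _⟩
    exact ⟨i1, i2⟩
  · rintro k - hk τ ⟨i0, i1, i2, i3, i4, i5, i6⟩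
    have hr1 := Runs.setNat (.add (.const 1) (.cell (.const 18)))
      (.cell (addr 10 (.cell (.const 18)))) τ
    simp only [NatExpr.eval, addr_eval, i1, i6 (32 * k + 10) (by omega)] at hr1
    have hr2 := Runs.setNat (.const 18) (.add (.cell (.const 18)) (.const 1))
      { τ with nat := Function.update τ.nat (1 + k) (σ.nat (32 * k + 10)) }
    have e18 : Function.update τ.nat (1 + k) (σ.nat (32 * k + 10)) 18 = k := by
      rw [Function.update_of_ne (by omega), i1]
    simp only [NatExpr.eval, e18] at hr2
    refine ⟨_, ?_, _, Runs.seq hr1 hr2, ?_⟩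
    · rw [hT]; decide
    · refine ⟨by omega, by simp, ?_, ?_, i4, ?_, ?_⟩
      · simp only [Function.update_apply]
        rw [if_neg (by omega), if_neg (by omega), i2]
      · simp only [Function.update_apply]
        rw [if_neg (by omega), if_neg (by omega), i3]
      · intro q h1 h2
        simp only [Function.update_apply]
        rw [if_neg (by omega)]
        by_cases hqk : q = k
        · simp [hqk]
        · rw [if_neg (by omega), i5 q h1 (by omega)]
      · intro p hp
        simp only [Function.update_apply]
        rw [if_neg (by omega), if_neg (by omega), i6 p (by omega)]
  · exact ⟨h32, ha, rfl, hb, rfl, fun q h1 h2 => by omega, fun p _ => rfl⟩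

end ArrayProg

/-! ### The complete program -/

namespace ArrayProg

set_option linter.constructorNameAsVariable false
set_option linter.unusedSimpArgs false

open RBMLearn RealRAM

/-- Move the predictor to its final place. -/
def finalProg : Program :=
  .seq (.setNat (.const 8) (.cell (addr 9 (.cell (.const 6)))))
    -- The address computation doubles as multiplication: it yields `32 * n`, the start of the first
    -- row. The end of the last row was read off the table of row starts.
    (.seq copyRealProg (.seq (.setNat (.const 18) (addr 0 (.cell (.const 0))))
      (.seq copyNatProg (.setNat (.const 0) (.cell (.const 6))))))

theorem finalProg_run : ∃ K : ℕ, ∀ (σ : State) (n : ℕ) (L : List (Finset (Fin n))) (c : ℕ → ℝ),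
    1 ≤ n → σ.nat 0 = n → FeatRep L (envOf σ) →
    (∀ j < L.length, (envOf σ).R .acc (32 + j) = c j) →
    ∃ t ≤ K * ((32 + L.length) * n + 1), ∃ τ, Runs finalProg σ t τ ∧
      ∀ x, hypothesis n τ x = ∑ j ∈ Finset.range L.length, c j * monom (L.getD j ∅) x := by
  obtain ⟨K1, h1⟩ := copyRealProg_run
  obtain ⟨K2, h2⟩ := copyNatProg_run
  obtain ⟨T, hT⟩ : ∃ T : ℕ, T = 1000 := ⟨_, rfl⟩
  refine ⟨T + K1 + K2, fun σ n L c hn h0 hF hc => ?_⟩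
  set N := L.length with hN
  have hcnt : σ.nat 6 = 32 + N := hF.cnt
  have hrow : σ.nat (32 * (32 + N) + 9) = (32 + N) * n := hF.row _ le_rfl
  have r1 := Runs.setNat (.const 8) (.cell (addr 9 (.cell (.const 6)))) σ
  simp only [NatExpr.eval, addr_eval, hcnt, hrow] at r1
  set σ1 : State := { σ with nat := Function.update σ.nat 8 ((32 + N) * n) } with hσ1
  obtain ⟨t2, ht2, σ2, r2, n2, q2⟩ := h1 σ1 (32 + N) (by simp [hσ1, hcnt])
  have r3 := Runs.setNat (.const 18) (addr 0 (.cell (.const 0))) σ2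
  have e0 : σ2.nat 0 = n := by rw [n2 _ (by decide)]; simp [hσ1, h0]
  simp only [NatExpr.eval, addr_eval, e0, add_zero] at r3
  set σ3 : State := { σ2 with nat := Function.update σ2.nat 18 (32 * n) } with hσ3
  obtain ⟨t4, ht4, σ4, r4, q4, n4, b4⟩ := h2 σ3 (32 * n) ((32 + N) * n) (by simp [hσ3])
    (by simp only [hσ3]; rw [Function.update_of_ne (by decide), n2 _ (by decide)]; simp [hσ1])
    (by omega) (Nat.mul_le_mul_right _ (by omega))
  have r5 := Runs.setNat (.const 0) (.cell (.const 6)) σ4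
  have e6 : σ4.nat 6 = 32 + N := by
    rw [n4]; simp only [hσ3]
    rw [Function.update_of_ne (by decide), n2 _ (by decide)]; simp [hσ1, hcnt]
  simp only [NatExpr.eval, e6] at r5
  refine ⟨_, ?_, _, Runs.seq r1 (Runs.seq r2 (Runs.seq r3 (Runs.seq r4 r5))), ?_⟩
  · have c1 : (NatExpr.const 8).cost + (NatExpr.cell (addr 9 (.cell (.const 6)))).cost + 1 ≤ 300 := by
      decide
    have c2 : (NatExpr.const 18).cost + (addr 0 (.cell (.const 0))).cost + 1 ≤ 300 := by
      decide
    have c3 : (NatExpr.const 0).cost + (NatExpr.cell (.const 6)).cost + 1 ≤ 300 := by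
      decide
    have hle : 32 + N + 1 ≤ (32 + N) * n + 1 := by
      have := Nat.mul_le_mul_left (32 + N) hn
      omega
    have ht2' : t2 ≤ K1 * ((32 + N) * n + 1) := ht2.trans (Nat.mul_le_mul_left _ hle)
    have : (T + K1 + K2) * ((32 + N) * n + 1) = T * ((32 + N) * n + 1) +
      K1 * ((32 + N) * n + 1) + K2 * ((32 + N) * n + 1) := by ring
    have h3 : T * 1 ≤ T * ((32 + N) * n + 1) := Nat.mul_le_mul_left _ (by omega)
    omega
  · intro x
    simp only [hypothesis, Function.update_self]
    -- The first 32 monomials of the output have coefficient zero, so whatever bits they carry are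
    -- irrelevant.
    rw [Finset.sum_range_add]
    have z1 : ∑ t ∈ Finset.range 32, σ4.real t * ∏ i : Fin n,
        (if Function.update σ4.nat 0 (32 + N) (1 + t * n + i) = 0 then 1 else spin (x i)) = 0 := by
      refine Finset.sum_eq_zero fun t ht => ?_
      rw [Finset.mem_range] at ht
      have : σ4.real t = 0 := by
        rw [q4]; simp only [hσ3]
        rw [q2 t (by omega), if_neg (by omega)]
      rw [this, zero_mul]
    rw [z1, zero_add]
    refine Finset.sum_congr rfl fun j hj => ?_
    rw [Finset.mem_range] at hj
    have hcj : σ4.real (32 + j) = c j := by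
      rw [q4]; simp only [hσ3]
      rw [q2 _ (by omega), if_pos (by omega)]
      exact hc j hj
    rw [hcj, monom]
    congr 1
    have hbit : ∀ i : Fin n, Function.update σ4.nat 0 (32 + N) (1 + (32 + j) * n + i) =
        if i ∈ L.getD j ∅ then 1 else 0 := by
      intro i
      rw [Function.update_of_ne (by omega), add_assoc, b4 _ (by nlinarith)
        (block_lt (by omega) i.2)]
      simp only [hσ3]
      have hbig : 32 * n ≤ (32 + j) * n := Nat.mul_le_mul_right _ (by omega)
      rw [Function.update_of_ne (by omega), n2 _ (by omega)]
      simp only [hσ1]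
      rw [Function.update_of_ne (by omega)]
      exact hF.bits j hj i
    simp only [hbit]
    generalize L.getD j ∅ = A
    have hA : ∀ i, (if (if i ∈ A then 1 else 0) = 0 then 1 else spin (x i)) =
        if i ∈ A then spin (x i) else 1 := by
      intro i; by_cases hi : i ∈ A <;> simp [hi]
    simp only [hA, Finset.prod_ite_mem, Finset.univ_inter]

/-- The learning program. -/
def learnProg : Program :=
  -- For large ε the sample can be smaller than `n`, and steps polynomial in `m` need not even
  -- suffice to write down one monomial. The zero predictor is output in constant time.
  .ite (.realLE (.ofNat (.const 1)) (.cell (.const 4))) (.setNat (.const 0) (.const 0))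
    (.seq initCmd.compile (.seq loadProg (.seq mainCmd.compile finalProg)))

theorem spin_nonneg_iff (u : ℤˣ) : 0 ≤ spin u ↔ u = 1 := by
  rcases Int.units_eq_one_or u with rfl | rfl
  · simp [spin]
  · simp [spin]

theorem input_real_feat {n m : ℕ} (params : Fin 6 → ℝ) (s : Fin m → Example n) {t : ℕ} (ht : t < m)
    (i : Fin n) : (input params s).real (6 + (t * (n + 1) + i)) = spin ((s ⟨t, ht⟩).1 i) := by
  have h1 : (t * (n + 1) + i) / (n + 1) = t := by
    rw [mul_comm, Nat.mul_add_div (by omega), Nat.div_eq_of_lt (by omega), add_zero]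
  have h2 : (t * (n + 1) + i) % (n + 1) = i := by
    rw [mul_comm, Nat.mul_add_mod, Nat.mod_eq_of_lt (by omega)]
  simp only [input]
  rw [dif_neg (by omega)]
  simp only [Nat.add_sub_cancel_left, h1, h2]
  rw [dif_pos ht, dif_pos i.2]

theorem input_real_label {n m : ℕ} (params : Fin 6 → ℝ) (s : Fin m → Example n) {t : ℕ}
    (ht : t < m) : (input params s).real (6 + (t * (n + 1) + n)) = spin (s ⟨t, ht⟩).2 := by
  have h1 : (t * (n + 1) + n) / (n + 1) = t := by
    rw [mul_comm, Nat.mul_add_div (by omega), Nat.div_eq_of_lt (by omega), add_zero]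
  have h2 : (t * (n + 1) + n) % (n + 1) = n := by
    rw [mul_comm, Nat.mul_add_mod, Nat.mod_eq_of_lt (by omega)]
  simp only [input]
  rw [dif_neg (by omega)]
  simp only [Nat.add_sub_cancel_left, h1, h2]
  rw [dif_pos ht, dif_neg (by omega)]

/-- Separates the bookkeeping of the machine from the computation of the main command: whatever list
and coefficients it leaves become the predictor. Allowing length up to `33 * m` admits the single
constant monomial for every `m ≥ 1`. -/
theorem learnProg_run_of : ∃ K k : ℕ, ∀ (n m : ℕ) (params : Fin 6 → ℝ) (s : Fin m → Example n)
    (L : List (Finset (Fin n))) (c : ℕ → ℝ), 1 ≤ n → n ≤ m → params 4 < 1 →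
    32 + L.length ≤ 33 * m →
    (∀ e : Env, Data m (extend s) e → (∀ q, e.N .F q = 0) → e.N .half 0 = m / 2 →
      e.R .lam 0 = params 0 → e.R .al 0 = params 1 → e.R .be 0 = params 2 →
      e.R .eps 0 = params 4 →
      FeatRep L (mainCmd.run e) ∧ ∀ j < L.length, (mainCmd.run e).R .acc (32 + j) = c j) →
    ∃ t ≤ K * m ^ k, ∃ τ, Runs learnProg (input params s) t τ ∧
      ∀ x, hypothesis n τ x = ∑ j ∈ Finset.range L.length, c j * monom (L.getD j ∅) x := by
  obtain ⟨K1, k1, h1⟩ := initCmd.compile_runs (by decide)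
  obtain ⟨K2, h2⟩ := loadProg_run
  obtain ⟨K3, k3, h3⟩ := mainCmd.compile_runs (by decide)
  obtain ⟨K4, h4⟩ := finalProg_run
  refine ⟨10 + K1 + K2 * 3 + K3 + K4 * 34, k1 + k3 + 2, fun n m params s L c hn hnm heps hL H => ?_⟩
  have hm : 1 ≤ m := hn.trans hnm
  set σ := input params s with hσ
  have s0 : σ.nat 0 = n := by simp [hσ, input]
  have s1 : σ.nat 1 = m := by simp [hσ, input]
  have sz : ∀ p, 2 ≤ p → σ.nat p = 0 := by
    intro p hp; simp only [hσ, input]; rw [if_neg (by omega), if_neg (by omega)]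
  obtain ⟨t1, ht1, σ1, r1, e1, q1⟩ := h1 σ m hm (s0 ▸ hnm) s1.le
  -- The examples still occupy real cells that later belong to arrays, so the preparation must not
  -- write reals at all.
  have q1' := q1 (by decide)
  obtain ⟨i1, i2, i3⟩ := initCmd_run (e := envOf σ) s0 s1
  rw [← e1] at i1 i2 i3
  obtain ⟨t2, ht2, σ2, r2, q2, n2, x2⟩ := h2 σ1 (m * (n + 1)) i2
  rw [q1'] at x2 q2
  have nn : ∀ a, a ∉ [NV.X, .t, .half, .s, .M, .rowX] → (envOf σ2).N a = (envOf σ).N a := by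
    intro a ha
    simp at ha
    rw [n2 a ha.1 ha.2.1, e1, Cmd.run_N _ _ _ (by simp [initCmd, Cmd.writesN]; tauto)]
  have t0 : σ2.nat 0 = n := by
    have := congrFun (nn .n (by decide)) 0
    exact this.trans s0
  have t1' : σ2.nat 1 = m := by
    have := congrFun (nn .m (by decide)) 0
    exact this.trans s1
  have hD : Data m (extend s) (envOf σ2) := by
    refine ⟨t0, t1', ?_, ?_, ?_⟩
    · intro t ht; rw [n2 _ (by decide) (by decide), i3 t ht]
    · intro t ht i
      rw [x2 _ (by nlinarith [i.2]), input_real_feat params s ht]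
      simp only [spin_nonneg_iff]
      simp [extend, ht, bit]
    · intro t ht
      rw [x2 _ (by nlinarith), input_real_label params s ht]
      simp only [spin_nonneg_iff]
      simp [extend, ht, bit]
  have hp : ∀ p : Fin 6, σ.real p = params p := by
    intro p; simp [hσ, input]
  obtain ⟨hF, hc⟩ := H (envOf σ2) hD
    (by intro q; rw [nn _ (by decide)]; exact sz (32 * q + 10) (by omega))
    (by rw [n2 _ (by decide) (by decide), i1])
    (by simp only [envOf, q2]; exact hp 0) (by simp only [envOf, q2]; exact hp 1)
    (by simp only [envOf, q2]; exact hp 2) (by simp only [envOf, q2]; exact hp 4)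
  obtain ⟨t3, ht3, σ3, r3, e3, -⟩ := h3 σ2 m hm (t0 ▸ hnm) t1'.le
  rw [← e3] at hF hc
  have u0 : σ3.nat 0 = n := by
    have : (envOf σ3).N .n 0 = (envOf σ2).N .n 0 := by
      rw [e3, Cmd.run_N _ _ _ (by decide)]
    exact this.trans t0
  obtain ⟨t4, ht4, σ4, r4, hh⟩ := h4 σ3 n L c hn u0 hF hc
  refine ⟨_, ?_, σ4, Runs.iteFalse ?_ (Runs.seq r1 (Runs.seq r2 (Runs.seq r3 r4))), hh⟩
  · have c0 : (Test.realLE (.ofNat (.const 1)) (.cell (.const 4))).cost ≤ 10 := by decide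
    have m1 : 1 ≤ m ^ (k1 + k3 + 2) := Nat.one_le_pow _ _ hm
    have m2 := poly_le hm (le_refl K1) (show k1 ≤ k1 + k3 + 2 by omega)
    have m3 := poly_le hm (le_refl K3) (show k3 ≤ k1 + k3 + 2 by omega)
    have m4 := poly_le hm (le_refl (K2 * 3)) (show 2 ≤ k1 + k3 + 2 by omega)
    have m5 := poly_le hm (le_refl (K4 * 34)) (show 2 ≤ k1 + k3 + 2 by omega)
    have m6 : K2 * (m * (n + 1) + 1) ≤ K2 * 3 * m ^ 2 := by
      rw [mul_assoc]; apply Nat.mul_le_mul_left; nlinarith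
    have m7 : K4 * ((32 + L.length) * n + 1) ≤ K4 * 34 * m ^ 2 := by
      rw [mul_assoc]; apply Nat.mul_le_mul_left
      have := Nat.mul_le_mul hL hnm
      nlinarith
    have : (10 + K1 + K2 * 3 + K3 + K4 * 34) * m ^ (k1 + k3 + 2) = 10 * m ^ (k1 + k3 + 2) +
      K1 * m ^ (k1 + k3 + 2) + K2 * 3 * m ^ (k1 + k3 + 2) + K3 * m ^ (k1 + k3 + 2) +
      K4 * 34 * m ^ (k1 + k3 + 2) := by ring
    omega
  · simp only [Test.Holds, RealExpr.eval, NatExpr.eval]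
    have := hp 4
    simp only [Fin.isValue, show ((4 : Fin 6) : ℕ) = 4 from rfl] at this
    rw [this]; push_cast; linarith

/-- The learning program computes what it should. -/
theorem learnProg_run : ∃ K k : ℕ, ∀ (n m : ℕ) (lam al be B eps del : ℝ) (s : Fin m → Example n),
    1 ≤ n → 1 ≤ m →
    (1 ≤ eps → ∃ t ≤ K * m ^ k, ∃ τ, Runs learnProg (input ![lam, al, be, B, eps, del] s) t τ ∧
      ∀ x, hypothesis n τ x = 0) ∧
    (n ≤ m → eps < 1 → lam < al → ∃ t ≤ K * m ^ k, ∃ τ,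
      Runs learnProg (input ![lam, al, be, B, eps, del] s) t τ ∧
      ∀ x, hypothesis n τ x =
        Real.log (freqVal eps (∑ t ∈ Finset.range m, bit (extend s t).2 : ℕ) m /
        (1 - freqVal eps (∑ t ∈ Finset.range m, bit (extend s t).2 : ℕ) m)) / 2) ∧
    (n ≤ m → eps < 1 → al ≤ lam →
      (∀ k, ∀ hk : k < n, ∀ l ≤ n,
        32 + (feats (extend s) (m / 2) (thrVal lam al be * (m / 2 : ℕ)) k ++
        (scan (extend s) (m / 2) (thrVal lam al be * (m / 2 : ℕ)) ⟨k, hk⟩ l).2).length ≤ m) →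
      32 + (learnedFeats (extend s) m lam al be).length ≤ m → ∃ t ≤ K * m ^ k, ∃ τ,
      Runs learnProg (input ![lam, al, be, B, eps, del] s) t τ ∧
      ∀ x, hypothesis n τ x =
        ∑ j ∈ Finset.range (learnedFeats (extend s) m lam al be).length,
          egAcc (learnedFeats (extend s) m lam al be) (m / 2) (radVal n lam al be)
            (etaVal eps (radVal n lam al be)) (extend s) m j / (m - (m / 2 : ℕ)) *
            monom ((learnedFeats (extend s) m lam al be).getD j ∅) x) := by
  obtain ⟨K, k, h⟩ := learnProg_run_of
  refine ⟨K + 100, k, fun n m lam al be B eps del s hn hm => ⟨?_, ?_, ?_⟩⟩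
  · intro heps
    refine ⟨_, ?_, _, Runs.iteTrue ?_ (Runs.setNat _ _ _), ?_⟩
    · have : 1 ≤ m ^ k := Nat.one_le_pow _ _ hm
      have c0 : (Test.realLE (.ofNat (.const 1)) (.cell (.const 4))).cost +
        ((NatExpr.const 0).cost + (NatExpr.const 0).cost + 1) ≤ 100 := by decide
      nlinarith
    · simp [Test.Holds, RealExpr.eval, NatExpr.eval, input]
      exact heps
    · intro x; simp [hypothesis, NatExpr.eval]
  · intro hnm heps hal
    obtain ⟨t, ht, τ, hr, hτ⟩ := h n m ![lam, al, be, B, eps, del] s [∅] (fun _ =>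
      Real.log (freqVal eps (∑ t ∈ Finset.range m, bit (extend s t).2 : ℕ) m /
        (1 - freqVal eps (∑ t ∈ Finset.range m, bit (extend s t).2 : ℕ) m)) / 2) hn hnm heps
        (by simp; omega) (by
        intro e hD hF hM e1 e2 e3 e4
        change _ = lam at e1
        change _ = al at e2
        change _ = eps at e4
        obtain ⟨h1, h2⟩ := mainCmd_run_neg hD hF (by rw [e1, e2]; exact hal)
        refine ⟨h1, fun j hj => ?_⟩
        simp only [List.length_cons, List.length_nil, zero_add, Nat.lt_one_iff] at hj
        subst hj
        rw [e4] at h2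
        exact h2)
    refine ⟨t, ht.trans (Nat.mul_le_mul_right _ (by omega)), τ, hr, fun x => ?_⟩
    rw [hτ]; simp [monom]
  · intro hnm heps hal hle hle'
    obtain ⟨t, ht, τ, hr, hτ⟩ := h n m ![lam, al, be, B, eps, del] s
      (learnedFeats (extend s) m lam al be) _ hn hnm heps (by omega) (by
        intro e hD hF hM e1 e2 e3 e4
        exact mainCmd_run_pos hD hF hM e1 e2 e3 e4 hal hle hle')
    exact ⟨t, ht.trans (Nat.mul_le_mul_right _ (by omega)), τ, hr, hτ⟩

end ArrayProg

namespace RBMLearn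

/-! ### Independent samples -/

section Prob

variable {Z : Type*} [Fintype Z]

/-- The expectation of `F` for `m` independent samples with law `p`. -/
noncomputable def iidExp (p : Z → ℝ) {m : ℕ} (F : (Fin m → Z) → ℝ) : ℝ :=
  ∑ s : Fin m → Z, (∏ t, p (s t)) * F s

/-- The probability of `E` for `m` independent samples with law `p`. -/
noncomputable def iidProb (p : Z → ℝ) {m : ℕ} (E : Set (Fin m → Z)) : ℝ :=
  ∑ s : Fin m → Z, E.indicator (fun s => ∏ t, p (s t)) s

variable {p : Z → ℝ}

theorem iidExp_mono (hp : ∀ z, 0 ≤ p z) {m : ℕ} {F G : (Fin m → Z) → ℝ} (h : ∀ s, F s ≤ G s) :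
    iidExp p F ≤ iidExp p G :=
  Finset.sum_le_sum fun s _ => mul_le_mul_of_nonneg_left (h s)
    (Finset.prod_nonneg fun _ _ => hp _)

/-- Peeling off the first sample replaces conditional expectations in the martingale argument. -/
theorem iidExp_succ {m : ℕ} (F : (Fin (m + 1) → Z) → ℝ) :
    iidExp p F = ∑ z, p z * iidExp p (fun s : Fin m → Z => F (Fin.cons z s)) := by
  simp only [iidExp]
  rw [← (Fin.consEquiv (fun _ => Z)).sum_comp, Fintype.sum_prod_type]
  refine Finset.sum_congr rfl fun z _ => ?_
  rw [Finset.mul_sum]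
  refine Finset.sum_congr rfl fun s _ => ?_
  simp only [Fin.consEquiv_apply, Fin.prod_univ_succ, Fin.cons_zero, Fin.cons_succ]
  rw [mul_assoc]
  rfl

theorem iidExp_const (h1 : ∑ z, p z = 1) (m : ℕ) (c : ℝ) :
    iidExp p (fun _ : Fin m → Z => c) = c := by
  induction m with
  | zero => simp [iidExp]
  | succ m ih => rw [iidExp_succ]; simp only [ih]; rw [← Finset.sum_mul, h1, one_mul]

theorem iidExp_mul_left {m : ℕ} (c : ℝ) (F : (Fin m → Z) → ℝ) :
    iidExp p (fun s => c * F s) = c * iidExp p F := by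
  simp only [iidExp, Finset.mul_sum]
  exact Finset.sum_congr rfl fun s _ => by ring

theorem iidProb_eq {m : ℕ} (E : Set (Fin m → Z)) :
    iidProb p E = iidExp p (E.indicator (fun _ => 1)) := by
  classical
  refine Finset.sum_congr rfl fun s _ => ?_
  by_cases h : s ∈ E <;> simp [h]

theorem iidProb_mono (hp : ∀ z, 0 ≤ p z) {m : ℕ} {E F : Set (Fin m → Z)} (h : E ⊆ F) :
    iidProb p E ≤ iidProb p F := by
  rw [iidProb_eq, iidProb_eq]
  exact iidExp_mono hp fun s => Set.indicator_le_indicator_of_subset h (fun _ => zero_le_one) s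

theorem iidProb_add_compl (h1 : ∑ z, p z = 1) {m : ℕ} (E : Set (Fin m → Z)) :
    iidProb p E + iidProb p Eᶜ = 1 := by
  rw [iidProb, iidProb, ← Finset.sum_add_distrib]
  have := iidExp_const h1 m 1
  simp only [iidExp, mul_one] at this
  rw [← this]
  exact Finset.sum_congr rfl fun s _ => congrFun (Set.indicator_self_add_compl E _) s

theorem iidProb_union_le (hp : ∀ z, 0 ≤ p z) {m : ℕ} (E F : Set (Fin m → Z)) :
    iidProb p (E ∪ F) ≤ iidProb p E + iidProb p F := by
  classical
  rw [iidProb, iidProb, iidProb, ← Finset.sum_add_distrib]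
  refine Finset.sum_le_sum fun s _ => ?_
  have : 0 ≤ ∏ t, p (s t) := Finset.prod_nonneg fun t _ => hp _
  by_cases h : s ∈ E <;> by_cases h' : s ∈ F <;> simp [h, h', this]

theorem iidProb_iUnion_le (hp : ∀ z, 0 ≤ p z) {m : ℕ} {ι : Type*} (I : Finset ι)
    (E : ι → Set (Fin m → Z)) {q : ℝ} (hE : ∀ i ∈ I, iidProb p (E i) ≤ q) :
    iidProb p (⋃ i ∈ I, E i) ≤ I.card * q := by
  classical
  induction I using Finset.induction_on with
  | empty => simp [iidProb]
  | insert a I ha ih =>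
    rw [Finset.set_biUnion_insert, Finset.card_insert_of_notMem ha]
    refine (iidProb_union_le hp _ _).trans ?_
    have h1 := hE a (Finset.mem_insert_self _ _)
    have h2 := ih fun i hi => hE i (Finset.mem_insert_of_mem hi)
    push_cast; linarith

/-- Markov's inequality for the exponential moment, the first half of a Chernoff bound. -/
theorem iidProb_le_exp (hp : ∀ z, 0 ≤ p z) {m : ℕ} (F : (Fin m → Z) → ℝ) {c : ℝ} (hc : 0 ≤ c)
    (a : ℝ) :
    iidProb p {s | a ≤ F s} ≤ Real.exp (-(c * a)) * iidExp p (fun s => Real.exp (c * F s)) := by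
  rw [← iidExp_mul_left, iidProb_eq]
  refine iidExp_mono hp fun s => ?_
  by_cases h : a ≤ F s
  · rw [Set.indicator_of_mem (by exact h), ← Real.exp_add]
    apply Real.one_le_exp
    nlinarith
  · rw [Set.indicator_of_notMem (by exact h)]; positivity

/-- Hoeffding's lemma for a finite law. -/
theorem sum_exp_le (hp : ∀ z, 0 ≤ p z) (h1 : ∑ z, p z = 1) {D : Z → ℝ} {b : ℝ} (hb : 0 < b)
    (h0 : ∑ z, p z * D z = 0) (hD : ∀ z, |D z| ≤ b) (c : ℝ) :
    ∑ z, p z * Real.exp (c * D z) ≤ Real.exp (c ^ 2 * b ^ 2 / 2) := by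
  -- On the interval of possible values the exponential lies below its chord; the linear part of the
  -- chord has mean zero.
  have key : ∀ z, Real.exp (c * D z) ≤ Real.cosh (c * b) + D z / b * Real.sinh (c * b) := by
    intro z
    have hz := abs_le.1 (hD z)
    have hcv := convexOn_exp.2 (Set.mem_univ (c * b)) (Set.mem_univ (-(c * b)))
      (show 0 ≤ (1 + D z / b) / 2 by
        have : -1 ≤ D z / b := by rw [le_div_iff₀ hb]; linarith
        linarith)
      (show 0 ≤ (1 - D z / b) / 2 by
        have : D z / b ≤ 1 := by rw [div_le_iff₀ hb]; linarith
        linarith) (by ring)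
    simp only [smul_eq_mul] at hcv
    have e1 : (1 + D z / b) / 2 * (c * b) + (1 - D z / b) / 2 * -(c * b) = c * D z := by
      field_simp; ring
    rw [e1] at hcv
    rw [Real.cosh_eq, Real.sinh_eq]
    linarith
  calc ∑ z, p z * Real.exp (c * D z)
      ≤ ∑ z, p z * (Real.cosh (c * b) + D z / b * Real.sinh (c * b)) :=
        Finset.sum_le_sum fun z _ => mul_le_mul_of_nonneg_left (key z) (hp z)
    _ = (∑ z, p z) * Real.cosh (c * b) + (∑ z, p z * D z) * (Real.sinh (c * b) / b) := by
        rw [Finset.sum_mul, Finset.sum_mul, ← Finset.sum_add_distrib]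
        exact Finset.sum_congr rfl fun z _ => by ring
    _ = Real.cosh (c * b) := by rw [h1, h0]; ring
    _ ≤ Real.exp (c ^ 2 * b ^ 2 / 2) := by
        refine (Real.cosh_le_exp_half_sq _).trans (le_of_eq ?_)
        congr 1; ring

/-- Here `D l z` is the increment of a martingale at the sample `z` after the history `l`. Once the
first sample is fixed, the increments with shifted histories are again centred, so the exponential
moments multiply. -/
theorem iidExp_exp_le (hp : ∀ z, 0 ≤ p z) (h1 : ∑ z, p z = 1) {b : ℝ} (hb : 0 < b) (c : ℝ)
    (m : ℕ) : ∀ D : List Z → Z → ℝ, (∀ l, ∑ z, p z * D l z = 0) → (∀ l z, |D l z| ≤ b) →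
    iidExp p (fun s : Fin m → Z =>
      Real.exp (c * ∑ t : Fin m, D ((List.ofFn s).take t) (s t))) ≤
      Real.exp (m * (c ^ 2 * b ^ 2 / 2)) := by
  induction m with
  | zero => intro D _ _; simp [iidExp]
  | succ m ih =>
    intro D h0 hD
    rw [iidExp_succ]
    have step : ∀ z, iidExp p (fun s : Fin m → Z => Real.exp (c * ∑ t : Fin (m + 1),
        D ((List.ofFn (Fin.cons z s : Fin (m + 1) → Z)).take t)
          ((Fin.cons z s : Fin (m + 1) → Z) t))) ≤
        Real.exp (c * D [] z) * Real.exp (m * (c ^ 2 * b ^ 2 / 2)) := by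
      intro z
      have := ih (fun l => D (z :: l)) (fun l => h0 _) (fun l => hD _)
      refine le_trans (le_of_eq ?_) (mul_le_mul_of_nonneg_left this (Real.exp_nonneg _))
      rw [← iidExp_mul_left]
      congr 1; funext s
      rw [← Real.exp_add, Fin.sum_univ_succ, mul_add]
      simp [List.ofFn_succ]
    calc _ ≤ ∑ z, p z * (Real.exp (c * D [] z) * Real.exp (m * (c ^ 2 * b ^ 2 / 2))) :=
          Finset.sum_le_sum fun z _ => mul_le_mul_of_nonneg_left (step z) (hp z)
      _ = (∑ z, p z * Real.exp (c * D [] z)) * Real.exp (m * (c ^ 2 * b ^ 2 / 2)) := by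
          rw [Finset.sum_mul]; exact Finset.sum_congr rfl fun z _ => by ring
      _ ≤ Real.exp (c ^ 2 * b ^ 2 / 2) * Real.exp (m * (c ^ 2 * b ^ 2 / 2)) :=
          mul_le_mul_of_nonneg_right (sum_exp_le hp h1 hb (h0 _) (hD _) c) (Real.exp_nonneg _)
      _ = _ := by rw [← Real.exp_add]; push_cast; congr 1; ring

/-- The Azuma–Hoeffding inequality. -/
theorem azuma (hp : ∀ z, 0 ≤ p z) (h1 : ∑ z, p z = 1) {b : ℝ} (hb : 0 < b) {m : ℕ} (hm : 0 < m)
    {D : List Z → Z → ℝ} (h0 : ∀ l, ∑ z, p z * D l z = 0) (hD : ∀ l z, |D l z| ≤ b) {a : ℝ}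
    (ha : 0 ≤ a) :
    iidProb p {s : Fin m → Z | a ≤ ∑ t : Fin m, D ((List.ofFn s).take t) (s t)} ≤
      Real.exp (-(a ^ 2 / (2 * m * b ^ 2))) := by
  have hm' : (0 : ℝ) < m := by exact_mod_cast hm
  -- This value of `c` minimizes `m * c ^ 2 * b ^ 2 / 2 - c * a`.
  have hc : 0 ≤ a / (m * b ^ 2) := by positivity
  refine (iidProb_le_exp hp _ hc a).trans ?_
  refine (mul_le_mul_of_nonneg_left (iidExp_exp_le hp h1 hb _ m D h0 hD)
    (Real.exp_nonneg _)).trans (le_of_eq ?_)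
  rw [← Real.exp_add]
  congr 1
  field_simp
  ring

/-- Hoeffding's inequality for the first `M` of `m` samples. -/
theorem hoeffding (hp : ∀ z, 0 ≤ p z) (h1 : ∑ z, p z = 1) {m M : ℕ} (hm : 0 < m)
    {f : Z → ℝ} (hf : ∀ z, 0 ≤ f z ∧ f z ≤ 1) {a : ℝ} (ha : 0 ≤ a) :
    iidProb p {s : Fin m → Z | a ≤ |∑ t : Fin m, if t.1 < M then f (s t) - ∑ z, p z * f z else 0|} ≤
      2 * Real.exp (-(a ^ 2 / (2 * m))) := by
  set μ := ∑ z, p z * f z with hμ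
  have hμ0 : 0 ≤ μ := Finset.sum_nonneg fun z _ => mul_nonneg (hp z) (hf z).1
  have hμ1 : μ ≤ 1 := by
    rw [← h1]
    exact Finset.sum_le_sum fun z _ => mul_le_of_le_one_right (hp z) (hf z).2
  have mean : ∑ z, p z * (f z - μ) = 0 := by
    simp only [mul_sub, Finset.sum_sub_distrib]
    rw [← Finset.sum_mul, h1, one_mul, hμ, sub_self]
  have bound : ∀ z, |f z - μ| ≤ 1 := fun z => abs_le.2 ⟨by linarith [(hf z).1], by linarith [(hf z).2]⟩
  -- Testing the length of the history switches the increments off after the first `M` samples.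
  have A1 := azuma hp h1 one_pos hm (D := fun l z => if l.length < M then f z - μ else 0)
    (fun l => by split_ifs <;> simp [mean]) (fun l z => by split_ifs <;> simp [bound]) ha
  have A2 := azuma hp h1 one_pos hm (D := fun l z => -(if l.length < M then f z - μ else 0))
    (fun l => by
      simp only [mul_neg, Finset.sum_neg_distrib]
      split_ifs <;> simp [mean]) (fun l z => by rw [abs_neg]; split_ifs <;> simp [bound]) ha
  have len : ∀ (s : Fin m → Z) (t : Fin m), ((List.ofFn s).take t).length = t := by
    intro s t; simp
  simp only [len, Finset.sum_neg_distrib] at A1 A2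
  rw [one_pow, mul_one] at A1 A2
  have sub : {s : Fin m → Z | a ≤ |∑ t : Fin m, if t.1 < M then f (s t) - μ else 0|} ⊆
      {s : Fin m → Z | a ≤ ∑ t : Fin m, if t.1 < M then f (s t) - μ else 0} ∪
        {s : Fin m → Z | a ≤ -∑ t : Fin m, if t.1 < M then f (s t) - μ else 0} :=
    fun s hs => by
      simp only [Set.mem_ofPred_eq, Set.mem_union] at hs ⊢
      exact le_abs.1 hs
  refine (iidProb_mono hp sub).trans ((iidProb_union_le hp _ _).trans ?_)
  linarith

end Prob

end RBMLearn

namespace RBMLearn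

/-! ### The exponentiated gradient algorithm -/

theorem abs_spin (u : ℤˣ) : |spin u| = 1 := by
  rcases Int.units_eq_one_or u with rfl | rfl <;> norm_num [spin]

theorem abs_monom {n : ℕ} (A : Finset (Fin n)) (x : Fin n → ℤˣ) : |monom A x| = 1 := by
  rw [monom, Finset.abs_prod]; exact Finset.prod_eq_one fun i _ => abs_spin _

theorem abs_lossDeriv_le (v : ℝ) (y : ℤˣ) : |lossDeriv v y| ≤ 2 := by
  have h := Real.exp_pos (2 * spin y * v)
  rw [lossDeriv, abs_div, abs_mul, abs_neg, abs_spin, abs_two, abs_of_pos (a := 1 + _) (by linarith),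
    mul_one, div_le_iff₀ (by linarith)]
  linarith

/-- Convexity of the loss, derived without calculus: convexity of the exponential at `0` and `b - a`
with weights `1 - q` and `q` gives exactly the quotient of the arguments of the two logarithms. -/
theorem logisticLoss_sub_le (v u : ℝ) (y : ℤˣ) :
    logisticLoss v y - logisticLoss u y ≤ lossDeriv v y * (v - u) := by
  have key : ∀ a b : ℝ, Real.log (1 + Real.exp (-b)) - Real.log (1 + Real.exp (-a)) ≤
      (1 / (1 + Real.exp b)) * (a - b) := by
    intro a b
    have hb := Real.exp_pos b
    have hnb := Real.exp_pos (-b)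
    have hna := Real.exp_pos (-a)
    set q := 1 / (1 + Real.exp b) with hq
    have hq0 : 0 ≤ q := by positivity
    have hq1 : 0 ≤ 1 - q := by
      rw [hq, sub_nonneg, div_le_one (by linarith)]; linarith
    have hcv := convexOn_exp.2 (Set.mem_univ (0 : ℝ)) (Set.mem_univ (b - a)) hq1 hq0 (by ring)
    simp only [smul_eq_mul, mul_zero, zero_add, Real.exp_zero, mul_one] at hcv
    have e1 : 1 - q + q * Real.exp (b - a) = (1 + Real.exp (-a)) / (1 + Real.exp (-b)) := by
      rw [hq, Real.exp_sub, Real.exp_neg, Real.exp_neg]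
      have := Real.exp_pos a
      field_simp
      ring
    rw [e1] at hcv
    have := Real.log_le_log (Real.exp_pos _) hcv
    rw [Real.log_exp, Real.log_div (by linarith) (by linarith)] at this
    linarith
  have := key (2 * spin y * u) (2 * spin y * v)
  rw [logisticLoss, logisticLoss, lossDeriv]
  rw [show -2 * v * spin y = -(2 * spin y * v) by ring,
    show -2 * u * spin y = -(2 * spin y * u) by ring]
  refine this.trans (le_of_eq ?_)
  ring

theorem abs_logisticLoss_sub_le (v u : ℝ) (y : ℤˣ) :
    |logisticLoss v y - logisticLoss u y| ≤ 2 * |v - u| := by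
  have h : ∀ v u : ℝ, logisticLoss v y - logisticLoss u y ≤ 2 * |v - u| := fun v u =>
    (logisticLoss_sub_le v u y).trans ((le_abs_self _).trans (by
      rw [abs_mul]; exact mul_le_mul_of_nonneg_right (abs_lossDeriv_le v y) (abs_nonneg _)))
  rw [abs_le]
  constructor
  · have := h u v; rw [abs_sub_comm] at this; linarith
  · exact h v u

theorem egNorm_pos {N : ℕ} (hN : 0 < N) (W : ℕ → ℝ) : 0 < egNorm N W :=
  Finset.sum_pos (fun j _ => by positivity) ⟨0, Finset.mem_range.2 hN⟩

variable {n : ℕ} {L : List (Finset (Fin n))} {M : ℕ} {rad eta : ℝ} {z : ℕ → Example n}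

theorem abs_egPred_le (hL : 0 < L.length) (hr : 0 ≤ rad) (W : ℕ → ℝ) (x : Fin n → ℤˣ) :
    |egPred L rad W x| ≤ rad := by
  have hZ := egNorm_pos hL W
  rw [egPred, abs_div, abs_mul, abs_of_pos hZ, abs_of_nonneg hr, div_le_iff₀ hZ]
  refine mul_le_mul_of_nonneg_left ?_ hr
  refine (Finset.abs_sum_le_sum_abs _ _).trans (Finset.sum_le_sum fun j _ => ?_)
  rw [abs_mul, abs_monom, mul_one, abs_le]
  have h1 := Real.exp_pos (W j)
  have h2 := Real.exp_pos (-W j)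
  constructor <;> linarith

/-- Every exponent moves by at most 1, so exp t ≤ 1 + t + t² applies termwise. The linear terms add
up to the normalized prediction, and the squares to `a ^ 2` because monomials are signs. -/
theorem egNorm_step (hL : 0 < L.length) (hr : 0 < rad) (W : ℕ → ℝ) (x : Fin n → ℤˣ) {a : ℝ}
    (ha : |a| ≤ 1) :
    egNorm L.length (fun j => W j - a * monom (L.getD j ∅) x) ≤
      egNorm L.length W * Real.exp (a ^ 2 - a * egPred L rad W x / rad) := by
  have hZ := egNorm_pos hL W
  have hexp : ∀ t : ℝ, |t| ≤ 1 → Real.exp t ≤ 1 + t + t ^ 2 := by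
    intro t ht
    have := (abs_le.1 (Real.abs_exp_sub_one_sub_id_le ht)).2
    linarith
  have e1 : egNorm L.length W * (1 + (a ^ 2 - a * egPred L rad W x / rad)) =
      ∑ j ∈ Finset.range L.length, ((Real.exp (W j) + Real.exp (-W j)) * (1 + a ^ 2) -
        a * ((Real.exp (W j) - Real.exp (-W j)) * monom (L.getD j ∅) x)) := by
    rw [Finset.sum_sub_distrib, ← Finset.sum_mul, ← Finset.mul_sum, egPred]
    change _ = egNorm L.length W * _ - _
    field_simp
    ring
  calc _ ≤ egNorm L.length W * (1 + (a ^ 2 - a * egPred L rad W x / rad)) := by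
        rw [e1]
        refine Finset.sum_le_sum fun j _ => ?_
        have hm := abs_monom (L.getD j ∅) x
        set χ := monom (L.getD j ∅) x
        have hχ : χ ^ 2 = 1 := by rw [← sq_abs, hm, one_pow]
        have b1 := hexp (-(a * χ)) (by rw [abs_neg, abs_mul, hm, mul_one]; exact ha)
        have b2 := hexp (a * χ) (by rw [abs_mul, hm, mul_one]; exact ha)
        have q1 := Real.exp_pos (W j)
        have q2 := Real.exp_pos (-W j)
        have s1 : Real.exp (W j - a * χ) = Real.exp (W j) * Real.exp (-(a * χ)) := by
          rw [← Real.exp_add]; congr 1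
        have s2 : Real.exp (-(W j - a * χ)) = Real.exp (-W j) * Real.exp (a * χ) := by
          rw [← Real.exp_add]; congr 1; ring
        rw [s1, s2]
        have t1 := mul_le_mul_of_nonneg_left b1 q1.le
        have t2 := mul_le_mul_of_nonneg_left b2 q2.le
        have hsq : (a * χ) ^ 2 = a ^ 2 := by rw [mul_pow, hχ, mul_one]
        rw [neg_sq, hsq] at t1
        rw [hsq] at t2
        linarith
    _ ≤ _ := by
        refine mul_le_mul_of_nonneg_left ?_ hZ.le
        linarith [Real.add_one_le_exp (a ^ 2 - a * egPred L rad W x / rad)]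

/-- The prediction before example number `t`. -/
noncomputable abbrev egHyp (L : List (Finset (Fin n))) (M : ℕ) (rad eta : ℝ) (z : ℕ → Example n)
    (t : ℕ) : (Fin n → ℤˣ) → ℝ :=
  egPred L rad (egW L M rad eta z t)

theorem egW_eq_sum (s j : ℕ) : egW L M rad eta z s j =
    -∑ t ∈ Finset.Ico M s, eta * lossDeriv (egHyp L M rad eta z t (z t).1) (z t).2 *
      monom (L.getD j ∅) (z t).1 := by
  induction s with
  | zero => simp [egW]
  | succ s ih =>
    by_cases h : M ≤ s
    · rw [Finset.sum_Ico_succ_top h, egW]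
      simp only [if_pos h]
      rw [ih]; ring
    · rw [egW]
      simp only [if_neg h]
      rw [ih, Finset.Ico_eq_empty_of_le (by omega), Finset.Ico_eq_empty_of_le (by omega)]

/-- The potential starts at `log (2 * L.length)`, all weights being 1, and the quadratic cost of a
step is at most `4 * eta ^ 2` because the derivative of the loss is at most 2. -/
theorem log_egNorm_le (hL : 0 < L.length) (hr : 0 < rad) (he : 0 < eta) (he1 : 2 * eta ≤ 1) (s : ℕ) :
    Real.log (egNorm L.length (egW L M rad eta z s)) ≤ Real.log (2 * L.length) +
      ∑ t ∈ Finset.Ico M s, (4 * eta ^ 2 - eta * lossDeriv (egHyp L M rad eta z t (z t).1) (z t).2 *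
        egHyp L M rad eta z t (z t).1 / rad) := by
  induction s with
  | zero =>
    simp [egW, egNorm]
    apply le_of_eq; congr 1; ring
  | succ s ih =>
    by_cases h : M ≤ s
    · rw [Finset.sum_Ico_succ_top h, egW]
      simp only [if_pos h]
      set g := lossDeriv (egPred L rad (egW L M rad eta z s) (z s).1) (z s).2 with hg
      have hg2 : |g| ≤ 2 := abs_lossDeriv_le _ _
      have ha : |eta * g| ≤ 1 := by
        rw [abs_mul, abs_of_pos he]; nlinarith
      have hstep := egNorm_step hL hr (egW L M rad eta z s) (z s).1 ha
      have := Real.log_le_log (egNorm_pos hL _) hstep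
      rw [Real.log_mul (egNorm_pos hL _).ne' (Real.exp_pos _).ne', Real.log_exp] at this
      have hsq : (eta * g) ^ 2 ≤ 4 * eta ^ 2 := by
        have : g ^ 2 ≤ 2 ^ 2 := by rw [← sq_abs]; gcongr
        rw [mul_pow]; nlinarith [sq_nonneg eta]
      linarith
    · rw [egW]
      simp only [if_neg h]
      refine ih.trans (le_of_eq ?_)
      rw [Finset.Ico_eq_empty_of_le (by omega), Finset.Ico_eq_empty_of_le (by omega)]

/-- The regret bound. -/
theorem eg_regret (hL : 0 < L.length) (hr : 0 < rad) (he : 0 < eta) (he1 : 2 * eta ≤ 1) {m : ℕ}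
    {c : ℕ → ℝ} (hc : ∑ j ∈ Finset.range L.length, |c j| ≤ rad)
    {u : (Fin n → ℤˣ) → ℝ} (hu : ∀ x, u x = ∑ j ∈ Finset.range L.length, c j * monom (L.getD j ∅) x) :
    ∑ t ∈ Finset.Ico M m, (logisticLoss (egHyp L M rad eta z t (z t).1) (z t).2 -
      logisticLoss (u (z t).1) (z t).2) ≤
      rad * Real.log (2 * L.length) / eta + 4 * rad * eta * (m - M : ℕ) := by
  set g : ℕ → ℝ := fun t => lossDeriv (egHyp L M rad eta z t (z t).1) (z t).2 with hg
  set h : ℕ → ℝ := fun t => egHyp L M rad eta z t (z t).1 with hh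
  set W := egW L M rad eta z m with hW
  set lz := Real.log (egNorm L.length W) with hlz
  have hZ := egNorm_pos hL W
  -- Both `W j` and `-W j` occur as exponents in the normalization, so its logarithm dominates the
  -- sup norm of `W`, the dual of the ℓ¹ norm of `c`.
  have hWj : ∀ j ∈ Finset.range L.length, |W j| ≤ lz := by
    intro j hj
    rw [hlz, Real.le_log_iff_exp_le hZ]
    refine le_trans ?_ (Finset.single_le_sum (f := fun j => Real.exp (W j) + Real.exp (-W j))
      (fun j _ => by positivity) hj)
    have q1 := Real.exp_pos (W j)
    have q2 := Real.exp_pos (-W j)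
    rcases abs_cases (W j) with ⟨h1, -⟩ | ⟨h1, -⟩ <;> rw [h1] <;> linarith
  have hlz0 : 0 ≤ lz := (abs_nonneg _).trans (hWj 0 (Finset.mem_range.2 hL))
  have h1 : ∑ j ∈ Finset.range L.length, c j * W j ≤ rad * lz := by
    calc _ ≤ ∑ j ∈ Finset.range L.length, |c j| * lz := by
          refine Finset.sum_le_sum fun j hj => (le_abs_self _).trans ?_
          rw [abs_mul]
          exact mul_le_mul_of_nonneg_left (hWj j hj) (abs_nonneg _)
      _ ≤ _ := by rw [← Finset.sum_mul]; exact mul_le_mul_of_nonneg_right hc hlz0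
  -- The parameters are minus the accumulated gradients, so pairing them with `c` produces the
  -- linearized losses of the comparator.
  have h2 : ∑ j ∈ Finset.range L.length, c j * W j = -(eta * ∑ t ∈ Finset.Ico M m, g t * u (z t).1) := by
    simp only [hW, egW_eq_sum, hu, Finset.mul_sum, mul_neg, Finset.sum_neg_distrib]
    rw [Finset.sum_comm]
    congr 1
    refine Finset.sum_congr rfl fun t _ => Finset.sum_congr rfl fun j _ => ?_
    simp only [hg]; ring
  have h3 := log_egNorm_le (L := L) (M := M) (z := z) hL hr he he1 m
  rw [Finset.sum_sub_distrib, Finset.sum_const, Nat.card_Ico, nsmul_eq_mul] at h3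
  have h4 : ∑ t ∈ Finset.Ico M m, eta * lossDeriv (egHyp L M rad eta z t (z t).1) (z t).2 *
        egHyp L M rad eta z t (z t).1 / rad = eta / rad * ∑ t ∈ Finset.Ico M m, g t * h t := by
    rw [Finset.mul_sum]
    exact Finset.sum_congr rfl fun t _ => by simp only [hg, hh]; ring
  rw [h4] at h3
  have h5 : ∑ t ∈ Finset.Ico M m, (logisticLoss (egHyp L M rad eta z t (z t).1) (z t).2 -
      logisticLoss (u (z t).1) (z t).2) ≤ ∑ t ∈ Finset.Ico M m, g t * h t -
        ∑ t ∈ Finset.Ico M m, g t * u (z t).1 := by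
    rw [← Finset.sum_sub_distrib]
    refine Finset.sum_le_sum fun t _ => (logisticLoss_sub_le _ _ _).trans (le_of_eq ?_)
    simp only [hg, hh]; ring
  refine h5.trans ?_
  rw [h2] at h1
  set G := ∑ t ∈ Finset.Ico M m, g t * h t
  set U := ∑ t ∈ Finset.Ico M m, g t * u (z t).1
  have h6 := mul_le_mul_of_nonneg_left h3 hr.le
  have h7 : rad * (Real.log (2 * L.length) + ((m - M : ℕ) * (4 * eta ^ 2) - eta / rad * G)) =
      rad * Real.log (2 * L.length) + rad * (4 * eta ^ 2) * (m - M : ℕ) - eta * G := by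
    field_simp
    ring
  have h8 : eta * (G - U) ≤ rad * Real.log (2 * L.length) + rad * (4 * eta ^ 2) * (m - M : ℕ) := by
    rw [h7] at h6; linarith
  have h9 : rad * Real.log (2 * L.length) / eta + 4 * rad * eta * (m - M : ℕ) =
      (rad * Real.log (2 * L.length) + rad * (4 * eta ^ 2) * (m - M : ℕ)) / eta := by
    field_simp
  rw [h9, le_div_iff₀ he]
  linarith

theorem egW_congr {z z' : ℕ → Example n} (s : ℕ) (h : ∀ i < s, z i = z' i) :
    egW L M rad eta z s = egW L M rad eta z' s := by
  induction s with
  | zero => rfl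
  | succ s ih =>
    have := ih fun i hi => h i (by omega)
    simp only [egW, this, h s (by omega)]

/-- The risk of a predictor if the examples have law `p`. -/
noncomputable def lawRisk (p : Example n → ℝ) (g : (Fin n → ℤˣ) → ℝ) : ℝ :=
  ∑ e : Example n, p e * logisticLoss (g e.1) e.2

theorem abs_lawRisk_sub_le {p : Example n → ℝ} (hp : ∀ e, 0 ≤ p e) (h1 : ∑ e, p e = 1)
    {g h : (Fin n → ℤˣ) → ℝ} {b : ℝ} (hb : ∀ x, |g x - h x| ≤ b) :
    |lawRisk p g - lawRisk p h| ≤ 2 * b := by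
  rw [lawRisk, lawRisk, ← Finset.sum_sub_distrib]
  refine (Finset.abs_sum_le_sum_abs _ _).trans ?_
  calc _ ≤ ∑ e, p e * (2 * b) := by
        refine Finset.sum_le_sum fun e _ => ?_
        rw [← mul_sub, abs_mul, abs_of_nonneg (hp e)]
        refine mul_le_mul_of_nonneg_left ((abs_logisticLoss_sub_le _ _ _).trans ?_) (hp e)
        linarith [hb e.1]
    _ = 2 * b := by rw [← Finset.sum_mul, h1, one_mul]

theorem lawRisk_sub_le {p : Example n → ℝ} (hp : ∀ e, 0 ≤ p e) (g h : (Fin n → ℤˣ) → ℝ) :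
    lawRisk p g - lawRisk p h ≤ ∑ e, p e * (lossDeriv (g e.1) e.2 * (g e.1 - h e.1)) := by
  rw [lawRisk, lawRisk, ← Finset.sum_sub_distrib]
  refine Finset.sum_le_sum fun e _ => ?_
  rw [← mul_sub]
  exact mul_le_mul_of_nonneg_left (logisticLoss_sub_le _ _ _) (hp e)

/-- Convexity of the risk. -/
theorem lawRisk_average_le {p : Example n → ℝ} (hp : ∀ e, 0 ≤ p e) {I : Finset ℕ} (hI : I.Nonempty)
    (h : ℕ → (Fin n → ℤˣ) → ℝ) :
    I.card * lawRisk p (fun x => (∑ t ∈ I, h t x) / I.card) ≤ ∑ t ∈ I, lawRisk p (h t) := by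
  set avg : (Fin n → ℤˣ) → ℝ := fun x => (∑ t ∈ I, h t x) / I.card with havg
  have hc : (0 : ℝ) < I.card := by exact_mod_cast hI.card_pos
  have : ∑ t ∈ I, (lawRisk p avg - lawRisk p (h t)) ≤ 0 := by
    refine (Finset.sum_le_sum fun t _ => lawRisk_sub_le hp avg (h t)).trans (le_of_eq ?_)
    rw [Finset.sum_comm]
    refine Finset.sum_eq_zero fun e _ => ?_
    rw [← Finset.mul_sum, ← Finset.mul_sum, Finset.sum_sub_distrib, Finset.sum_const, nsmul_eq_mul]
    have : (I.card : ℝ) * avg e.1 = ∑ t ∈ I, h t e.1 := by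
      simp only [havg]; field_simp
    rw [this, sub_self, mul_zero, mul_zero]
  rw [Finset.sum_sub_distrib, Finset.sum_const, nsmul_eq_mul] at this
  linarith

/-- The average of the predictions. -/
theorem egAcc_sum (m : ℕ) (hM : M ≤ m) (x : Fin n → ℤˣ) :
    ∑ j ∈ Finset.range L.length, egAcc L M rad eta z m j / (m - M : ℝ) * monom (L.getD j ∅) x =
      (∑ t ∈ Finset.Ico M m, egHyp L M rad eta z t x) / (Finset.Ico M m).card := by
  rw [Nat.card_Ico, Nat.cast_sub hM, Finset.sum_div]
  simp only [egAcc, egHyp, egPred, Finset.sum_div, Finset.sum_mul, Finset.mul_sum]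
  rw [Finset.sum_comm]
  refine Finset.sum_congr rfl fun t _ => Finset.sum_congr rfl fun j _ => ?_
  ring

theorem getD_take_ofFn {m : ℕ} (s : Fin m → Example n) {t i : ℕ} (hi : i < t) (ht : t ≤ m) :
    ((List.ofFn s).take t).getD i (fun _ => 1, 1) = extend s i := by
  rw [List.getD_eq_getElem _ _ (by simp; omega)]
  simp [extend, show i < m by omega]

/-- The deviation of the empirical from the expected excess risk. -/
theorem eg_deviation {p : Example n → ℝ} (hp : ∀ e, 0 ≤ p e) (h1 : ∑ e, p e = 1) (hr : 0 < rad)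
    {Lf : (ℕ → Example n) → List (Finset (Fin n))} (hLf : ∀ z, 0 < (Lf z).length)
    (hloc : ∀ z z' : ℕ → Example n, (∀ i < M, z i = z' i) → Lf z = Lf z') {m : ℕ} (hm : 0 < m)
    {u : (Fin n → ℤˣ) → ℝ} (hu : ∀ x, |u x| ≤ rad) {a : ℝ} (ha : 0 ≤ a) :
    iidProb p {s : Fin m → Example n | a ≤ ∑ t ∈ Finset.Ico M m,
      (lawRisk p (egHyp (Lf (extend s)) M rad eta (extend s) t) - lawRisk p u -
        (logisticLoss (egHyp (Lf (extend s)) M rad eta (extend s) t (extend s t).1) (extend s t).2 -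
          logisticLoss (u (extend s t).1) (extend s t).2))} ≤
      Real.exp (-(a ^ 2 / (2 * m * (8 * rad) ^ 2))) := by
  set sq : List (Example n) → ℕ → Example n := fun l i => l.getD i (fun _ => 1, 1) with hsq
  -- The predictor as a function of the history alone. Histories are padded by a default example;
  -- this is harmless, as the list depends on the first `M` examples and the parameters only on the
  -- past.
  set hy : List (Example n) → (Fin n → ℤˣ) → ℝ := fun l =>
    egHyp (Lf (sq l)) M rad eta (sq l) l.length with hhy
  have hdiff : ∀ l x, |hy l x - u x| ≤ 2 * rad := by
    intro l x
    have h1 := abs_le.1 (abs_egPred_le (hLf (sq l)) hr.le (egW (Lf (sq l)) M rad eta (sq l) l.length) x)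
    have h2 := abs_le.1 (hu x)
    rw [abs_le]
    constructor
    · have := h1.1; simp only [hhy, egHyp]; linarith [h2.2]
    · have := h1.2; simp only [hhy, egHyp]; linarith [h2.1]
  -- Predictions differ from the comparator by at most `2 * rad`, so the risks and the losses differ
  -- by at most `4 * rad` each.
  have A := azuma hp h1 (b := 8 * rad) (by positivity) hm
    (D := fun l e => if M ≤ l.length then lawRisk p (hy l) - lawRisk p u -
      (logisticLoss (hy l e.1) e.2 - logisticLoss (u e.1) e.2) else 0) ?_ ?_ ha
  · refine le_trans (le_of_eq ?_) A
    congr 1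
    ext s
    simp only [Set.mem_ofPred_eq]
    have : ∀ t : Fin m, ((List.ofFn s).take t).length = t := fun t => by simp
    simp only [this]
    have e1 : ∀ t : Fin m, M ≤ t.1 →
        hy ((List.ofFn s).take t) = egHyp (Lf (extend s)) M rad eta (extend s) t := by
      intro t ht
      have hag : ∀ i < t.1, sq ((List.ofFn s).take t) i = extend s i :=
        fun i hi => getD_take_ofFn s hi t.2.le
      simp only [hhy, egHyp, this]
      rw [hloc _ _ fun i hi => hag i (by omega), egW_congr t.1 hag]
    have e2 : ∀ t : Fin m, s t = extend s t := fun t => by simp [extend]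
    have e3 : ∀ F : ℕ → ℝ, ∑ t ∈ Finset.Ico M m, F t = ∑ t : Fin m, if M ≤ t.1 then F t else 0 := by
      intro F
      rw [Fin.sum_univ_eq_sum_range (fun t => if M ≤ t then F t else 0) m, ← Finset.sum_filter]
      congr 1
      ext t; simp [and_comm]
    rw [e3]
    have e4 : ∀ t : Fin m, (if M ≤ t.1 then
        lawRisk p (egHyp (Lf (extend s)) M rad eta (extend s) t) - lawRisk p u -
        (logisticLoss (egHyp (Lf (extend s)) M rad eta (extend s) t (extend s t).1) (extend s t).2 -
          logisticLoss (u (extend s t).1) (extend s t).2) else 0) =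
        if M ≤ t.1 then lawRisk p (hy ((List.ofFn s).take t)) - lawRisk p u -
      (logisticLoss (hy ((List.ofFn s).take t) (s t).1) (s t).2 -
        logisticLoss (u (s t).1) (s t).2) else 0 := by
      intro t
      split_ifs with ht
      · rw [e1 t ht, e2 t]
      · rfl
    rw [Finset.sum_congr rfl fun t _ => e4 t]
  · intro l
    split_ifs
    · simp only [mul_sub, Finset.sum_sub_distrib, ← Finset.sum_mul, h1, one_mul]
      rw [lawRisk, lawRisk]; ring
    · simp
  · intro l e
    split_ifs
    · have b1 := abs_lawRisk_sub_le hp h1 (hdiff l)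
      have b2 := abs_logisticLoss_sub_le (hy l e.1) (u e.1) e.2
      have b3 := hdiff l e.1
      refine (abs_sub _ _).trans ?_
      linarith
    · simp; positivity

/-- The excess risk of the averaged prediction, off the event of `eg_deviation`. -/
theorem eg_risk_le {p : Example n → ℝ} (hp : ∀ e, 0 ≤ p e) (hL : 0 < L.length) (hr : 0 < rad)
    (he : 0 < eta) (he1 : 2 * eta ≤ 1) {m : ℕ} (hM : M < m) {c : ℕ → ℝ}
    (hc : ∑ j ∈ Finset.range L.length, |c j| ≤ rad) {u : (Fin n → ℤˣ) → ℝ}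
    (hu : ∀ x, u x = ∑ j ∈ Finset.range L.length, c j * monom (L.getD j ∅) x) {a : ℝ}
    (ha : ∑ t ∈ Finset.Ico M m, (lawRisk p (egHyp L M rad eta z t) - lawRisk p u -
      (logisticLoss (egHyp L M rad eta z t (z t).1) (z t).2 - logisticLoss (u (z t).1) (z t).2)) ≤ a) :
    (m - M : ℕ) * (lawRisk p (fun x => ∑ j ∈ Finset.range L.length,
      egAcc L M rad eta z m j / (m - M : ℝ) * monom (L.getD j ∅) x) - lawRisk p u) ≤
      a + (rad * Real.log (2 * L.length) / eta + 4 * rad * eta * (m - M : ℕ)) := by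
  have h1 := eg_regret (M := M) (m := m) (z := z) hL hr he he1 hc hu
  have h2 := lawRisk_average_le hp (I := Finset.Ico M m) (Finset.nonempty_Ico.2 hM)
    (egHyp L M rad eta z)
  have h3 : (fun x => ∑ j ∈ Finset.range L.length,
      egAcc L M rad eta z m j / (m - M : ℝ) * monom (L.getD j ∅) x) =
      fun x => (∑ t ∈ Finset.Ico M m, egHyp L M rad eta z t x) / (Finset.Ico M m).card :=
    funext fun x => egAcc_sum m hM.le x
  rw [h3]
  rw [Finset.sum_sub_distrib, Finset.sum_sub_distrib, Finset.sum_const, nsmul_eq_mul] at ha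
  rw [Nat.card_Ico] at h2 ha ⊢
  linarith

end RBMLearn

namespace RBMLearn

/-! ### Conditional covariances under a law on the examples -/

variable {n : ℕ} {q p : Example n → ℝ} {S : Finset (Fin n)} {u v : Fin n}

/-- The bit number `u` of an example. -/
noncomputable def xb (u : Fin n) (e : Example n) : ℝ := bit (e.1 u)

theorem xb_eq (u : Fin n) (e : Example n) : xb u e = 0 ∨ xb u e = 1 := by
  rw [xb, bit]; split_ifs <;> simp

theorem xb_mul_self (u : Fin n) (e : Example n) : xb u e * xb u e = xb u e := by
  rcases xb_eq u e with h | h <;> rw [h] <;> norm_num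

theorem xb_nonneg (u : Fin n) (e : Example n) : 0 ≤ xb u e := by
  rcases xb_eq u e with h | h <;> rw [h]; norm_num

theorem xb_le_one (u : Fin n) (e : Example n) : xb u e ≤ 1 := by
  rcases xb_eq u e with h | h <;> rw [h]; norm_num

/-- The integral of `f` over the examples with restriction `k`. -/
noncomputable def cell (q : Example n → ℝ) (S : Finset (Fin n)) (k : Example n)
    (f : Example n → ℝ) : ℝ :=
  ∑ e with key S e = k, q e * f e

/-- The conditional covariance of the bits `u` and `v`, times the probability of the condition. -/
noncomputable def cellStat (q : Example n → ℝ) (S : Finset (Fin n)) (u v : Fin n) (k : Example n) :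
    ℝ :=
  cell q S k (fun e => xb u e * xb v e) - cell q S k (xb u) * cell q S k (xb v) /
    cell q S k (fun _ => 1)

/-- The expected conditional covariance of the bits `u` and `v` given the bits in `S` and the
label. -/
noncomputable def lawStat (q : Example n → ℝ) (S : Finset (Fin n)) (u v : Fin n) : ℝ :=
  ∑ k, cellStat q S u v k

theorem sum_cell (q : Example n → ℝ) (S : Finset (Fin n)) (f : Example n → ℝ) :
    ∑ k, cell q S k f = ∑ e, q e * f e :=
  Finset.sum_fiberwise _ _ _

theorem cell_mono (hq : ∀ e, 0 ≤ q e) (k : Example n) {f g : Example n → ℝ} (h : ∀ e, f e ≤ g e) :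
    cell q S k f ≤ cell q S k g :=
  Finset.sum_le_sum fun e _ => mul_le_mul_of_nonneg_left (h e) (hq e)

theorem cell_nonneg (hq : ∀ e, 0 ≤ q e) (k : Example n) {f : Example n → ℝ} (h : ∀ e, 0 ≤ f e) :
    0 ≤ cell q S k f :=
  Finset.sum_nonneg fun e _ => mul_nonneg (hq e) (h e)

theorem cell_eq_ite (q : Example n → ℝ) (S : Finset (Fin n)) (k : Example n) (f : Example n → ℝ) :
    cell q S k f = ∑ e, q e * if key S e = k then f e else 0 := by
  rw [cell, Finset.sum_filter]
  exact Finset.sum_congr rfl fun e _ => by split_ifs <;> simp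

/-- Bits are idempotent, so the square is a combination of 1, the two bits and their product. -/
theorem cell_square (q : Example n → ℝ) (S : Finset (Fin n)) (k : Example n) (u v : Fin n)
    (f c g : ℝ) :
    cell q S k (fun e => (xb u e - f - c * (xb v e - g)) ^ 2) =
      cell q S k (xb u) * (1 - 2 * f + 2 * c * g) +
      c * (-2) * cell q S k (fun e => xb u e * xb v e) +
      cell q S k (xb v) * (c ^ 2 + 2 * c * f - 2 * c ^ 2 * g) +
      cell q S k (fun _ => 1) * (f - c * g) ^ 2 := by
  simp only [cell, Finset.sum_mul, Finset.mul_sum, ← Finset.sum_add_distrib]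
  refine Finset.sum_congr rfl fun e _ => ?_
  have h1 := xb_mul_self u e
  have h2 := xb_mul_self v e
  linear_combination q e * h1 + q e * c ^ 2 * h2

/-- The expected conditional variance of the bit `u`. -/
noncomputable def pot (q : Example n → ℝ) (S : Finset (Fin n)) (u : Fin n) : ℝ :=
  ∑ k, (cell q S k (xb u) - cell q S k (xb u) ^ 2 / cell q S k (fun _ => 1))

theorem cell_xb_le (hq : ∀ e, 0 ≤ q e) (k : Example n) (u : Fin n) :
    0 ≤ cell q S k (xb u) ∧ cell q S k (xb u) ≤ cell q S k (fun _ => 1) :=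
  ⟨cell_nonneg hq k (xb_nonneg u), cell_mono hq k (xb_le_one u)⟩

theorem cell_xb_mul_le (hq : ∀ e, 0 ≤ q e) (k : Example n) (u v : Fin n) :
    0 ≤ cell q S k (fun e => xb u e * xb v e) ∧
      cell q S k (fun e => xb u e * xb v e) ≤ cell q S k (xb u) ∧
      cell q S k (fun e => xb u e * xb v e) ≤ cell q S k (xb v) :=
  ⟨cell_nonneg hq k fun e => mul_nonneg (xb_nonneg u e) (xb_nonneg v e),
    cell_mono hq k fun e => mul_le_of_le_one_right (xb_nonneg u e) (xb_le_one v e),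
    cell_mono hq k fun e => mul_le_of_le_one_left (xb_nonneg v e) (xb_le_one u e)⟩

theorem pot_nonneg (hq : ∀ e, 0 ≤ q e) (S : Finset (Fin n)) (u : Fin n) : 0 ≤ pot q S u := by
  refine Finset.sum_nonneg fun k _ => ?_
  obtain ⟨h0, h1⟩ := cell_xb_le (S := S) hq k u
  rw [sub_nonneg]
  rcases eq_or_lt_of_le (h0.trans h1) with h | h
  · rw [← h, div_zero]; exact h0
  · rw [div_le_iff₀ h, sq]; exact mul_le_mul_of_nonneg_left h1 h0

theorem pot_le_one (hq : ∀ e, 0 ≤ q e) (h1 : ∑ e, q e = 1) (S : Finset (Fin n)) (u : Fin n) :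
    pot q S u ≤ 1 := by
  calc pot q S u ≤ ∑ k, cell q S k (fun _ => 1) := by
        refine Finset.sum_le_sum fun k _ => ?_
        obtain ⟨h0, h1⟩ := cell_xb_le (S := S) hq k u
        have : 0 ≤ cell q S k (xb u) ^ 2 / cell q S k (fun _ => 1) := by
          have := h0.trans h1; positivity
        linarith
    _ = 1 := by rw [sum_cell]; simpa using h1

theorem key_key {S T : Finset (Fin n)} (h : S ⊆ T) (e : Example n) : key S (key T e) = key S e := by
  rw [key_eq_iff]
  exact ⟨rfl, fun i hi => by simp [key, h hi]⟩

/-- The conditional mean is the best predictor in mean square: on a cell of mass `C`, any other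
constant costs `C` times its squared distance from the mean. -/
theorem pot_le_sum (hq : ∀ e, 0 ≤ q e) (S : Finset (Fin n)) (u : Fin n) (φ : Example n → ℝ) :
    pot q S u ≤ ∑ e, q e * (xb u e - φ (key S e)) ^ 2 := by
  rw [← sum_cell q S]
  refine Finset.sum_le_sum fun k _ => ?_
  have e1 : cell q S k (fun e => (xb u e - φ (key S e)) ^ 2) =
      cell q S k (fun e => (xb u e - φ k - 0 * (xb u e - 0)) ^ 2) := by
    refine Finset.sum_congr rfl fun e he => ?_
    simp only [(Finset.mem_filter.1 he).2]; ring
  rw [e1, cell_square]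
  obtain ⟨h0, h1⟩ := cell_xb_le (S := S) hq k u
  set A := cell q S k (xb u)
  set C := cell q S k (fun _ => 1)
  rcases eq_or_lt_of_le (h0.trans h1) with h | h
  · rw [← h] at h1 ⊢
    rw [le_antisymm h1 h0]; simp
  · have : A - A ^ 2 / C + C * (φ k - A / C) ^ 2 = A * (1 - 2 * φ k) + C * φ k ^ 2 := by
      field_simp; ring
    have h2 : 0 ≤ C * (φ k - A / C) ^ 2 := by positivity
    linarith

/-- Knowing `v` allows the affine predictor with slope `c` around the conditional means. With `c`
equal to the expected conditional covariance, this gains `2 * c ^ 2` and costs `c ^ 2` times the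
expected conditional variance of a bit, which is at most 1. -/
theorem pot_insert_le (hq : ∀ e, 0 ≤ q e) (h1 : ∑ e, q e = 1) (S : Finset (Fin n)) (u v : Fin n) :
    pot q (insert v S) u ≤ pot q S u - lawStat q S u v ^ 2 := by
  set c := lawStat q S u v with hc
  set f : Example n → ℝ := fun k => cell q S k (xb u) / cell q S k (fun _ => 1) with hf
  set g : Example n → ℝ := fun k => cell q S k (xb v) / cell q S k (fun _ => 1) with hg
  refine (pot_le_sum hq (insert v S) u
    (fun k => f (key S k) + c * (xb v k - g (key S k)))).trans ?_
  simp only [key_key (Finset.subset_insert v S)]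
  have hv : ∀ e, xb v (key (insert v S) e) = xb v e := fun e => by simp [xb, key]
  simp only [hv]
  rw [← sum_cell q S]
  have key1 : ∀ k, cell q S k (fun e => (xb u e - (f (key S e) + c * (xb v e - g (key S e)))) ^ 2) ≤
      (cell q S k (xb u) - cell q S k (xb u) ^ 2 / cell q S k (fun _ => 1)) -
      2 * c * cellStat q S u v k + c ^ 2 * cell q S k (fun _ => 1) := by
    intro k
    have e1 : cell q S k (fun e => (xb u e - (f (key S e) + c * (xb v e - g (key S e)))) ^ 2) =
        cell q S k (fun e => (xb u e - f k - c * (xb v e - g k)) ^ 2) := by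
      refine Finset.sum_congr rfl fun e he => ?_
      simp only [(Finset.mem_filter.1 he).2]; ring
    rw [e1, cell_square, cellStat, hf, hg]
    simp only
    obtain ⟨a0, a1⟩ := cell_xb_le (S := S) hq k u
    obtain ⟨b0, b1⟩ := cell_xb_le (S := S) hq k v
    obtain ⟨d0, d1, -⟩ := cell_xb_mul_le (S := S) hq k u v
    set A := cell q S k (xb u)
    set B := cell q S k (xb v)
    set D := cell q S k (fun e => xb u e * xb v e)
    set C := cell q S k (fun _ => 1)
    rcases eq_or_lt_of_le (a0.trans a1) with h | h
    · rw [← h] at a1 b1 ⊢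
      have hA := le_antisymm a1 a0
      have hD := le_antisymm (d1.trans a1) d0
      rw [hA, hD, le_antisymm b1 b0]; simp
    · have e2 : A * (1 - 2 * (A / C) + 2 * c * (B / C)) + c * (-2) * D +
          B * (c ^ 2 + 2 * c * (A / C) - 2 * c ^ 2 * (B / C)) + C * (A / C - c * (B / C)) ^ 2 =
          A - A ^ 2 / C - 2 * c * (D - A * B / C) + c ^ 2 * B - c ^ 2 * (B ^ 2 / C) := by
        field_simp; ring
      rw [e2]
      have h2 : 0 ≤ c ^ 2 * (B ^ 2 / C) := by positivity
      have h3 : c ^ 2 * B ≤ c ^ 2 * C := mul_le_mul_of_nonneg_left b1 (sq_nonneg c)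
      linarith
  refine (Finset.sum_le_sum fun k _ => key1 k).trans (le_of_eq ?_)
  rw [Finset.sum_add_distrib, Finset.sum_sub_distrib, ← Finset.mul_sum, ← Finset.mul_sum, sum_cell]
  simp only [mul_one, h1]
  rw [pot]
  change _ - 2 * c * lawStat q S u v + _ = _
  rw [← hc]; ring

/-! ### The empirical law -/

/-- The empirical law of the first `M` examples. -/
noncomputable def empLaw (z : ℕ → Example n) (M : ℕ) (e : Example n) : ℝ :=
  (∑ r ∈ Finset.range M, if z r = e then 1 else 0) / M

theorem empLaw_nonneg (z : ℕ → Example n) (M : ℕ) (e : Example n) : 0 ≤ empLaw z M e :=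
  div_nonneg (Finset.sum_nonneg fun r _ => by split_ifs <;> simp) (Nat.cast_nonneg M)

theorem sum_empLaw_mul (z : ℕ → Example n) (M : ℕ) (f : Example n → ℝ) :
    ∑ e, empLaw z M e * f e = (∑ r ∈ Finset.range M, f (z r)) / M := by
  simp only [empLaw, Finset.sum_div, Finset.sum_mul]
  rw [Finset.sum_comm]
  refine Finset.sum_congr rfl fun r _ => ?_
  rw [Finset.sum_eq_single (z r)]
  · simp; ring
  · intro e _ he; simp [he.symm]
  · simp

theorem sum_empLaw (z : ℕ → Example n) {M : ℕ} (hM : 0 < M) : ∑ e, empLaw z M e = 1 := by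
  have := sum_empLaw_mul z M fun _ => 1
  simp only [mul_one, Finset.sum_const, Finset.card_range, nsmul_eq_mul] at this
  rw [this, div_self (by positivity)]

theorem cell_empLaw (z : ℕ → Example n) (M : ℕ) (S : Finset (Fin n)) (k : Example n)
    (f : Example n → ℝ) :
    cell (empLaw z M) S k f = (∑ r ∈ Finset.range M with key S (z r) = k, f (z r)) / M := by
  rw [cell_eq_ite, sum_empLaw_mul, Finset.sum_filter]

/-- Group the examples by cell: a cell of empirical mass `C` contains `M * C` of them, with equal
contributions. Cells of mass zero contribute nothing on either side, division by zero included. -/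
theorem empStat_eq (z : ℕ → Example n) {M : ℕ} (hM : 0 < M) (S : Finset (Fin n)) (u v : Fin n) :
    empStat z M S u v = M * lawStat (empLaw z M) S u v := by
  have hM' : (M : ℝ) ≠ 0 := by positivity
  set q := empLaw z M with hq
  have hq0 := empLaw_nonneg z M
  set F : Example n → ℝ := fun k => cell q S k (fun e => xb u e * xb v e) / cell q S k (fun _ => 1) -
    cell q S k (xb u) * cell q S k (xb v) / (cell q S k (fun _ => 1) * cell q S k (fun _ => 1)) with hF
  have h1 : empStat z M S u v = ∑ s ∈ Finset.range M, F (key S (z s)) := by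
    refine Finset.sum_congr rfl fun s _ => ?_
    simp only [hF, hq, cell_empLaw, xb]
    push_cast
    simp only [eq_comm (a := key S (z s))]
    field_simp
  have h2 : ∑ s ∈ Finset.range M, F (key S (z s)) = M * ∑ e, q e * F (key S e) := by
    rw [hq, sum_empLaw_mul z M (fun e => F (key S e))]; field_simp
  rw [h1, h2, lawStat, ← sum_cell q S]
  congr 1
  refine Finset.sum_congr rfl fun k _ => ?_
  have e1 : cell q S k (fun e => F (key S e)) = cell q S k (fun _ => 1) * F k := by
    rw [cell, cell, Finset.sum_mul]
    refine Finset.sum_congr rfl fun e he => ?_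
    rw [(Finset.mem_filter.1 he).2]; ring
  rw [e1, hF, cellStat]
  obtain ⟨a0, a1⟩ := cell_xb_le (S := S) hq0 k u
  obtain ⟨d0, d1, -⟩ := cell_xb_mul_le (S := S) hq0 k u v
  rw [← hq] at a0 a1 d0 d1
  by_cases h : cell q S k (fun _ => 1) = 0
  · rw [h] at a1 ⊢
    simp [le_antisymm (d1.trans a1) d0]
  · field_simp

/-! ### The selected features -/

variable {z : ℕ → Example n} {M : ℕ} {th : ℝ}

theorem empStat_congr {z z' : ℕ → Example n} (h : ∀ i < M, z i = z' i) (S : Finset (Fin n))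
    (u v : Fin n) : empStat z M S u v = empStat z' M S u v := by
  have e : ∀ s ∈ Finset.range M, ∀ f : Example n → ℕ,
      ∑ r ∈ Finset.range M with key S (z s) = key S (z r), f (z r) =
      ∑ r ∈ Finset.range M with key S (z' s) = key S (z' r), f (z' r) := by
    intro s hs f
    rw [Finset.sum_filter, Finset.sum_filter]
    refine Finset.sum_congr rfl fun r hr => ?_
    rw [h s (Finset.mem_range.1 hs), h r (Finset.mem_range.1 hr)]
  refine Finset.sum_congr rfl fun s hs => ?_
  rw [e s hs (fun e => bit (e.1 u) * bit (e.1 v)), e s hs (fun e => bit (e.1 u)),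
    e s hs (fun e => bit (e.1 v)), e s hs (fun _ => 1)]

theorem scan_congr {z z' : ℕ → Example n} (h : ∀ i < M, z i = z' i) (u : Fin n) (k : ℕ) :
    scan z M th u k = scan z' M th u k := by
  induction k with
  | zero => rfl
  | succ k ih => simp only [scan, ih, empStat_congr h]

/-- The list is fixed before the online phase starts, which keeps the second half of the sample
fresh. -/
theorem feats_congr {z z' : ℕ → Example n} (h : ∀ i < M, z i = z' i) (k : ℕ) :
    feats z M th k = feats z' M th k := by
  induction k with
  | zero => rfl
  | succ k ih => simp only [feats, ih, scan_congr h]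

theorem lt_of_mem_scan {k : ℕ} {i : Fin n} (h : i ∈ (scan z M th u k).1) : i.1 < k ∧ i ≠ u := by
  induction k with
  | zero => simp [scan] at h
  | succ k ih =>
    rw [scan] at h
    split_ifs at h with h1 h2 h3
    · exact ⟨(ih h).1.trans (Nat.lt_succ_self k), (ih h).2⟩
    · rcases Finset.mem_insert.1 h with rfl | h
      · exact ⟨Nat.lt_succ_self k, h2⟩
      · exact ⟨(ih h).1.trans (Nat.lt_succ_self k), (ih h).2⟩
    · exact ⟨(ih h).1.trans (Nat.lt_succ_self k), (ih h).2⟩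
    · exact ⟨(ih h).1.trans (Nat.lt_succ_self k), (ih h).2⟩

theorem scan_mono {k l : ℕ} (h : k ≤ l) : (scan z M th u k).1 ⊆ (scan z M th u l).1 := by
  induction l, h using Nat.le_induction with
  | base => rfl
  | succ l _ ih =>
    refine ih.trans ?_
    rw [scan]
    split_ifs
    · rfl
    · exact Finset.subset_insert _ _
    · rfl
    · rfl

/-- The list doubles at each selected unit and once more when `u` itself is passed. -/
theorem length_scan (k : ℕ) (hk : k ≤ n) :
    (scan z M th u k).2.length = 2 ^ ((scan z M th u k).1.card + if u.1 < k then 1 else 0) := by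
  induction k with
  | zero => simp [scan]
  | succ k ih =>
    have ih := ih (by omega)
    rw [scan, dif_pos (show k < n by omega)]
    have hn : (⟨k, by omega⟩ : Fin n) ∉ (scan z M th u k).1 := fun h =>
      lt_irrefl _ (lt_of_mem_scan h).1
    by_cases h2 : (⟨k, by omega⟩ : Fin n) = u
    · have h3 : u.1 = k := by rw [← h2]
      rw [if_neg (by omega)] at ih
      rw [if_pos h2, if_pos (by omega)]
      simp only [List.length_append, List.length_map, ih]
      ring
    · have h3 : u.1 < k + 1 ↔ u.1 < k := by
        have : k ≠ u.1 := fun h => h2 (Fin.ext h)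
        omega
      simp only [h3]
      rw [if_neg h2]
      by_cases h4 : th ≤ empStat z M (scan z M th u k).1 u ⟨k, by omega⟩
      · rw [if_pos h4]
        simp only [List.length_append, List.length_map, ih, Finset.card_insert_of_notMem hn]
        ring
      · rw [if_neg h4]; exact ih

theorem subset_insert_cases {α : Type*} [DecidableEq α] {A S : Finset α} {a : α}
    (h : A ⊆ insert a S) : A ⊆ S ∨ ∃ B ⊆ S, A = insert a B := by
  by_cases ha : a ∈ A
  · exact Or.inr ⟨A.erase a, Finset.subset_insert_iff.1 h, (Finset.insert_erase ha).symm⟩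
  · exact Or.inl ((Finset.subset_insert_iff_of_notMem ha).1 h)

theorem mem_scan_of_subset (k : ℕ) (hk : k ≤ n) {A : Finset (Fin n)}
    (hA : A ⊆ if u.1 < k then insert u (scan z M th u k).1 else (scan z M th u k).1) :
    A ∈ (scan z M th u k).2 := by
  induction k generalizing A with
  | zero => simpa [scan] using hA
  | succ k ih =>
    have ih := fun A => ih (A := A) (by omega)
    have dbl : ∀ (L : List (Finset (Fin n))) (T : Finset (Fin n)) (a : Fin n),
        (∀ A ⊆ T, A ∈ L) → ∀ A ⊆ insert a T, A ∈ L ++ L.map (insert a) := by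
      intro L T a hL A hA
      rw [List.mem_append, List.mem_map]
      rcases subset_insert_cases hA with h | ⟨B, hB, rfl⟩
      · exact Or.inl (hL A h)
      · exact Or.inr ⟨B, hL B hB, rfl⟩
    rw [scan, dif_pos (show k < n by omega)] at hA ⊢
    by_cases h2 : (⟨k, by omega⟩ : Fin n) = u
    · have h3 : ¬ u.1 < k := by rw [← h2]; simp
      have h4 : u.1 < k + 1 := by rw [← h2]; simp
      rw [if_pos h2, if_pos h4] at hA
      rw [if_pos h2]
      simp only [if_neg h3] at ih
      rw [h2]
      exact dbl _ _ _ ih A hA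
    · have h3 : u.1 < k + 1 ↔ u.1 < k := by
        have : k ≠ u.1 := fun h => h2 (Fin.ext h)
        omega
      simp only [h3] at hA
      rw [if_neg h2] at hA ⊢
      by_cases h4 : th ≤ empStat z M (scan z M th u k).1 u ⟨k, by omega⟩
      · rw [if_pos h4] at hA ⊢
        by_cases h5 : u.1 < k
        · simp only [if_pos h5] at ih
          rw [if_pos h5, Finset.insert_comm] at hA
          exact dbl _ _ _ ih A hA
        · simp only [if_neg h5] at ih
          rw [if_neg h5] at hA
          exact dbl _ _ _ ih A hA
      · rw [if_neg h4] at hA ⊢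
        exact ih A hA

theorem mem_feats {k : ℕ} {u : Fin n} (hu : u.1 < k) {A : Finset (Fin n)}
    (hA : A ∈ (scan z M th u n).2) : A ∈ feats z M th k := by
  induction k with
  | zero => omega
  | succ k ih =>
    rw [feats]
    split_ifs with h
    · rw [List.mem_append]
      rcases (Nat.lt_succ_iff.1 hu).lt_or_eq with h1 | h1
      · exact Or.inl (ih h1)
      · right
        have : (⟨k, h⟩ : Fin n) = u := Fin.ext h1.symm
        rwa [this]
    · exact ih (by omega)

theorem empty_mem_feats (k : ℕ) : (∅ : Finset (Fin n)) ∈ feats z M th k := by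
  induction k with
  | zero => simp [feats]
  | succ k ih => rw [feats]; split_ifs <;> simp [ih]

theorem length_feats_le {t : ℕ} (h : ∀ u : Fin n, (scan z M th u n).2.length ≤ t) (k : ℕ) :
    (feats z M th k).length ≤ 1 + k * t := by
  induction k with
  | zero => simp [feats]
  | succ k ih =>
    rw [feats]
    split_ifs with h1
    · rw [List.length_append]
      have := h ⟨k, h1⟩
      linarith
    · linarith

/-- The variance potential starts at most at 1, and each selection lowers it by at least `th ^ 2`.
As it stays nonnegative, this bounds the number of selections for every sample, not only for typical
ones. -/
theorem pot_scan_le (hM : 0 < M) {th : ℝ} (hth : 0 ≤ th) (k : ℕ) :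
    pot (empLaw z M) (scan z M (th * M) u k).1 u ≤
      1 - th ^ 2 * (scan z M (th * M) u k).1.card := by
  have hM' : (0 : ℝ) < M := by exact_mod_cast hM
  have hq := empLaw_nonneg z M
  have h1 := sum_empLaw z hM
  induction k with
  | zero => simpa [scan] using pot_le_one hq h1 ∅ u
  | succ k ih =>
    rw [scan]
    split_ifs with h2 h3 h4
    · exact ih
    · refine (pot_insert_le hq h1 _ u _).trans ?_
      rw [empStat_eq z hM, mul_comm (M : ℝ), mul_le_mul_iff_left₀ hM'] at h4
      have h5 : ((insert (⟨k, h2⟩ : Fin n) (scan z M (th * M) u k).1).card : ℝ) ≤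
          (scan z M (th * M) u k).1.card + 1 := by exact_mod_cast Finset.card_insert_le _ _
      have h6 := pow_le_pow_left₀ hth h4 2
      have h7 := mul_le_mul_of_nonneg_left h5 (sq_nonneg th)
      simp only
      linarith
    · exact ih
    · exact ih

theorem card_scan_le (hM : 0 < M) {th : ℝ} (hth : 0 < th) (k : ℕ) :
    (scan z M (th * M) u k).1.card ≤ ⌊1 / th ^ 2⌋₊ := by
  have h := (pot_nonneg (empLaw_nonneg z M) _ u).trans (pot_scan_le (z := z) (u := u) hM hth.le k)
  refine Nat.le_floor ?_
  rw [le_div_iff₀ (by positivity)]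
  linarith

theorem mem_scan_of_le {v : Fin n} (hv : v ≠ u)
    (h : th ≤ empStat z M (scan z M th u v.1).1 u v) : v ∈ (scan z M th u n).1 := by
  refine scan_mono (Nat.succ_le_of_lt v.2) ?_
  rw [scan, dif_pos v.2, if_neg hv, if_pos h]
  exact Finset.mem_insert_self _ _

end RBMLearn

namespace RBMLearn

/-! ### Concentration of the conditional covariances -/

variable {n : ℕ} {q p : Example n → ℝ} {S : Finset (Fin n)} {u v : Fin n}

/-- On the range 0 ≤ a, b ≤ c the quotient is 1-Lipschitz in each variable, the relevant slopes
being products of ratios at most 1. A vanishing denominator forces vanishing numerators and is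
treated apart. -/
theorem abs_mul_div_sub_le {a b c a' b' c' : ℝ} (ha : 0 ≤ a) (hac : a ≤ c) (hb : 0 ≤ b)
    (hbc : b ≤ c) (ha' : 0 ≤ a') (hac' : a' ≤ c') (hb' : 0 ≤ b') (hbc' : b' ≤ c') :
    |a * b / c - a' * b' / c'| ≤ |a - a'| + |b - b'| + |c - c'| := by
  rcases eq_or_lt_of_le (ha.trans hac) with h | h
  · rw [← h] at hac
    have : a = 0 := le_antisymm hac ha
    have h2 : a' * b' / c' ≤ a' := by
      rw [mul_div_assoc]
      exact mul_le_of_le_one_right ha' (div_le_one_of_le₀ hbc' (ha'.trans hac'))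
    have h3 : 0 ≤ a' * b' / c' := div_nonneg (mul_nonneg ha' hb') (ha'.trans hac')
    rw [this, ← h]
    simp only [zero_mul, zero_div, zero_sub, abs_neg, abs_of_nonneg h3, abs_of_nonneg ha']
    linarith [abs_nonneg (b - b'), abs_nonneg c']
  rcases eq_or_lt_of_le (ha'.trans hac') with h' | h'
  · rw [← h'] at hac'
    have : a' = 0 := le_antisymm hac' ha'
    have h2 : a * b / c ≤ a := by
      rw [mul_div_assoc]
      exact mul_le_of_le_one_right ha (div_le_one_of_le₀ hbc (ha.trans hac))
    have h3 : 0 ≤ a * b / c := div_nonneg (mul_nonneg ha hb) (ha.trans hac)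
    rw [this, ← h']
    simp only [zero_mul, zero_div, sub_zero, abs_of_nonneg h3, abs_of_nonneg ha]
    linarith [abs_nonneg (b - b'), abs_nonneg c]
  have e : a * b / c - a' * b' / c' = (a - a') * (b / c) + (b - b') * (a' / c') -
      (c - c') * (a' / c' * (b / c)) := by
    field_simp; ring
  have r1 : 0 ≤ b / c := by positivity
  have r2 : b / c ≤ 1 := (div_le_one h).2 hbc
  have r3 : 0 ≤ a' / c' := by positivity
  have r4 : a' / c' ≤ 1 := (div_le_one h').2 hac'
  have r5 : a' / c' * (b / c) ≤ 1 := mul_le_one₀ r4 r1 r2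
  rw [e]
  refine (abs_sub _ _).trans (add_le_add ((abs_add_le _ _).trans (add_le_add ?_ ?_)) ?_) <;>
    rw [abs_mul]
  · rw [abs_of_nonneg r1]; exact mul_le_of_le_one_right (abs_nonneg _) r2
  · rw [abs_of_nonneg r3]; exact mul_le_of_le_one_right (abs_nonneg _) r4
  · rw [abs_of_nonneg (mul_nonneg r3 r1)]; exact mul_le_of_le_one_right (abs_nonneg _) r5

theorem card_image_key_le (S : Finset (Fin n)) :
    (Finset.univ.image (key S)).card ≤ 2 ^ (S.card + 1) := by
  classical
  set G : (S → ℤˣ) × ℤˣ → Example n := fun r =>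
    (fun i => if h : i ∈ S then r.1 ⟨i, h⟩ else 1, r.2) with hG
  have h1 : Finset.univ.image (key S) ⊆ Finset.univ.image G := by
    intro k hk
    obtain ⟨e, -, rfl⟩ := Finset.mem_image.1 hk
    refine Finset.mem_image.2 ⟨(fun i => e.1 i, e.2), Finset.mem_univ _, ?_⟩
    simp [hG, key]
  refine (Finset.card_le_card h1).trans (Finset.card_image_le.trans ?_)
  rw [Finset.card_univ, Fintype.card_prod, Fintype.card_fun, Fintype.card_coe,
    Fintype.card_units_int, pow_succ]

/-- The indicator of the examples with label `y` that agree with the list `f` of values of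
features. -/
noncomputable def cyl {T : ℕ} (f : Fin T → Option (Fin n × ℤˣ)) (y : ℤˣ) (e : Example n) : ℝ :=
  open Classical in if e.2 = y ∧ ∀ t, ∀ r ∈ f t, e.1 r.1 = r.2 then 1 else 0

/-- The conditions are the values on `S` followed by the value 1 for each bit in the product; slots
beyond them are `none`, so fewer than `T` conditions are allowed. -/
theorem exists_cyl {T : ℕ} (S : Finset (Fin n)) (e₀ : Example n) (l : List (Fin n))
    (hT : S.card + l.length ≤ T) : ∃ (f : Fin T → Option (Fin n × ℤˣ)) (y : ℤˣ),
      ∀ q : Example n → ℝ, cell q S (key S e₀) (fun e => (l.map fun i => xb i e).prod) =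
        ∑ e, q e * cyl f y e := by
  classical
  set L : List (Fin n × ℤˣ) := S.toList.map (fun i => (i, e₀.1 i)) ++ l.map (fun i => (i, 1)) with hL
  have hlen : L.length ≤ T := by simpa [hL] using hT
  refine ⟨fun t => L[t.1]?, e₀.2, fun q => ?_⟩
  rw [cell_eq_ite]
  refine Finset.sum_congr rfl fun e _ => ?_
  congr 1
  have h1 : (∀ t : Fin T, ∀ r ∈ L[t.1]?, e.1 r.1 = r.2) ↔ ∀ r ∈ L, e.1 r.1 = r.2 := by
    constructor
    · intro h r hr
      obtain ⟨i, hi, rfl⟩ := List.mem_iff_getElem.1 hr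
      exact h ⟨i, by omega⟩ _ (by simp [hi])
    · intro h t r hr
      exact h r (List.mem_of_getElem? hr)
  have h2 : (l.map fun i => xb i e).prod = if ∀ i ∈ l, e.1 i = 1 then 1 else 0 := by
    clear hT hL hlen h1
    induction l with
    | nil => simp
    | cons a l ih =>
      rw [List.map_cons, List.prod_cons, ih, xb, bit]
      by_cases h : e.1 a = 1 <;> simp [h]
  have h3 : (∀ r ∈ L, e.1 r.1 = r.2) ↔ (∀ i ∈ S, e.1 i = e₀.1 i) ∧ ∀ i ∈ l, e.1 i = 1 := by
    simp only [hL, List.mem_append, List.mem_map, Finset.mem_toList]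
    constructor
    · intro h
      exact ⟨fun i hi => h (i, e₀.1 i) (Or.inl ⟨i, hi, rfl⟩), fun i hi => h (i, 1) (Or.inr ⟨i, hi, rfl⟩)⟩
    · rintro ⟨h, h'⟩ r (⟨i, hi, rfl⟩ | ⟨i, hi, rfl⟩)
      exacts [h i hi, h' i hi]
  simp only [cyl, h1, h3, h2, key_eq_iff]
  rw [← ite_and]
  simp only [and_assoc]

/-- The laws `q` and `p` differ by at most `η` on all conditions on `T` features and the label. -/
def Near (q p : Example n → ℝ) (T : ℕ) (η : ℝ) : Prop :=
  ∀ (f : Fin T → Option (Fin n × ℤˣ)) (y : ℤˣ), |∑ e, q e * cyl f y e - ∑ e, p e * cyl f y e| ≤ η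

theorem Near.abs_cell_sub_le {T : ℕ} {η : ℝ} (h : Near q p T η) (S : Finset (Fin n)) (e₀ : Example n)
    (l : List (Fin n)) (hT : S.card + l.length ≤ T) :
    |cell q S (key S e₀) (fun e => (l.map fun i => xb i e).prod) -
      cell p S (key S e₀) (fun e => (l.map fun i => xb i e).prod)| ≤ η := by
  obtain ⟨f, y, hf⟩ := exists_cyl S e₀ l hT
  rw [hf, hf]
  exact h f y

/-- At most `2 ^ (S.card + 1)` keys occur. On each, the mass of the product moves by η and the
quotient term by three times η, while `S`, `u` and `v` use at most `T` features. -/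
theorem Near.abs_lawStat_sub_le {T : ℕ} {η : ℝ} (hq : ∀ e, 0 ≤ q e) (hp : ∀ e, 0 ≤ p e)
    (h : Near q p T η) (hη : 0 ≤ η) (S : Finset (Fin n)) (u v : Fin n) (hT : S.card + 2 ≤ T) :
    |lawStat q S u v - lawStat p S u v| ≤ 2 ^ (S.card + 1) * (4 * η) := by
  have e1 : ∀ q : Example n → ℝ, lawStat q S u v =
      ∑ k ∈ Finset.univ.image (key S), cellStat q S u v k := by
    intro q
    refine (Finset.sum_subset (Finset.subset_univ _) fun k _ hk => ?_).symm
    have : ∀ f, cell q S k f = 0 := fun f => by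
      rw [cell]
      refine Finset.sum_eq_zero fun e he => absurd ?_ hk
      exact Finset.mem_image.2 ⟨e, Finset.mem_univ _, (Finset.mem_filter.1 he).2⟩
    simp [cellStat, this]
  rw [e1, e1, ← Finset.sum_sub_distrib]
  refine (Finset.abs_sum_le_sum_abs _ _).trans ?_
  refine (Finset.sum_le_card_nsmul _ _ (4 * η) fun k hk => ?_).trans ?_
  · obtain ⟨e₀, -, rfl⟩ := Finset.mem_image.1 hk
    have c0 := h.abs_cell_sub_le S e₀ [] (by simp; omega)
    have c1 := h.abs_cell_sub_le S e₀ [u] (by simp; omega)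
    have c2 := h.abs_cell_sub_le S e₀ [v] (by simp; omega)
    have c3 := h.abs_cell_sub_le S e₀ [u, v] (by simpa using hT)
    simp only [List.map_nil, List.map_cons, List.prod_nil, List.prod_cons, mul_one] at c0 c1 c2 c3
    obtain ⟨a0, a1⟩ := cell_xb_le (S := S) hq (key S e₀) u
    obtain ⟨b0, b1⟩ := cell_xb_le (S := S) hq (key S e₀) v
    obtain ⟨a0', a1'⟩ := cell_xb_le (S := S) hp (key S e₀) u
    obtain ⟨b0', b1'⟩ := cell_xb_le (S := S) hp (key S e₀) v
    have := abs_mul_div_sub_le a0 a1 b0 b1 a0' a1' b0' b1'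
    rw [cellStat, cellStat, sub_sub_sub_comm]
    refine (abs_sub _ _).trans ?_
    have h1 : ∀ q : Example n → ℝ, cell q S (key S e₀) (xb u) =
      cell q S (key S e₀) (fun e => xb u e) := fun q => rfl
    have h2 : ∀ q : Example n → ℝ, cell q S (key S e₀) (xb v) =
      cell q S (key S e₀) (fun e => xb v e) := fun q => rfl
    simp only [h1, h2] at this ⊢
    linarith
  · rw [nsmul_eq_mul]
    refine mul_le_mul_of_nonneg_right ?_ (by linarith)
    exact_mod_cast card_image_key_le S

/-- Hoeffding's inequality and a union bound over all conditions: each of the `T` slots is empty or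
one of `2 * n` literals, and the label has two values. -/
theorem iidProb_not_near_le (hp : ∀ e, 0 ≤ p e) (h1 : ∑ e, p e = 1) {m M : ℕ} (hM : 0 < M)
    (hMm : M ≤ m) (T : ℕ) {η : ℝ} (hη : 0 ≤ η) :
    iidProb p {s : Fin m → Example n | ¬ Near (empLaw (extend s) M) p T η} ≤
      ((2 * n + 1) ^ T * 2 : ℕ) * (2 * Real.exp (-((η * M) ^ 2 / (2 * m)))) := by
  classical
  have hm : 0 < m := by omega
  have hM' : (0 : ℝ) < M := by exact_mod_cast hM
  have hcyl : ∀ (f : Fin T → Option (Fin n × ℤˣ)) (y : ℤˣ) (e : Example n),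
      0 ≤ cyl f y e ∧ cyl f y e ≤ 1 := by
    intro f y e; rw [cyl]; split_ifs <;> norm_num
  have hcard : (Finset.univ : Finset ((Fin T → Option (Fin n × ℤˣ)) × ℤˣ)).card =
      (2 * n + 1) ^ T * 2 := by
    simp [Fintype.card_prod, Fintype.card_units_int, mul_comm]
  set E : (Fin T → Option (Fin n × ℤˣ)) × ℤˣ → Set (Fin m → Example n) := fun r =>
    {s | η * M ≤ |∑ t : Fin m, if t.1 < M then cyl r.1 r.2 (s t) - ∑ e, p e * cyl r.1 r.2 e else 0|}
    with hE
  have hEq : ∀ r ∈ Finset.univ, iidProb p (E r) ≤ 2 * Real.exp (-((η * M) ^ 2 / (2 * m))) :=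
    fun r _ => hoeffding hp h1 hm (hcyl r.1 r.2) (by positivity)
  have hU := iidProb_iUnion_le hp Finset.univ E hEq
  rw [hcard] at hU
  refine le_trans (iidProb_mono hp ?_) hU
  intro s hs
  simp only [Near, Set.mem_ofPred_eq, not_forall, not_le] at hs
  obtain ⟨f, y, hs⟩ := hs
  simp only [Set.mem_iUnion]
  refine ⟨(f, y), Finset.mem_univ _, ?_⟩
  have e1 : (∑ t : Fin m, if t.1 < M then cyl f y (s t) - ∑ e, p e * cyl f y e else 0) =
      (∑ e, empLaw (extend s) M e * cyl f y e - ∑ e, p e * cyl f y e) * M := by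
    rw [sum_empLaw_mul, sub_mul, div_mul_cancel₀ _ hM'.ne']
    have e2 : ∀ t : Fin m, s t = extend s t := fun t => by simp [extend]
    simp only [e2]
    rw [Fin.sum_univ_eq_sum_range (fun t => if t < M then cyl f y (extend s t) -
      ∑ e, p e * cyl f y e else 0) m, ← Finset.sum_filter]
    have e3 : (Finset.range m).filter (fun t => t < M) = Finset.range M := by
      ext t; simp; omega
    rw [e3, Finset.sum_sub_distrib, Finset.sum_const, Finset.card_range, nsmul_eq_mul]
    ring
  simp only [hE, Set.mem_ofPred_eq]
  rw [e1, abs_mul, abs_of_pos hM']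
  exact mul_le_mul_of_nonneg_right hs.le hM'.le

/-- Off the exceptional event, all features with large conditional covariances are selected. -/
theorem mem_scan_of_near {z : ℕ → Example n} {M : ℕ} (hM : 0 < M) (hp : ∀ e, 0 ≤ p e)
    {th η : ℝ} (hth : 0 < th) (hη : 0 ≤ η) (hη' : 2 ^ (⌊1 / th ^ 2⌋₊ + 1) * (4 * η) ≤ th)
    (h : Near (empLaw z M) p (⌊1 / th ^ 2⌋₊ + 2) η) (huv : v ≠ u)
    (hstat : ∀ S : Finset (Fin n), u ∉ S → v ∉ S → 2 * th ≤ lawStat p S u v) :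
    v ∈ (scan z M (th * M) u n).1 := by
  refine mem_scan_of_le huv ?_
  have hM' : (0 : ℝ) < M := by exact_mod_cast hM
  have hc := card_scan_le (z := z) (u := u) hM hth v.1
  set S := (scan z M (th * M) u v.1).1 with hS
  -- When `v` is examined, the selected set contains only earlier units other than `u`. It depends
  -- on the data, but the lower bound holds for all sets.
  have h1 := hstat S (fun h => (lt_of_mem_scan h).2 rfl) (fun h => lt_irrefl _ (lt_of_mem_scan h).1)
  have h2 := Near.abs_lawStat_sub_le (empLaw_nonneg z M) hp h hη S u v (by omega)
  have h3 : (2 : ℝ) ^ (S.card + 1) * (4 * η) ≤ th := by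
    refine le_trans ?_ hη'
    refine mul_le_mul_of_nonneg_right (pow_le_pow_right₀ (by norm_num) (by omega)) (by linarith)
  have h4 := (abs_le.1 h2).1
  rw [empStat_eq z hM, mul_comm]
  refine mul_le_mul_of_nonneg_left ?_ hM'.le
  linarith

end RBMLearn

namespace RBMLearn

/-! ### The law of the observed units -/

theorem sum_units (f : ℤˣ → ℝ) : ∑ y, f y = f 1 + f (-1) := by
  have : (Finset.univ : Finset ℤˣ) = {1, -1} := by decide
  rw [this, Finset.sum_pair (by decide)]

theorem spin_one : spin 1 = 1 := by simp [spin]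

theorem spin_neg (u : ℤˣ) : spin (-u) = -spin u := by simp [spin]

variable {n n₂ : ℕ} (R : SupervisedRBM n n₂)

/-- The field of the visible units at the hidden unit `j`. -/
noncomputable def field (x : Fin n → ℤˣ) (j : Fin n₂) : ℝ := ∑ i, R.W i j * spin (x i)

/-- The sum of the weights over the states of the hidden units. -/
noncomputable def obsWeight (x : Fin n → ℤˣ) (y : ℤˣ) : ℝ :=
  Real.exp (∑ i, R.b₁ i * spin (x i) + R.b₃ * spin y) *
    ∏ j, (2 * Real.cosh (field R x j + (R.b₂ j + spin y * R.w j)))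

/-- No two hidden units interact, so the sum over their states is a product of one-spin sums. -/
theorem sum_weight (x : Fin n → ℤˣ) (y : ℤˣ) : ∑ h, R.weight x h y = obsWeight R x y := by
  have h1 : ∀ j, 2 * Real.cosh (field R x j + (R.b₂ j + spin y * R.w j)) =
      ∑ s : ℤˣ, Real.exp (spin s * (field R x j + (R.b₂ j + spin y * R.w j))) := by
    intro j
    rw [sum_units, spin_neg, spin_one, Real.cosh_eq]; ring_nf
  rw [obsWeight]
  simp only [h1]
  rw [Finset.prod_univ_sum, Fintype.piFinset_univ, Finset.mul_sum]
  refine Finset.sum_congr rfl fun h _ => ?_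
  rw [← Real.exp_sum, ← Real.exp_add, SupervisedRBM.weight]
  congr 1
  have h2 : spins x ⬝ᵥ (R.W *ᵥ spins h) = ∑ j, spin (h j) * field R x j := by
    simp only [dotProduct, Matrix.mulVec, field, Finset.mul_sum, spins]
    rw [Finset.sum_comm]
    exact Finset.sum_congr rfl fun j _ => Finset.sum_congr rfl fun i _ => by ring
  rw [h2]
  simp only [dotProduct, spins, mul_add, Finset.sum_add_distrib, Finset.sum_mul]
  have h3 : ∑ j, spin (h j) * R.w j * spin y = ∑ j, spin (h j) * (spin y * R.w j) :=
    Finset.sum_congr rfl fun j _ => by ring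
  have h4 : ∑ j, R.b₂ j * spin (h j) = ∑ j, spin (h j) * R.b₂ j :=
    Finset.sum_congr rfl fun j _ => by ring
  rw [h3, h4]; ring

theorem obsWeight_pos (x : Fin n → ℤˣ) (y : ℤˣ) : 0 < obsWeight R x y :=
  mul_pos (Real.exp_pos _) (Finset.prod_pos fun _ _ => mul_pos two_pos (Real.cosh_pos _))

theorem partition_eq : R.partition = ∑ e : Example n, obsWeight R e.1 e.2 := by
  rw [Fintype.sum_prod_type, SupervisedRBM.partition]
  refine Finset.sum_congr rfl fun x _ => ?_
  rw [Finset.sum_comm]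
  exact Finset.sum_congr rfl fun y _ => sum_weight R x y

theorem partition_pos : 0 < R.partition := by
  rw [partition_eq]
  exact Finset.sum_pos (fun e _ => obsWeight_pos R _ _) ⟨(fun _ => 1, 1), Finset.mem_univ _⟩

theorem obsProb_eq (x : Fin n → ℤˣ) (y : ℤˣ) : R.obsProb x y = obsWeight R x y / R.partition := by
  simp only [SupervisedRBM.obsProb, SupervisedRBM.jointProb]
  rw [← Finset.sum_div, sum_weight]

theorem obsProb_pos (x : Fin n → ℤˣ) (y : ℤˣ) : 0 < R.obsProb x y := by
  rw [obsProb_eq]; exact div_pos (obsWeight_pos R _ _) (partition_pos R)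

/-- The law of an example. -/
noncomputable def law (e : Example n) : ℝ := R.obsProb e.1 e.2

theorem law_nonneg (e : Example n) : 0 ≤ law R e := (obsProb_pos R _ _).le

theorem sum_law : ∑ e, law R e = 1 := by
  simp only [law, obsProb_eq]
  rw [← Finset.sum_div, ← partition_eq, div_self (partition_pos R).ne']

/-! ### Correlation inequalities -/

variable {R}

theorem spin_sup_add_inf (a b : ℤˣ) : spin (a ⊓ b) + spin (a ⊔ b) = spin a + spin b := by
  have h1 : (1 ⊔ -1 : ℤˣ) = 1 := by decide
  have h2 : (1 ⊓ -1 : ℤˣ) = -1 := by decide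
  have h3 : (-1 ⊔ 1 : ℤˣ) = 1 := by decide
  have h4 : (-1 ⊓ 1 : ℤˣ) = -1 := by decide
  rcases Int.units_eq_one_or a with rfl | rfl <;> rcases Int.units_eq_one_or b with rfl | rfl <;>
    simp [h1, h2, h3, h4, add_comm]

theorem spin_mono {a b : ℤˣ} (h : a ≤ b) : spin a ≤ spin b := by
  have h1 : ¬ (1 : ℤˣ) ≤ -1 := by decide
  rcases Int.units_eq_one_or a with rfl | rfl <;> rcases Int.units_eq_one_or b with rfl | rfl
  · rfl
  · exact absurd h h1
  · norm_num [spin]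
  · rfl

theorem field_inf_add_sup (a b : Fin n → ℤˣ) (j : Fin n₂) :
    field R (a ⊓ b) j + field R (a ⊔ b) j = field R a j + field R b j := by
  simp only [field, ← Finset.sum_add_distrib, ← mul_add]
  exact Finset.sum_congr rfl fun i _ => by rw [Pi.inf_apply, Pi.sup_apply, spin_sup_add_inf]

theorem field_mono (hW : ∀ i j, 0 ≤ R.W i j) {a b : Fin n → ℤˣ} (h : a ≤ b) (j : Fin n₂) :
    field R a j ≤ field R b j :=
  Finset.sum_le_sum fun i _ => mul_le_mul_of_nonneg_left (spin_mono (h i)) (hW i j)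

theorem field_add_le (hW : ∀ i j, 0 ≤ R.W i j) {a b : Fin n → ℤˣ} (h : a ≤ b) (j : Fin n₂)
    {i : Fin n} (ha : a i = -1) (hb : b i = 1) : field R a j + 2 * R.W i j ≤ field R b j := by
  have h1 : 2 * R.W i j ≤ ∑ i, (R.W i j * spin (b i) - R.W i j * spin (a i)) := by
    refine le_trans (le_of_eq ?_) (Finset.single_le_sum (f := fun i => R.W i j * spin (b i) -
      R.W i j * spin (a i)) (fun i _ => sub_nonneg.2 (mul_le_mul_of_nonneg_left (spin_mono (h i))
        (hW i j))) (Finset.mem_univ i))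
    simp only [ha, hb, spin_neg, spin_one]; ring
  rw [Finset.sum_sub_distrib] at h1
  simp only [field]; linarith

theorem abs_field_le (hW : ∀ i j, 0 ≤ R.W i j) (x : Fin n → ℤˣ) (j : Fin n₂) :
    |field R x j| ≤ ∑ i, R.W i j := by
  refine (Finset.abs_sum_le_sum_abs _ _).trans (Finset.sum_le_sum fun i _ => ?_)
  rw [abs_mul, abs_spin, mul_one, abs_of_nonneg (hW i j)]

/-- Product formulas turn both sides into half of cosh(p - q) - cosh(a - b). This exact form
quantifies the supermodularity of a hidden unit. -/
theorem cosh_mul_sub (p q a b : ℝ) (h : q + p = a + b) :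
    Real.cosh q * Real.cosh p - Real.cosh a * Real.cosh b =
      Real.sinh (p - a) * Real.sinh (p - b) := by
  have e1 := Real.cosh_add p q
  have e2 := Real.cosh_sub p q
  have e3 := Real.cosh_add a b
  have e4 := Real.cosh_sub a b
  have e5 := Real.cosh_add (p - a) (p - b)
  have e6 := Real.cosh_sub (p - a) (p - b)
  rw [show p - a + (p - b) = p - q by linarith] at e5
  rw [show p - a - (p - b) = -(a - b) by ring, Real.cosh_neg] at e6
  rw [show p + q = a + b by linarith] at e1
  linarith

theorem cosh_le_exp {x l : ℝ} (h : |x| ≤ l) : Real.cosh x ≤ Real.exp l := by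
  rw [Real.cosh_eq]
  have := Real.exp_le_exp.2 ((le_abs_self x).trans h)
  have := Real.exp_le_exp.2 ((neg_le_abs x).trans h)
  linarith

/-- Ferromagnetism makes the field at the join at least both fields, so both hyperbolic sines in
`cosh_mul_sub` are nonnegative. -/
theorem cosh_field_mul_le (hW : ∀ i j, 0 ≤ R.W i j) (a b : Fin n → ℤˣ) (j : Fin n₂) (c : ℝ) :
    Real.cosh (field R a j + c) * Real.cosh (field R b j + c) ≤
      Real.cosh (field R (a ⊓ b) j + c) * Real.cosh (field R (a ⊔ b) j + c) := by
  have h := cosh_mul_sub (field R (a ⊔ b) j + c) (field R (a ⊓ b) j + c) (field R a j + c)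
    (field R b j + c) (by linarith [field_inf_add_sup (R := R) a b j])
  have h1 := Real.sinh_nonneg_iff.2
    (sub_nonneg.2 (add_le_add_left (field_mono hW (le_sup_left : a ≤ a ⊔ b) j) c))
  have h2 := Real.sinh_nonneg_iff.2
    (sub_nonneg.2 (add_le_add_left (field_mono hW (le_sup_right : b ≤ a ⊔ b) j) c))
  linarith [mul_nonneg h1 h2]

/-- The join turns up `v` in `a` and `u` in `b`, raising each field by at least `2 * al`; the gain
is therefore at least `4 * al ^ 2`. Sparsity bounds the product at meet and join by e^{2λ}, which
makes the gain relative. -/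
theorem cosh_field_mul_le_of_ne (hW : ∀ i j, 0 ≤ R.W i j) {a b : Fin n → ℤˣ} {j : Fin n₂} {c al lam : ℝ}
    (hal : 0 < al) {u v : Fin n} (au : a u = 1) (av : a v = -1) (bu : b u = -1) (bv : b v = 1)
    (hu : al ≤ R.W u j) (hv : al ≤ R.W v j) (hs : ∑ i, R.W i j + |c| ≤ lam) :
    Real.cosh (field R a j + c) * Real.cosh (field R b j + c) ≤
      (1 - 4 * al ^ 2 * Real.exp (-(2 * lam))) *
        (Real.cosh (field R (a ⊓ b) j + c) * Real.cosh (field R (a ⊔ b) j + c)) := by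
  have h := cosh_mul_sub (field R (a ⊔ b) j + c) (field R (a ⊓ b) j + c) (field R a j + c)
    (field R b j + c) (by linarith [field_inf_add_sup (R := R) a b j])
  have h1 := field_add_le hW (le_sup_left : a ≤ a ⊔ b) j av
    (by rw [Pi.sup_apply, av, bv]; decide)
  have h2 := field_add_le hW (le_sup_right : b ≤ a ⊔ b) j bu
    (by rw [Pi.sup_apply, au, bu]; decide)
  have g1 : 2 * al ≤ Real.sinh (field R (a ⊔ b) j + c - (field R a j + c)) :=
    (by linarith : 2 * al ≤ field R (a ⊔ b) j + c - (field R a j + c)).trans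
      (Real.self_le_sinh_iff.2 (by linarith))
  have g2 : 2 * al ≤ Real.sinh (field R (a ⊔ b) j + c - (field R b j + c)) :=
    (by linarith : 2 * al ≤ field R (a ⊔ b) j + c - (field R b j + c)).trans
      (Real.self_le_sinh_iff.2 (by linarith))
  have g3 := mul_le_mul g1 g2 (by linarith) (by linarith)
  have b1 : ∀ x : Fin n → ℤˣ, Real.cosh (field R x j + c) ≤ Real.exp lam := fun x =>
    cosh_le_exp ((abs_add_le _ _).trans (by linarith [abs_field_le hW x j]))
  have b2 := mul_le_mul (b1 (a ⊓ b)) (b1 (a ⊔ b)) (Real.cosh_pos _).le (Real.exp_pos _).le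
  have b3 : Real.exp (-(2 * lam)) * (Real.exp lam * Real.exp lam) = 1 := by
    rw [← Real.exp_add, ← Real.exp_add, ← Real.exp_zero]; congr 1; ring
  have b4 := mul_le_mul_of_nonneg_left b2
    (mul_nonneg (sq_nonneg al) (Real.exp_pos (-(2 * lam))).le)
  have b5 : al ^ 2 * Real.exp (-(2 * lam)) * (Real.exp lam * Real.exp lam) = al ^ 2 := by
    rw [mul_assoc, b3, mul_one]
  rw [b5] at b4
  nlinarith

theorem exp_modular (a b : Fin n → ℤˣ) (t : ℝ) :
    Real.exp (∑ i, R.b₁ i * spin (a i) + t) * Real.exp (∑ i, R.b₁ i * spin (b i) + t) =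
      Real.exp (∑ i, R.b₁ i * spin ((a ⊓ b) i) + t) *
        Real.exp (∑ i, R.b₁ i * spin ((a ⊔ b) i) + t) := by
  rw [← Real.exp_add, ← Real.exp_add]
  congr 1
  have : ∑ i, R.b₁ i * spin (a i) + ∑ i, R.b₁ i * spin (b i) =
      ∑ i, R.b₁ i * spin ((a ⊓ b) i) + ∑ i, R.b₁ i * spin ((a ⊔ b) i) := by
    simp only [← Finset.sum_add_distrib, ← mul_add]
    exact Finset.sum_congr rfl fun i _ => by rw [Pi.inf_apply, Pi.sup_apply, spin_sup_add_inf]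
  linarith

theorem obsProb_mul_le_of {a b : Fin n → ℤˣ} {y : ℤˣ} {κ : Fin n₂ → ℝ}
    (h : ∀ j, Real.cosh (field R a j + (R.b₂ j + spin y * R.w j)) *
      Real.cosh (field R b j + (R.b₂ j + spin y * R.w j)) ≤
      κ j * (Real.cosh (field R (a ⊓ b) j + (R.b₂ j + spin y * R.w j)) *
        Real.cosh (field R (a ⊔ b) j + (R.b₂ j + spin y * R.w j)))) :
    R.obsProb a y * R.obsProb b y ≤ (∏ j, κ j) * (R.obsProb (a ⊓ b) y * R.obsProb (a ⊔ b) y) := by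
  simp only [obsProb_eq, obsWeight]
  have hZ := partition_pos R
  set Z := R.partition
  have h1 : (∏ j, 2 * Real.cosh (field R a j + (R.b₂ j + spin y * R.w j))) *
      (∏ j, 2 * Real.cosh (field R b j + (R.b₂ j + spin y * R.w j))) ≤
      (∏ j, κ j) * ((∏ j, 2 * Real.cosh (field R (a ⊓ b) j + (R.b₂ j + spin y * R.w j))) *
      (∏ j, 2 * Real.cosh (field R (a ⊔ b) j + (R.b₂ j + spin y * R.w j)))) := by
    rw [← Finset.prod_mul_distrib, ← Finset.prod_mul_distrib, ← Finset.prod_mul_distrib]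
    refine Finset.prod_le_prod (fun j _ => ?_) fun j _ => ?_
    · have := Real.cosh_pos (field R a j + (R.b₂ j + spin y * R.w j))
      have := Real.cosh_pos (field R b j + (R.b₂ j + spin y * R.w j))
      positivity
    · linarith [h j]
  have h2 := exp_modular (R := R) a b (R.b₃ * spin y)
  set P1 := ∏ j, 2 * Real.cosh (field R a j + (R.b₂ j + spin y * R.w j))
  set P2 := ∏ j, 2 * Real.cosh (field R b j + (R.b₂ j + spin y * R.w j))
  set P3 := ∏ j, 2 * Real.cosh (field R (a ⊓ b) j + (R.b₂ j + spin y * R.w j))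
  set P4 := ∏ j, 2 * Real.cosh (field R (a ⊔ b) j + (R.b₂ j + spin y * R.w j))
  set E1 := Real.exp (∑ i, R.b₁ i * spin (a i) + R.b₃ * spin y)
  set E2 := Real.exp (∑ i, R.b₁ i * spin (b i) + R.b₃ * spin y)
  set E3 := Real.exp (∑ i, R.b₁ i * spin ((a ⊓ b) i) + R.b₃ * spin y)
  set E4 := Real.exp (∑ i, R.b₁ i * spin ((a ⊔ b) i) + R.b₃ * spin y)
  have e1 : E1 * P1 / Z * (E2 * P2 / Z) = (E1 * E2) / (Z * Z) * (P1 * P2) := by field_simp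
  have e2 : (∏ j, κ j) * (E3 * P3 / Z * (E4 * P4 / Z)) =
      (E1 * E2) / (Z * Z) * ((∏ j, κ j) * (P3 * P4)) := by rw [h2]; field_simp
  rw [e1, e2]
  refine mul_le_mul_of_nonneg_left h1 ?_
  have : 0 < E1 := Real.exp_pos _
  have : 0 < E2 := Real.exp_pos _
  positivity

theorem obsProb_mul_le (hW : ∀ i j, 0 ≤ R.W i j) (a b : Fin n → ℤˣ) (y : ℤˣ) :
    R.obsProb a y * R.obsProb b y ≤ R.obsProb (a ⊓ b) y * R.obsProb (a ⊔ b) y := by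
  have := obsProb_mul_le_of (R := R) (a := a) (b := b) (y := y) (κ := fun _ => 1) fun j => by
    rw [one_mul]; exact cosh_field_mul_le hW a b j _
  simpa using this

theorem obsProb_mul_le_of_ne (hW : ∀ i j, 0 ≤ R.W i j) {a b : Fin n → ℤˣ} {y : ℤˣ} {j : Fin n₂}
    {al lam : ℝ} (hal : 0 < al) {u v : Fin n} (au : a u = 1) (av : a v = -1) (bu : b u = -1)
    (bv : b v = 1) (hu : al ≤ R.W u j) (hv : al ≤ R.W v j)
    (hs : ∑ i, R.W i j + |R.b₂ j + spin y * R.w j| ≤ lam) :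
    R.obsProb a y * R.obsProb b y ≤ (1 - 4 * al ^ 2 * Real.exp (-(2 * lam))) *
      (R.obsProb (a ⊓ b) y * R.obsProb (a ⊔ b) y) := by
  have := obsProb_mul_le_of (R := R) (a := a) (b := b) (y := y)
    (κ := fun j' => if j' = j then 1 - 4 * al ^ 2 * Real.exp (-(2 * lam)) else 1) fun j' => by
    split_ifs with h
    · subst h; exact cosh_field_mul_le_of_ne hW hal au av bu bv hu hv hs
    · rw [one_mul]; exact cosh_field_mul_le hW a b j' _
  simpa using this

theorem cosh_add_le {w : ℝ} {s : ℝ} (hs : |s| ≤ 2 * w) (t : ℝ) :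
    Real.cosh (t + s) ≤ Real.exp (2 * w) * Real.cosh t := by
  rw [Real.cosh_eq, Real.cosh_eq, Real.exp_add, neg_add, Real.exp_add]
  have h1 := mul_le_mul_of_nonneg_left (Real.exp_le_exp.2 ((le_abs_self s).trans hs)) (Real.exp_pos t).le
  have h2 := mul_le_mul_of_nonneg_left (Real.exp_le_exp.2 ((neg_le_abs s).trans hs)) (Real.exp_pos (-t)).le
  linarith

/-- Changing the sign of the unit `u`. -/
def flip (u : Fin n) (x : Fin n → ℤˣ) : Fin n → ℤˣ := Function.update x u (-x u)

theorem flip_flip (u : Fin n) (x : Fin n → ℤˣ) : flip u (flip u x) = x := by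
  simp [flip]

theorem sum_mul_flip (f : Fin n → ℝ) (u : Fin n) (x : Fin n → ℤˣ) :
    ∑ i, f i * spin (flip u x i) = ∑ i, f i * spin (x i) - 2 * f u * spin (x u) := by
  have : ∀ i, f i * spin (flip u x i) = f i * spin (x i) -
      if i = u then 2 * f u * spin (x u) else 0 := by
    intro i
    by_cases h : i = u
    · subst h; simp [flip, spin_neg]; ring
    · simp [flip, h]
  rw [Finset.sum_congr rfl fun i _ => this i, Finset.sum_sub_distrib]
  simp

/-- Every field moves by at most `2 * R.W u j` and the bias term by at most `2 * |R.b₁ u|`, each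
costing at most its exponential. Thus no spin is nearly determined by the other visible units and
the label. -/
theorem obsProb_flip_le (hW : ∀ i j, 0 ≤ R.W i j) {lam : ℝ} {u : Fin n}
    (hu : ∑ j, R.W u j + |R.b₁ u| ≤ lam) (x : Fin n → ℤˣ) (y : ℤˣ) :
    R.obsProb (flip u x) y ≤ Real.exp (2 * lam) * R.obsProb x y := by
  rw [obsProb_eq, obsProb_eq, ← mul_div_assoc]
  refine div_le_div_of_nonneg_right ?_ (partition_pos R).le
  rw [obsWeight, obsWeight, sum_mul_flip]
  have h1 : ∏ j, (2 * Real.cosh (field R (flip u x) j + (R.b₂ j + spin y * R.w j))) ≤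
      Real.exp (2 * ∑ j, R.W u j) * ∏ j, (2 * Real.cosh (field R x j + (R.b₂ j + spin y * R.w j))) := by
    rw [Finset.mul_sum, Real.exp_sum, ← Finset.prod_mul_distrib]
    refine Finset.prod_le_prod (fun j _ => mul_nonneg two_pos.le (Real.cosh_pos _).le) fun j _ => ?_
    have e1 : field R (flip u x) j = field R x j - 2 * R.W u j * spin (x u) :=
      sum_mul_flip (fun i => R.W i j) u x
    have := cosh_add_le (w := R.W u j) (s := -(2 * R.W u j * spin (x u)))
      (by rw [abs_neg, abs_mul, abs_spin, mul_one, abs_of_nonneg (by linarith [hW u j])])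
      (field R x j + (R.b₂ j + spin y * R.w j))
    rw [e1, show field R x j - 2 * R.W u j * spin (x u) + (R.b₂ j + spin y * R.w j) =
      field R x j + (R.b₂ j + spin y * R.w j) + -(2 * R.W u j * spin (x u)) by ring]
    linarith
  have h2 : Real.exp (∑ i, R.b₁ i * spin (x i) - 2 * R.b₁ u * spin (x u) + R.b₃ * spin y) ≤
      Real.exp (2 * |R.b₁ u|) * Real.exp (∑ i, R.b₁ i * spin (x i) + R.b₃ * spin y) := by
    rw [← Real.exp_add, Real.exp_le_exp]
    have : -(2 * R.b₁ u * spin (x u)) ≤ 2 * |R.b₁ u| := by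
      refine (neg_le_abs _).trans (le_of_eq ?_)
      rw [abs_mul, abs_mul, abs_spin, abs_two, mul_one]
    linarith
  have h3 : Real.exp (2 * |R.b₁ u|) * Real.exp (2 * ∑ j, R.W u j) ≤ Real.exp (2 * lam) := by
    rw [← Real.exp_add, Real.exp_le_exp]; linarith
  set P := ∏ j, (2 * Real.cosh (field R x j + (R.b₂ j + spin y * R.w j)))
  set P' := ∏ j, (2 * Real.cosh (field R (flip u x) j + (R.b₂ j + spin y * R.w j)))
  set E := Real.exp (∑ i, R.b₁ i * spin (x i) + R.b₃ * spin y)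
  have hP : 0 ≤ P := Finset.prod_nonneg fun j _ => mul_nonneg two_pos.le (Real.cosh_pos _).le
  have hP' : 0 ≤ P' := Finset.prod_nonneg fun j _ => mul_nonneg two_pos.le (Real.cosh_pos _).le
  have hE : 0 < E := Real.exp_pos _
  calc _ ≤ Real.exp (2 * |R.b₁ u|) * E * (Real.exp (2 * ∑ j, R.W u j) * P) :=
        mul_le_mul h2 h1 hP' (by positivity)
    _ = Real.exp (2 * |R.b₁ u|) * Real.exp (2 * ∑ j, R.W u j) * (E * P) := by ring
    _ ≤ _ := mul_le_mul_of_nonneg_right h3 (by positivity)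

/-- Flipping `u` matches the configurations with the wrong value to those with the right one. Two
applications give each pattern of two spins a fixed share of its cell. -/
theorem sum_le_of_flip (hW : ∀ i j, 0 ≤ R.W i j) {lam : ℝ} {u : Fin n}
    (hu : ∑ j, R.W u j + |R.b₁ u| ≤ lam) (y : ℤˣ) {c : (Fin n → ℤˣ) → Prop} [DecidablePred c]
    (hc : ∀ x, c (flip u x) ↔ c x) (s : ℤˣ) :
    ∑ x with c x, R.obsProb x y ≤
      (1 + Real.exp (2 * lam)) * ∑ x with c x ∧ x u = s, R.obsProb x y := by
  have e1 : ∑ x with c x, R.obsProb x y = ∑ x with c x ∧ x u = s, R.obsProb x y +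
      ∑ x with c x ∧ ¬ x u = s, R.obsProb x y := by
    rw [← Finset.sum_filter_add_sum_filter_not _ (fun x : Fin n → ℤˣ => x u = s),
      Finset.filter_filter, Finset.filter_filter]
  have e2 : ∑ x with c x ∧ ¬ x u = s, R.obsProb x y =
      ∑ x with c x ∧ x u = s, R.obsProb (flip u x) y := by
    have hne : ∀ a b : ℤˣ, ¬ a = b ↔ -a = b := by decide
    refine Finset.sum_bij' (fun x _ => flip u x) (fun x _ => flip u x) ?_ ?_ ?_ ?_ ?_
    · intro x hx
      simp only [Finset.mem_filter, Finset.mem_univ, true_and] at hx ⊢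
      exact ⟨(hc x).2 hx.1, by simpa [flip] using (hne _ _).1 hx.2⟩
    · intro x hx
      simp only [Finset.mem_filter, Finset.mem_univ, true_and] at hx ⊢
      exact ⟨(hc x).2 hx.1, (hne _ _).2 (by simpa [flip] using hx.2)⟩
    · intro x _; exact flip_flip u x
    · intro x _; exact flip_flip u x
    · intro x _; rw [flip_flip]
  rw [e1, e2, add_mul, one_mul, Finset.mul_sum]
  exact add_le_add le_rfl (Finset.sum_le_sum fun x _ => obsProb_flip_le hW hu x y)

/-- The probability that an example has restriction `k` and its bits `u` and `v` are `s`
and `t`. -/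
noncomputable def quad (R : SupervisedRBM n n₂) (S : Finset (Fin n)) (k : Example n) (u v : Fin n)
    (s t : ℤˣ) : ℝ :=
  ∑ x with (key S (x, k.2) = k ∧ x u = s) ∧ x v = t, R.obsProb x k.2

theorem quad_nonneg (S : Finset (Fin n)) (k : Example n) (u v : Fin n) (s t : ℤˣ) :
    0 ≤ quad R S k u v s t :=
  Finset.sum_nonneg fun _ _ => (obsProb_pos R _ _).le

/-- The four functions theorem for the restrictions of the law to the four patterns of `u` and `v`:
meet and join of opposite mixed patterns are the two constant patterns, and fixing the features in
`S` is stable under both operations. -/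
theorem quad_mul_le {S : Finset (Fin n)} {k : Example n} {u v : Fin n} {κ : ℝ} (hκ : 0 ≤ κ)
    (h : ∀ a b : Fin n → ℤˣ, a u = 1 → a v = -1 → b u = -1 → b v = 1 →
      R.obsProb a k.2 * R.obsProb b k.2 ≤ κ * (R.obsProb (a ⊓ b) k.2 * R.obsProb (a ⊔ b) k.2)) :
    quad R S k u v 1 (-1) * quad R S k u v (-1) 1 ≤
      κ * (quad R S k u v (-1) (-1) * quad R S k u v 1 1) := by
  set F : ℤˣ → ℤˣ → (Fin n → ℤˣ) → ℝ := fun s t x =>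
    if (key S (x, k.2) = k ∧ x u = s) ∧ x v = t then R.obsProb x k.2 else 0 with hF
  have hF0 : ∀ s t x, 0 ≤ F s t x := fun s t x => by
    simp only [hF]; split_ifs; exacts [(obsProb_pos R _ _).le, le_rfl]
  have hq : ∀ s t, quad R S k u v s t = ∑ x, F s t x := fun s t => by
    rw [quad, Finset.sum_filter]
  rw [hq, hq, hq, hq, ← mul_assoc, Finset.mul_sum (f := F (-1) (-1))]
  refine four_functions_theorem_univ (F 1 (-1)) (F (-1) 1) (fun x => κ * F (-1) (-1) x) (F 1 1) (fun x => hF0 _ _ x)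
    (fun x => hF0 _ _ x) (fun x => mul_nonneg hκ (hF0 _ _ x)) (fun x => hF0 _ _ x) fun a b => ?_
  have hR : 0 ≤ κ * F (-1) (-1) (a ⊓ b) * F 1 1 (a ⊔ b) :=
    mul_nonneg (mul_nonneg hκ (hF0 _ _ _)) (hF0 _ _ _)
  by_cases ha : (key S (a, k.2) = k ∧ a u = 1) ∧ a v = -1
  swap
  · rw [show F 1 (-1) a = 0 from if_neg ha, zero_mul]; exact hR
  by_cases hb : (key S (b, k.2) = k ∧ b u = -1) ∧ b v = 1
  swap
  · rw [show F (-1) 1 b = 0 from if_neg hb, mul_zero]; exact hR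
  obtain ⟨⟨ka, au⟩, av⟩ := ha
  obtain ⟨⟨kb, bu⟩, bv⟩ := hb
  have hk : key S (a, k.2) = key S (b, k.2) := ka.trans kb.symm
  have hag := (key_eq_iff.1 hk).2
  have k1 : key S (a ⊓ b, k.2) = k := by
    rw [← ka, key_eq_iff]
    exact ⟨rfl, fun i hi => by have := hag i hi; simp only at this ⊢; simp [this]⟩
  have k2 : key S (a ⊔ b, k.2) = k := by
    rw [← ka, key_eq_iff]
    exact ⟨rfl, fun i hi => by have := hag i hi; simp only at this ⊢; simp [this]⟩
  have e1 : F 1 (-1) a = R.obsProb a k.2 := if_pos ⟨⟨ka, au⟩, av⟩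
  have e2 : F (-1) 1 b = R.obsProb b k.2 := if_pos ⟨⟨kb, bu⟩, bv⟩
  have e3 : F (-1) (-1) (a ⊓ b) = R.obsProb (a ⊓ b) k.2 :=
    if_pos ⟨⟨k1, by rw [Pi.inf_apply, au, bu]; decide⟩, by rw [Pi.inf_apply, av, bv]; decide⟩
  have e4 : F 1 1 (a ⊔ b) = R.obsProb (a ⊔ b) k.2 :=
    if_pos ⟨⟨k2, by rw [Pi.sup_apply, au, bu]; decide⟩, by rw [Pi.sup_apply, av, bv]; decide⟩
  rw [e1, e2, e3, e4, mul_assoc]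
  exact h a b au av bu bv

theorem cell_law_eq (S : Finset (Fin n)) (k : Example n) (f : Example n → ℝ) :
    cell (law R) S k f =
      ∑ x, if key S (x, k.2) = k then R.obsProb x k.2 * f (x, k.2) else 0 := by
  rw [cell, Finset.sum_filter, Fintype.sum_prod_type]
  refine Finset.sum_congr rfl fun x _ => ?_
  rw [Finset.sum_eq_single k.2]
  · rfl
  · intro y _ hy
    rw [if_neg]
    intro h; exact hy (congrArg Prod.snd h)
  · intro h; exact absurd (Finset.mem_univ _) h

theorem cell_law (S : Finset (Fin n)) (k : Example n) (u v : Fin n) (g : ℕ → ℕ → ℝ) :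
    cell (law R) S k (fun e => g (bit (e.1 u)) (bit (e.1 v))) =
      quad R S k u v 1 1 * g 1 1 + quad R S k u v 1 (-1) * g 1 0 +
      quad R S k u v (-1) 1 * g 0 1 + quad R S k u v (-1) (-1) * g 0 0 := by
  rw [cell_law_eq]
  simp only [quad, Finset.sum_filter, Finset.sum_mul, ← Finset.sum_add_distrib]
  refine Finset.sum_congr rfl fun x _ => ?_
  have h1 : ¬ (-1 : ℤˣ) = 1 := by decide
  have h2 : ¬ (1 : ℤˣ) = -1 := by decide
  by_cases hk : key S (x, k.2) = k
  · rcases Int.units_eq_one_or (x u) with h | h <;> rcases Int.units_eq_one_or (x v) with h' | h' <;>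
      simp [hk, h, h', bit, h1, h2]
  · simp [hk]

/-- The covariance of two bits is the determinant of their 2 by 2 table, up to normalization. -/
theorem cellStat_law (S : Finset (Fin n)) (k : Example n) (u v : Fin n) :
    cellStat (law R) S u v k * cell (law R) S k (fun _ => 1) =
      quad R S k u v 1 1 * quad R S k u v (-1) (-1) -
      quad R S k u v 1 (-1) * quad R S k u v (-1) 1 := by
  have hA := cell_law (R := R) S k u v (fun a _ => a)
  have hB := cell_law (R := R) S k u v (fun _ b => b)
  have hD := cell_law (R := R) S k u v (fun a b => a * b)
  have hC := cell_law (R := R) S k u v (fun _ _ => 1)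
  obtain ⟨a0, a1⟩ := cell_xb_le (S := S) (law_nonneg R) k u
  obtain ⟨d0, d1, -⟩ := cell_xb_mul_le (S := S) (law_nonneg R) k u v
  have q1 := quad_nonneg (R := R) S k u v 1 1
  have q2 := quad_nonneg (R := R) S k u v 1 (-1)
  have q3 := quad_nonneg (R := R) S k u v (-1) 1
  have q4 := quad_nonneg (R := R) S k u v (-1) (-1)
  rw [cellStat]
  change cell (law R) S k (xb u) = _ at hA
  change cell (law R) S k (xb v) = _ at hB
  change cell (law R) S k (fun e => xb u e * xb v e) = _ at hD
  push_cast at hA hB hD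
  simp only [mul_one, mul_zero, add_zero] at hA hB hC hD
  by_cases h : cell (law R) S k (fun _ => 1) = 0
  · rw [h] at hC ⊢
    have : quad R S k u v 1 1 = 0 := by linarith
    have : quad R S k u v 1 (-1) = 0 := by linarith
    rw [‹quad R S k u v 1 1 = 0›, ‹quad R S k u v 1 (-1) = 0›]; simp
  · rw [sub_mul, div_mul_cancel₀ _ h, hA, hB, hC, hD]
    ring

theorem cellStat_law_nonneg (hW : ∀ i j, 0 ≤ R.W i j) (S : Finset (Fin n)) (k : Example n)
    (u v : Fin n) : 0 ≤ cellStat (law R) S u v k := by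
  have h := quad_mul_le (R := R) (S := S) (k := k) (u := u) (v := v) zero_le_one fun a b _ _ _ _ => by
    rw [one_mul]; exact obsProb_mul_le hW a b k.2
  have h1 := cellStat_law (R := R) S k u v
  obtain ⟨a0, a1⟩ := cell_xb_le (S := S) (law_nonneg R) k u
  obtain ⟨d0, d1, -⟩ := cell_xb_mul_le (S := S) (law_nonneg R) k u v
  rcases eq_or_lt_of_le (a0.trans a1) with hC | hC
  · rw [cellStat, ← hC, div_zero, sub_zero]; exact d0
  · by_contra! hn
    have := mul_neg_of_neg_of_pos hn hC
    linarith

theorem key_flip {S : Finset (Fin n)} {u : Fin n} (hu : u ∉ S) (x : Fin n → ℤˣ) (y : ℤˣ) :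
    key S (flip u x, y) = key S (x, y) := by
  rw [key_eq_iff]
  refine ⟨rfl, fun i hi => ?_⟩
  have : i ≠ u := fun h => hu (h ▸ hi)
  simp [flip, this]

theorem cell_le_quad (hW : ∀ i j, 0 ≤ R.W i j) {lam : ℝ} {S : Finset (Fin n)} {u v : Fin n}
    (hu : ∑ j, R.W u j + |R.b₁ u| ≤ lam) (hv : ∑ j, R.W v j + |R.b₁ v| ≤ lam) (huv : v ≠ u)
    (huS : u ∉ S) (hvS : v ∉ S) (k : Example n) (s t : ℤˣ) :
    cell (law R) S k (fun _ => 1) ≤ (1 + Real.exp (2 * lam)) ^ 2 * quad R S k u v s t := by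
  have h1 := sum_le_of_flip hW hu k.2 (c := fun x => key S (x, k.2) = k)
    (fun x => by rw [key_flip huS]) s
  have h2 := sum_le_of_flip hW hv k.2 (c := fun x => key S (x, k.2) = k ∧ x u = s)
    (fun x => by rw [key_flip hvS]; simp [flip, huv.symm]) t
  have h3 : cell (law R) S k (fun _ => 1) = ∑ x with key S (x, k.2) = k, R.obsProb x k.2 := by
    rw [cell_law_eq, Finset.sum_filter]; simp only [mul_one]
  have hE := Real.exp_pos (2 * lam)
  rw [h3, quad]
  have h4 := h1.trans (mul_le_mul_of_nonneg_left h2 (by linarith))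
  rw [sq, mul_assoc]
  exact h4

/-- The determinant is at least `4 * al ^ 2 * exp (-(2 * lam))` times the product of the two
diagonal entries, each at least `exp (-(4 * lam)) / 4` of the mass of the cell. -/
theorem cellStat_law_le (hW : ∀ i j, 0 ≤ R.W i j) {lam al : ℝ} (hal : 0 < al) (hlam : al ≤ lam)
    {S : Finset (Fin n)} {u v : Fin n}
    (hu : ∑ j, R.W u j + |R.b₁ u| ≤ lam) (hv : ∑ j, R.W v j + |R.b₁ v| ≤ lam) (huv : v ≠ u)
    (huS : u ∉ S) (hvS : v ∉ S) (k : Example n) {j : Fin n₂} (huj : al ≤ R.W u j)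
    (hvj : al ≤ R.W v j) (hs : ∑ i, R.W i j + |R.b₂ j + spin k.2 * R.w j| ≤ lam) :
    al ^ 2 * Real.exp (-(10 * lam)) / 4 * cell (law R) S k (fun _ => 1) ≤
      cellStat (law R) S u v k := by
  set κ := 1 - 4 * al ^ 2 * Real.exp (-(2 * lam)) with hκ
  have hl0 : 0 < lam := hal.trans_le hlam
  have hκ0 : 0 ≤ κ := by
    -- Since `al ≤ lam`, the quadratic bound for the exponential suffices: 1 + λ + λ²/2 ≥ 2λ.
    have h1 : 2 * al ≤ Real.exp lam := by
      have := Real.quadratic_le_exp_of_nonneg hl0.le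
      nlinarith [sq_nonneg (lam - 1)]
    have h2 : (2 * al) ^ 2 ≤ Real.exp lam ^ 2 := pow_le_pow_left₀ (by linarith) h1 2
    have h3 : Real.exp (-(2 * lam)) * Real.exp lam ^ 2 = 1 := by
      rw [sq, ← Real.exp_add, ← Real.exp_add, ← Real.exp_zero]; congr 1; ring
    have h4 := mul_le_mul_of_nonneg_left h2 (Real.exp_pos (-(2 * lam))).le
    rw [h3] at h4
    rw [hκ]; nlinarith
  have h := quad_mul_le (R := R) (S := S) (k := k) (u := u) (v := v) hκ0 fun a b au av bu bv =>
    obsProb_mul_le_of_ne hW hal au av bu bv huj hvj hs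
  have h1 := cellStat_law (R := R) S k u v
  have b1 := cell_le_quad hW hu hv huv huS hvS k 1 1
  have b2 := cell_le_quad hW hu hv huv huS hvS k (-1) (-1)
  set C := cell (law R) S k (fun _ => 1) with hC
  have hC0 : 0 ≤ C := cell_nonneg (law_nonneg R) k fun _ => zero_le_one
  rcases eq_or_lt_of_le hC0 with hC' | hC'
  · rw [← hC', mul_zero]; exact cellStat_law_nonneg hW S k u v
  have e1 : 1 + Real.exp (2 * lam) ≤ 2 * Real.exp (2 * lam) := by
    have := Real.add_one_le_exp (2 * lam); linarith
  have e2 : (1 + Real.exp (2 * lam)) ^ 2 ≤ 4 * Real.exp (4 * lam) := by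
    have := pow_le_pow_left₀ (by positivity) e1 2
    rw [mul_pow, ← Real.exp_nat_mul] at this
    refine this.trans (le_of_eq ?_)
    norm_num; ring
  have hb : ∀ s t, C ≤ (1 + Real.exp (2 * lam)) ^ 2 * quad R S k u v s t →
      C * (Real.exp (-(4 * lam)) / 4) ≤ quad R S k u v s t := by
    intro s t hst
    have hq := quad_nonneg (R := R) S k u v s t
    have h1 := hst.trans (mul_le_mul_of_nonneg_right e2 hq)
    have h2 := mul_le_mul_of_nonneg_right h1 (Real.exp_pos (-(4 * lam))).le
    have h3 : Real.exp (-(4 * lam)) * Real.exp (4 * lam) = 1 := by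
      rw [← Real.exp_add, ← Real.exp_zero]; congr 1; ring
    have h4 : 4 * Real.exp (4 * lam) * quad R S k u v s t * Real.exp (-(4 * lam)) =
        4 * quad R S k u v s t := by linear_combination 4 * quad R S k u v s t * h3
    rw [h4] at h2; linarith
  have c1 := hb _ _ b1
  have c2 := hb _ _ b2
  have c3 := mul_le_mul c1 c2 (mul_nonneg hC0 (by positivity)) (quad_nonneg S k u v 1 1)
  have c4 : (1 - κ) * (C * (Real.exp (-(4 * lam)) / 4) * (C * (Real.exp (-(4 * lam)) / 4))) ≤
      cellStat (law R) S u v k * C := by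
    have h5 : 0 ≤ 1 - κ := by rw [hκ]; have := Real.exp_pos (-(2 * lam)); ring_nf; positivity
    have := mul_le_mul_of_nonneg_left c3 h5
    rw [h1]; linarith
  have c5 : (1 - κ) * (C * (Real.exp (-(4 * lam)) / 4) * (C * (Real.exp (-(4 * lam)) / 4))) =
      (al ^ 2 * Real.exp (-(10 * lam)) / 4 * C) * C := by
    have : Real.exp (-(10 * lam)) =
        Real.exp (-(2 * lam)) * (Real.exp (-(4 * lam)) * Real.exp (-(4 * lam))) := by
      rw [← Real.exp_add, ← Real.exp_add]; congr 1; ring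
    rw [hκ, this]; ring
  rw [c5] at c4
  exact le_of_mul_le_mul_right c4 hC'

/-- Units with a common hidden neighbour have a large conditional covariance. -/
theorem lawStat_ge (hW : ∀ i j, 0 ≤ R.W i j) {lam al be : ℝ} (hal : 0 < al) (hlam : al ≤ lam)
    (hsp : ∀ i, ∑ j, R.W i j + |R.b₁ i| ≤ lam) {y : ℤˣ}
    (hs : ∀ j, ∑ i, R.W i j + |R.b₂ j + spin y * R.w j| ≤ lam) (hbe : be ≤ R.labelProb y)
    {u v : Fin n} (huv : v ≠ u) {j : Fin n₂} (huj : al ≤ R.W u j)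
    (hvj : al ≤ R.W v j) (S : Finset (Fin n)) (huS : u ∉ S) (hvS : v ∉ S) :
    2 * thrVal lam al be ≤ lawStat (law R) S u v := by
  have h1 : ∑ k : Example n with k.2 = y, cell (law R) S k (fun _ => 1) = R.labelProb y := by
    have : ∀ k : Example n, k.2 = y → cell (law R) S k (fun _ => 1) =
        ∑ x : Fin n → ℤˣ, if key S (x, y) = k then R.obsProb x y else 0 := by
      rintro k rfl
      rw [cell_law_eq]; simp only [mul_one]
    rw [Finset.sum_congr rfl fun k hk => this k (Finset.mem_filter.1 hk).2, Finset.sum_comm,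
      SupervisedRBM.labelProb]
    refine Finset.sum_congr rfl fun x _ => ?_
    rw [Finset.sum_eq_single (key S (x, y))]
    · simp
    · intro k _ hk; rw [if_neg hk.symm]
    · intro h; exact absurd (Finset.mem_filter.2 ⟨Finset.mem_univ _, by rw [key]⟩) h
  calc 2 * thrVal lam al be = al ^ 2 * Real.exp (-(10 * lam)) / 4 * be := by rw [thrVal]; ring
    _ ≤ al ^ 2 * Real.exp (-(10 * lam)) / 4 * R.labelProb y :=
        mul_le_mul_of_nonneg_left hbe (by positivity)
    _ ≤ ∑ k : Example n with k.2 = y, cellStat (law R) S u v k := by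
        rw [← h1, Finset.mul_sum]
        refine Finset.sum_le_sum fun k hk => ?_
        refine cellStat_law_le hW hal hlam (hsp u) (hsp v) huv huS hvS k huj hvj ?_
        rw [(Finset.mem_filter.1 hk).2]; exact hs j
    -- Sparsity is only known at the label `y`; cells with the other label can be dropped, being
    -- nonnegative by ferromagnetism.
    _ ≤ _ := Finset.sum_le_sum_of_subset_of_nonneg (Finset.filter_subset _ _)
        fun k _ _ => cellStat_law_nonneg hW S k u v

end RBMLearn

namespace RBMLearn

/-! ### The minimizer of the logistic loss -/

variable {n n₂ : ℕ} (R : SupervisedRBM n n₂)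

theorem risk_eq (g : (Fin n → ℤˣ) → ℝ) : R.risk g = lawRisk (law R) g := by
  rw [SupervisedRBM.risk, lawRisk, Fintype.sum_prod_type]; rfl

/-- Half the logarithm of the odds of the label. -/
noncomputable def logOdds (x : Fin n → ℤˣ) : ℝ :=
  (Real.log (R.obsProb x 1) - Real.log (R.obsProb x (-1))) / 2

theorem exp_logOdds (x : Fin n → ℤˣ) :
    Real.exp (2 * logOdds R x) = R.obsProb x 1 / R.obsProb x (-1) := by
  rw [logOdds, show 2 * ((Real.log (R.obsProb x 1) - Real.log (R.obsProb x (-1))) / 2) =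
    Real.log (R.obsProb x 1) - Real.log (R.obsProb x (-1)) by ring, Real.exp_sub,
    Real.exp_log (obsProb_pos R _ _), Real.exp_log (obsProb_pos R _ _)]

/-- The tangent bound for the convex loss leaves a first-order term that vanishes at each `x`: at
the log odds, the derivatives for the two labels balance. -/
theorem lawRisk_logOdds_le (g : (Fin n → ℤˣ) → ℝ) :
    lawRisk (law R) (logOdds R) ≤ lawRisk (law R) g := by
  have h := lawRisk_sub_le (law_nonneg R) (logOdds R) g
  have h0 : ∑ e, law R e * (lossDeriv (logOdds R e.1) e.2 * (logOdds R e.1 - g e.1)) = 0 := by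
    rw [Fintype.sum_prod_type]
    refine Finset.sum_eq_zero fun x _ => ?_
    rw [sum_units]
    simp only [law, lossDeriv, spin_neg, spin_one]
    have h1 := obsProb_pos R x 1
    have h2 := obsProb_pos R x (-1)
    have h3 := exp_logOdds R x
    have h4 : Real.exp (2 * -1 * logOdds R x) = R.obsProb x (-1) / R.obsProb x 1 := by
      rw [show 2 * -1 * logOdds R x = -(2 * logOdds R x) by ring, Real.exp_neg, h3, inv_div]
    rw [h4, mul_one (2 : ℝ), h3]
    field_simp
    ring
  linarith

/-- The contribution of the hidden unit `j` to the log odds. -/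
noncomputable def hiddenOdds (j : Fin n₂) (x : Fin n → ℤˣ) : ℝ :=
  (Real.log (Real.cosh (field R x j + (R.b₂ j + R.w j))) -
    Real.log (Real.cosh (field R x j + (R.b₂ j + -R.w j)))) / 2

/-- The visible biases and the normalization do not depend on the label and cancel, which localizes
the log odds at the hidden units. -/
theorem logOdds_eq (x : Fin n → ℤˣ) : logOdds R x = R.b₃ + ∑ j, hiddenOdds R j x := by
  have hl : ∀ y, Real.log (R.obsProb x y) = (∑ i, R.b₁ i * spin (x i) + R.b₃ * spin y) +
      ∑ j, (Real.log 2 + Real.log (Real.cosh (field R x j + (R.b₂ j + spin y * R.w j)))) -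
      Real.log R.partition := by
    intro y
    rw [obsProb_eq, Real.log_div (obsWeight_pos R x y).ne' (partition_pos R).ne', obsWeight,
      Real.log_mul (Real.exp_pos _).ne' (Finset.prod_pos fun j _ =>
        mul_pos two_pos (Real.cosh_pos _)).ne', Real.log_exp, Real.log_prod fun j _ =>
        (mul_pos two_pos (Real.cosh_pos _)).ne']
    congr 2
    exact Finset.sum_congr rfl fun j _ => Real.log_mul two_ne_zero (Real.cosh_pos _).ne'
  rw [logOdds, hl, hl]
  simp only [hiddenOdds, spin_neg, spin_one, one_mul, neg_mul, Finset.sum_add_distrib, ← Finset.sum_div,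
    Finset.sum_sub_distrib]
  ring

variable {R}

theorem abs_log_cosh_sub_le (a b : ℝ) :
    |Real.log (Real.cosh a) - Real.log (Real.cosh b)| ≤ |a - b| := by
  have h : ∀ a b : ℝ, Real.log (Real.cosh a) - Real.log (Real.cosh b) ≤ |a - b| := by
    intro a b
    have h1 := cosh_add_le (w := |a - b| / 2) (s := a - b) (by linarith) b
    rw [show b + (a - b) = a by ring] at h1
    have h2 := Real.log_le_log (Real.cosh_pos a) h1
    rw [Real.log_mul (Real.exp_pos _).ne' (Real.cosh_pos _).ne', Real.log_exp] at h2
    linarith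
  rw [abs_le]
  constructor
  · have := h b a; rw [abs_sub_comm] at this; linarith
  · exact h a b

/-- The logarithm of cosh is 1-Lipschitz. Taking differences removes `b₂` and `w`, which may be
large because sparsity controls their combination at one label only. -/
theorem abs_hiddenOdds_sub_le (hW : ∀ i j, 0 ≤ R.W i j) (j : Fin n₂) (x x' : Fin n → ℤˣ) :
    |hiddenOdds R j x - hiddenOdds R j x'| ≤ 2 * ∑ i, R.W i j := by
  have h1 := abs_log_cosh_sub_le (field R x j + (R.b₂ j + R.w j)) (field R x' j + (R.b₂ j + R.w j))
  have h2 := abs_log_cosh_sub_le (field R x j + (R.b₂ j + -R.w j)) (field R x' j + (R.b₂ j + -R.w j))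
  rw [add_sub_add_right_eq_sub] at h1 h2
  have h3 : |field R x j - field R x' j| ≤ 2 * ∑ i, R.W i j :=
    (abs_sub _ _).trans (by linarith [abs_field_le hW x j, abs_field_le hW x' j])
  rw [abs_le] at h1 h2 ⊢
  simp only [hiddenOdds]
  constructor <;> linarith [h1.1, h1.2, h2.1, h2.2]

theorem hiddenOdds_congr {j : Fin n₂} {x x' : Fin n → ℤˣ} (h : ∀ i, R.W i j ≠ 0 → x i = x' i) :
    hiddenOdds R j x = hiddenOdds R j x' := by
  have : field R x j = field R x' j := Finset.sum_congr rfl fun i _ => by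
    by_cases hi : R.W i j = 0
    · simp [hi]
    · rw [h i hi]
  rw [hiddenOdds, hiddenOdds, this]

theorem sum_W_le {lam : ℝ} (hsp : ∀ i, ∑ j, R.W i j + |R.b₁ i| ≤ lam) :
    ∑ j, ∑ i, R.W i j ≤ n * lam := by
  rw [Finset.sum_comm]
  refine (Finset.sum_le_card_nsmul _ _ lam fun i _ => ?_).trans (le_of_eq (by simp))
  have := hsp i
  linarith [abs_nonneg (R.b₁ i)]

theorem abs_logOdds_sub_le (hW : ∀ i j, 0 ≤ R.W i j) {lam : ℝ}
    (hsp : ∀ i, ∑ j, R.W i j + |R.b₁ i| ≤ lam) (x x' : Fin n → ℤˣ) :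
    |logOdds R x - logOdds R x'| ≤ 2 * n * lam := by
  rw [logOdds_eq, logOdds_eq, add_sub_add_left_eq_sub, ← Finset.sum_sub_distrib]
  refine (Finset.abs_sum_le_sum_abs _ _).trans
    ((Finset.sum_le_sum fun j _ => abs_hiddenOdds_sub_le hW j x x').trans ?_)
  rw [← Finset.mul_sum]
  linarith [sum_W_le hsp]

theorem labelProb_add : R.labelProb 1 + R.labelProb (-1) = 1 := by
  have := sum_law R
  rw [Fintype.sum_prod_type, Finset.sum_comm, sum_units] at this
  exact this

theorem labelProb_nonneg (y : ℤˣ) : 0 ≤ R.labelProb y :=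
  Finset.sum_nonneg fun x _ => (obsProb_pos R x y).le

/-- By balance each label is at least `be` times as likely as the other at some point, which bounds
the log odds below and above at one point each. Their total oscillation carries these bounds to all
`x`. -/
theorem abs_logOdds_le (hW : ∀ i j, 0 ≤ R.W i j) {lam be : ℝ} (hbe : 0 < be)
    (hsp : ∀ i, ∑ j, R.W i j + |R.b₁ i| ≤ lam) (hbal : ∀ y, be ≤ R.labelProb y)
    (x : Fin n → ℤˣ) : |logOdds R x| ≤ 2 * n * lam + 1 / be := by
  -- Otherwise summation over all points would give a label probability below `be`.
  have key : ∀ y : ℤˣ, ∃ x', be * R.obsProb x' (-y) ≤ R.obsProb x' y := by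
    intro y
    by_contra! h
    have h1 : R.labelProb y < be * R.labelProb (-y) := by
      rw [SupervisedRBM.labelProb, SupervisedRBM.labelProb, Finset.mul_sum]
      exact Finset.sum_lt_sum_of_nonempty Finset.univ_nonempty fun x _ => h x
    have h2 := labelProb_add (R := R)
    have h3 := labelProb_nonneg (R := R) 1
    have h4 := labelProb_nonneg (R := R) (-1)
    have h5 : R.labelProb (-y) ≤ 1 := by
      rcases Int.units_eq_one_or y with rfl | rfl
      · linarith
      · rw [neg_neg]; linarith
    have := hbal y
    nlinarith
  have hlog : ∀ y x', be * R.obsProb x' (-y) ≤ R.obsProb x' y →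
      -(1 / be) ≤ Real.log (R.obsProb x' y) - Real.log (R.obsProb x' (-y)) := by
    intro y x' h
    have h1 := Real.log_le_log (mul_pos hbe (obsProb_pos R x' (-y))) h
    rw [Real.log_mul hbe.ne' (obsProb_pos R x' (-y)).ne'] at h1
    have h2 := Real.log_le_sub_one_of_pos (x := 1 / be) (by positivity)
    rw [one_div, Real.log_inv] at h2
    rw [one_div]; linarith
  obtain ⟨x1, h1⟩ := key 1
  obtain ⟨x2, h2⟩ := key (-1)
  have g1 := hlog _ _ h1
  have g2 := hlog _ _ h2
  rw [neg_neg] at g2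
  have d1 := abs_le.1 (abs_logOdds_sub_le hW hsp x x1)
  have d2 := abs_le.1 (abs_logOdds_sub_le hW hsp x x2)
  have hb : 0 < 1 / be := by positivity
  have e1 : -(1 / be) ≤ logOdds R x1 := by rw [logOdds]; linarith
  have e2 : logOdds R x2 ≤ 1 / be := by rw [logOdds]; linarith
  rw [abs_le]
  constructor <;> linarith [d1.1, d2.2]

/-! ### Expansion into monomials -/

/-- Splitting a function into its even and odd parts in one variable keeps the bound on its absolute
value and doubles the number of pieces. -/
theorem exists_expansion (N : Finset (Fin n)) {F : (Fin n → ℤˣ) → ℝ} {b : ℝ}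
    (hF : ∀ x x', (∀ i ∈ N, x i = x' i) → F x = F x') (hb : ∀ x, |F x| ≤ b) :
    ∃ c : Finset (Fin n) → ℝ, (∀ x, F x = ∑ A ∈ N.powerset, c A * monom A x) ∧
      ∑ A ∈ N.powerset, |c A| ≤ 2 ^ N.card * b := by
  induction N using Finset.induction_on generalizing F with
  | empty =>
    refine ⟨fun _ => F fun _ => 1, fun x => ?_, ?_⟩
    · simp [monom]; exact hF _ _ (by simp)
    · simpa using hb _
  | insert a N ha ih =>
    set u : ℤˣ → (Fin n → ℤˣ) → (Fin n → ℤˣ) := fun s x => Function.update x a s with hu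
    have hdep : ∀ s x x', (∀ i ∈ N, x i = x' i) → F (u s x) = F (u s x') := by
      intro s x x' h
      refine hF _ _ fun i hi => ?_
      by_cases hia : i = a
      · subst hia; simp [hu]
      · simp [hu, hia, h i (Finset.mem_of_mem_insert_of_ne hi hia)]
    obtain ⟨c0, h0, s0⟩ := ih (F := fun x => (F (u 1 x) + F (u (-1) x)) / 2)
      (fun x x' h => by simp only [hdep _ x x' h]) fun x => by
        have h1 := abs_le.1 (hb (u 1 x)); have h2 := abs_le.1 (hb (u (-1) x))
        rw [abs_le]; constructor <;> linarith [h1.1, h1.2, h2.1, h2.2]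
    obtain ⟨c1, h1, s1⟩ := ih (F := fun x => (F (u 1 x) - F (u (-1) x)) / 2)
      (fun x x' h => by simp only [hdep _ x x' h]) fun x => by
        have h1 := abs_le.1 (hb (u 1 x)); have h2 := abs_le.1 (hb (u (-1) x))
        rw [abs_le]; constructor <;> linarith [h1.1, h1.2, h2.1, h2.2]
    refine ⟨fun A => if a ∈ A then c1 (A.erase a) else c0 A, fun x => ?_, ?_⟩
    · rw [Finset.sum_powerset_insert ha]
      have e0 : ∀ A ∈ N.powerset, (if a ∈ A then c1 (A.erase a) else c0 A) * monom A x =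
          c0 A * monom A x := fun A hA => by
        rw [if_neg fun h => ha (Finset.mem_powerset.1 hA h)]
      have e1 : ∀ A ∈ N.powerset, (if a ∈ insert a A then c1 ((insert a A).erase a) else
          c0 (insert a A)) * monom (insert a A) x = spin (x a) * (c1 A * monom A x) := fun A hA => by
        have haA : a ∉ A := fun h => ha (Finset.mem_powerset.1 hA h)
        rw [if_pos (Finset.mem_insert_self _ _), Finset.erase_insert haA, monom,
          Finset.prod_insert haA, ← monom]
        ring
      rw [Finset.sum_congr rfl e0, Finset.sum_congr rfl e1, ← Finset.mul_sum, ← h0, ← h1]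
      have hx : u (x a) x = x := by simp [hu]
      rcases Int.units_eq_one_or (x a) with h | h
      · rw [h] at hx ⊢; rw [hx, spin_one]; ring
      · rw [h] at hx ⊢; rw [hx, spin_neg, spin_one]; ring
    · rw [Finset.sum_powerset_insert ha, Finset.card_insert_of_notMem ha]
      have e0 : ∀ A ∈ N.powerset, |if a ∈ A then c1 (A.erase a) else c0 A| = |c0 A| := fun A hA => by
        rw [if_neg fun h => ha (Finset.mem_powerset.1 hA h)]
      have e1 : ∀ A ∈ N.powerset, |if a ∈ insert a A then c1 ((insert a A).erase a) else
          c0 (insert a A)| = |c1 A| := fun A hA => by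
        have haA : a ∉ A := fun h => ha (Finset.mem_powerset.1 hA h)
        rw [if_pos (Finset.mem_insert_self _ _), Finset.erase_insert haA]
      rw [Finset.sum_congr rfl e0, Finset.sum_congr rfl e1, pow_succ]
      linarith

/-- The list of monomials repeats entries, the empty set for instance. Each coefficient is placed at
the first occurrence only. -/
theorem sum_getD_eq {L : List (Finset (Fin n))} (f : Finset (Fin n) → ℝ)
    (hf : ∀ A, A ∉ L → f A = 0) :
    ∑ j ∈ Finset.range L.length, (if L.idxOf (L.getD j ∅) = j then f (L.getD j ∅) else 0) =
      ∑ A, f A := by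
  rw [← Finset.sum_filter]
  have h1 : ∑ A, f A = ∑ A ∈ L.toFinset, f A :=
    (Finset.sum_subset (Finset.subset_univ _) fun A _ hA => hf A (by simpa using hA)).symm
  rw [h1]
  refine Finset.sum_bij' (fun j _ => L.getD j ∅) (fun A _ => L.idxOf A) ?_ ?_ ?_ ?_ ?_
  · intro j hj
    have hj' := Finset.mem_range.1 (Finset.mem_filter.1 hj).1
    rw [List.mem_toFinset, List.getD_eq_getElem _ _ hj']
    exact List.getElem_mem hj'
  · intro A hA
    have hA' := List.idxOf_lt_length_of_mem (List.mem_toFinset.1 hA)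
    rw [Finset.mem_filter, Finset.mem_range, List.getD_eq_getElem _ _ hA', List.getElem_idxOf]
    exact ⟨hA', rfl⟩
  · intro j hj; exact (Finset.mem_filter.1 hj).2
  · intro A hA
    have hA' := List.idxOf_lt_length_of_mem (List.mem_toFinset.1 hA)
    rw [List.getD_eq_getElem _ _ hA', List.getElem_idxOf]
  · intro j _; rfl

theorem card_neighbours_le (hmin : R.MinFerromagnetic al) (hal : 0 < al) {lam : ℝ}
    (hW : ∀ i j, 0 ≤ R.W i j) {j : Fin n₂} (hs : ∑ i, R.W i j ≤ lam) :
    ((Finset.univ.filter fun i => R.W i j ≠ 0).card : ℝ) ≤ lam / al := by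
  rw [le_div_iff₀ hal]
  refine le_trans ?_ hs
  rw [← nsmul_eq_mul]
  refine (Finset.card_nsmul_le_sum _ (fun i => R.W i j) _ fun i hi => ?_).trans
    (Finset.sum_le_sum_of_subset_of_nonneg (Finset.filter_subset _ _) fun i _ _ => hW i j)
  exact (hmin i j).resolve_left (Finset.mem_filter.1 hi).2

/-- The log odds as a combination of the monomials in a list. -/
theorem exists_logOdds_coeff {lam al be : ℝ} (hal : 0 < al) (hlam : al ≤ lam) (hbe : 0 < be)
    (hmin : R.MinFerromagnetic al) (hW : ∀ i j, 0 ≤ R.W i j)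
    (hsp : ∀ i, ∑ j, R.W i j + |R.b₁ i| ≤ lam) (hs : ∀ j, ∑ i, R.W i j ≤ lam)
    (hbal : ∀ y, be ≤ R.labelProb y) {L : List (Finset (Fin n))} (h0 : ∅ ∈ L)
    (hL : ∀ (j : Fin n₂) (A : Finset (Fin n)), (∀ i ∈ A, R.W i j ≠ 0) → A ∈ L) :
    ∃ c : ℕ → ℝ, ∑ j ∈ Finset.range L.length, |c j| ≤ radVal n lam al be ∧
      ∀ x, logOdds R x = ∑ j ∈ Finset.range L.length, c j * monom (L.getD j ∅) x := by
  set N : Fin n₂ → Finset (Fin n) := fun j => Finset.univ.filter fun i => R.W i j ≠ 0 with hN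
  set x0 : Fin n → ℤˣ := fun _ => 1 with hx0
  -- Only increments from a base point are expanded, as they are bounded in terms of `W`; the value
  -- at the base point goes into the constant monomial.
  have hex := fun j => exists_expansion (N j) (F := fun x => hiddenOdds R j x - hiddenOdds R j x0)
    (b := 2 * ∑ i, R.W i j) (fun x x' h => by
      rw [hiddenOdds_congr (x := x) (x' := x') fun i hi => h i (by simp [hN, hi])])
    (fun x => abs_hiddenOdds_sub_le hW j x x0)
  choose c hc hcs using hex
  set C : Finset (Fin n) → ℝ := fun A => (if A = ∅ then logOdds R x0 else 0) +
    ∑ j, if A ⊆ N j then c j A else 0 with hC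
  have hps : ∀ (j : Fin n₂) (f : Finset (Fin n) → ℝ),
      ∑ A, (if A ⊆ N j then f A else 0) = ∑ A ∈ (N j).powerset, f A := by
    intro j f
    rw [← Finset.sum_filter]
    congr 1
    ext A; simp
  have hCL : ∀ A, A ∉ L → C A = 0 := by
    intro A hA
    have h1 : A ≠ ∅ := fun h => hA (h ▸ h0)
    rw [hC]
    simp only [if_neg h1, zero_add]
    refine Finset.sum_eq_zero fun j _ => if_neg fun h => hA (hL j A fun i hi => ?_)
    simpa [hN] using h hi
  have hrep : ∀ x, logOdds R x = ∑ A, C A * monom A x := by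
    intro x
    simp only [hC, add_mul, Finset.sum_add_distrib, Finset.sum_mul, ite_mul, zero_mul]
    rw [Finset.sum_comm]
    simp only [hps, ← hc]
    rw [Finset.sum_ite_eq' Finset.univ ∅, if_pos (Finset.mem_univ _), Finset.sum_sub_distrib]
    rw [logOdds_eq, logOdds_eq]
    simp [monom]
  have hsum : ∑ A, |C A| ≤ radVal n lam al be := by
    have h1 : ∑ A, |C A| ≤ |logOdds R x0| + ∑ j, 2 ^ (N j).card * (2 * ∑ i, R.W i j) := by
      calc _ ≤ ∑ A, ((if A = ∅ then |logOdds R x0| else 0) + ∑ j, if A ⊆ N j then |c j A| else 0) := by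
            refine Finset.sum_le_sum fun A _ => (abs_add_le _ _).trans (add_le_add ?_ ?_)
            · split_ifs <;> simp
            · refine (Finset.abs_sum_le_sum_abs _ _).trans (Finset.sum_le_sum fun j _ => ?_)
              split_ifs <;> simp
        _ ≤ _ := by
            rw [Finset.sum_add_distrib, Finset.sum_comm]
            simp only [hps]
            rw [Finset.sum_ite_eq' Finset.univ ∅, if_pos (Finset.mem_univ _)]
            exact add_le_add le_rfl (Finset.sum_le_sum fun j _ => hcs j)
    have h2 : ∑ j, (2 : ℝ) ^ (N j).card * (2 * ∑ i, R.W i j) ≤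
        2 * n * (lam * lam / al) * Real.exp (lam / al) := by
      have h3 : ∀ j, (2 : ℝ) ^ (N j).card ≤ Real.exp (lam / al) := by
        intro j
        have hcard := card_neighbours_le hmin hal hW (hs j)
        calc (2 : ℝ) ^ (N j).card ≤ Real.exp 1 ^ (N j).card := by
              have := Real.add_one_le_exp (1 : ℝ)
              exact pow_le_pow_left₀ (by norm_num) (by linarith) _
          _ = Real.exp (N j).card := by rw [← Real.exp_nat_mul, mul_one]
          _ ≤ _ := Real.exp_le_exp.2 hcard
      have hE := Real.exp_pos (lam / al)
      calc _ ≤ ∑ j, Real.exp (lam / al) * (2 * ∑ i, R.W i j) :=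
            Finset.sum_le_sum fun j _ => mul_le_mul_of_nonneg_right (h3 j)
              (mul_nonneg two_pos.le (Finset.sum_nonneg fun i _ => hW i j))
        _ = 2 * Real.exp (lam / al) * ∑ j, ∑ i, R.W i j := by
            rw [← Finset.mul_sum, ← Finset.mul_sum]; ring
        _ ≤ 2 * Real.exp (lam / al) * (n * lam) :=
            mul_le_mul_of_nonneg_left (sum_W_le hsp) (by positivity)
        -- Room given away by `1 ≤ lam / al`, to match the formula of `radVal`.
        _ ≤ 2 * Real.exp (lam / al) * (n * (lam * lam / al)) := by
            refine mul_le_mul_of_nonneg_left (mul_le_mul_of_nonneg_left ?_ (Nat.cast_nonneg n))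
              (by positivity)
            rw [le_div_iff₀ hal]
            exact mul_le_mul_of_nonneg_left hlam (hal.le.trans hlam)
        _ = _ := by ring
    have h3 := abs_logOdds_le hW hbe hsp hbal x0
    rw [radVal]; linarith
  refine ⟨fun j => if L.idxOf (L.getD j ∅) = j then C (L.getD j ∅) else 0, ?_, fun x => ?_⟩
  · refine le_trans (le_of_eq ?_) hsum
    rw [← sum_getD_eq (fun A => |C A|) fun A hA => by rw [hCL A hA, abs_zero]]
    refine Finset.sum_congr rfl fun j _ => ?_
    by_cases h : L.idxOf (L.getD j ∅) = j
    · simp only [if_pos h]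
    · simp only [if_neg h, abs_zero]
  · rw [hrep, ← sum_getD_eq (fun A => C A * monom A x) fun A hA => by rw [hCL A hA, zero_mul]]
    refine Finset.sum_congr rfl fun j _ => ?_
    by_cases h : L.idxOf (L.getD j ∅) = j
    · simp only [if_pos h]
    · simp only [if_neg h, zero_mul]

end RBMLearn

namespace RBMLearn

/-! ### The sample size -/

/-- The scale of the sample size. -/
noncomputable def qVal (lam al be : ℝ) : ℝ := Real.exp (20 * lam) / (al ^ 4 * be ^ 2)

section Scale

variable {lam al be : ℝ}

theorem thrVal_pos (hal : 0 < al) (hbe : 0 < be) (lam : ℝ) : 0 < thrVal lam al be := by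
  have := Real.exp_pos (-(10 * lam)); rw [thrVal]; positivity

/-- Hence at most `64 * qVal lam al be` units are selected for any `u`, and `qVal` can measure every
other quantity too. -/
theorem one_div_thrVal_sq (hal : 0 < al) (hbe : 0 < be) (lam : ℝ) :
    1 / thrVal lam al be ^ 2 = 64 * qVal lam al be := by
  have h1 : Real.exp (20 * lam) = (Real.exp (-(10 * lam)) ^ 2)⁻¹ := by
    rw [← Real.exp_nat_mul, ← Real.exp_neg]; congr 1; push_cast; ring
  have := Real.exp_pos (-(10 * lam))
  rw [qVal, thrVal, h1]
  field_simp
  norm_num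

theorem pow_le_exp_mul (hal : 0 < al) (hlam : al ≤ lam) (k : ℕ) (hk : k ≤ 20) :
    lam ^ k ≤ Real.exp (20 * lam) := by
  have hl : 0 < lam := hal.trans_le hlam
  calc lam ^ k ≤ Real.exp lam ^ k :=
        pow_le_pow_left₀ hl.le (by linarith [Real.add_one_le_exp lam]) k
    _ = Real.exp (k * lam) := (Real.exp_nat_mul _ _).symm
    _ ≤ _ := Real.exp_le_exp.2 (mul_le_mul_of_nonneg_right (by exact_mod_cast hk) hl.le)

theorem four_le_qVal (hal : 0 < al) (hlam : al ≤ lam) (hbe : 0 < be) (hbe2 : be ≤ 1 / 2) :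
    4 ≤ qVal lam al be := by
  rw [qVal, le_div_iff₀ (by positivity)]
  have h1 := pow_le_exp_mul hal hlam 4 (by norm_num)
  have h2 : al ^ 4 ≤ lam ^ 4 := pow_le_pow_left₀ hal.le hlam 4
  have h3 : be ^ 2 ≤ (1 / 2) ^ 2 := pow_le_pow_left₀ hbe.le hbe2 2
  have h4 : 0 < al ^ 4 := by positivity
  nlinarith

theorem lam_le_qVal (hal : 0 < al) (hlam : al ≤ lam) (hbe : 0 < be) (hbe2 : be ≤ 1 / 2) :
    lam ≤ qVal lam al be := by
  have hl : 0 < lam := hal.trans_le hlam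
  rw [qVal, le_div_iff₀ (by positivity)]
  refine le_trans ?_ (pow_le_exp_mul hal hlam 5 (by norm_num))
  have h2 : al ^ 4 ≤ lam ^ 4 := pow_le_pow_left₀ hal.le hlam 4
  have h3 : be ^ 2 ≤ 1 := pow_le_one₀ hbe.le (by linarith)
  calc lam * (al ^ 4 * be ^ 2) ≤ lam * (lam ^ 4 * 1) := by gcongr
    _ = lam ^ 5 := by ring

theorem one_div_be_le_qVal (hal : 0 < al) (hlam : al ≤ lam) (hbe : 0 < be) (hbe2 : be ≤ 1 / 2) :
    1 / be ≤ qVal lam al be := by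
  rw [qVal, div_le_div_iff₀ hbe (by positivity)]
  have h1 := pow_le_exp_mul hal hlam 4 (by norm_num)
  have h2 : al ^ 4 ≤ lam ^ 4 := pow_le_pow_left₀ hal.le hlam 4
  calc 1 * (al ^ 4 * be ^ 2) = al ^ 4 * be * be := by ring
    _ ≤ Real.exp (20 * lam) * 1 * be := by gcongr <;> linarith
    _ = _ := by ring

theorem lam_div_le_qVal (hal : 0 < al) (hlam : al ≤ lam) (hbe : 0 < be) (hbe2 : be ≤ 1 / 2) :
    lam / al ≤ qVal lam al be := by
  have hl : 0 < lam := hal.trans_le hlam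
  rw [qVal, div_le_div_iff₀ hal (by positivity)]
  have h1 := pow_le_exp_mul hal hlam 4 (by norm_num)
  have h3 : be ^ 2 ≤ 1 := pow_le_one₀ hbe.le (by linarith)
  calc lam * (al ^ 4 * be ^ 2) = lam * al ^ 3 * be ^ 2 * al := by ring
    _ ≤ lam * lam ^ 3 * 1 * al := by gcongr
    _ = lam ^ 4 * al := by ring
    _ ≤ _ := mul_le_mul_of_nonneg_right h1 hal.le

/-- The choice of exponents 20, 5 and 10 makes the right side `qVal` times `(lam / al) * (1 / be) ^
8`, and this factor is at least 2⁸ because `be ≤ 1 / 2`. -/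
theorem qVal_le_exponent (hal : 0 < al) (hlam : al ≤ lam) (hbe : 0 < be) (hbe2 : be ≤ 1 / 2) :
    130 * qVal lam al be ≤ lam * (Real.exp (20 * lam) * (1 / al) ^ 5 * (1 / be) ^ 10) := by
  have hl : 0 < lam := hal.trans_le hlam
  have h1 : lam * (Real.exp (20 * lam) * (1 / al) ^ 5 * (1 / be) ^ 10) =
      qVal lam al be * ((lam / al) * (1 / be) ^ 8) := by
    rw [qVal]; field_simp
  have hQ := four_le_qVal hal hlam hbe hbe2
  have h2 : 1 ≤ lam / al := (one_le_div hal).2 hlam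
  have h3 : (2 : ℝ) ^ 8 ≤ (1 / be) ^ 8 :=
    pow_le_pow_left₀ two_pos.le (by rw [le_div_iff₀ hbe]; linarith) 8
  rw [h1, mul_comm]
  refine mul_le_mul_of_nonneg_left ?_ (by linarith)
  nlinarith

/-- The factor 5 is 2 + 1 + 2: each ingredient of the three terms of `radVal` is at most exp of
`qVal`. -/
theorem radVal_le (hal : 0 < al) (hlam : al ≤ lam) (hbe : 0 < be) (hbe2 : be ≤ 1 / 2) {n : ℕ}
    (hn : 1 ≤ n) : radVal n lam al be ≤ 5 * n * Real.exp (qVal lam al be) ^ 3 := by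
  have hl : 0 < lam := hal.trans_le hlam
  have hn' : (1 : ℝ) ≤ n := by exact_mod_cast hn
  have h1 := lam_le_qVal hal hlam hbe hbe2
  have h2 := one_div_be_le_qVal hal hlam hbe hbe2
  have h3 := lam_div_le_qVal hal hlam hbe hbe2
  have hQ := four_le_qVal hal hlam hbe hbe2
  set Q := qVal lam al be
  have hX : Q ≤ Real.exp Q := by linarith [Real.add_one_le_exp Q]
  set X := Real.exp Q
  have h4 : Real.exp (lam / al) ≤ X := Real.exp_le_exp.2 h3
  have h5 : lam * lam / al ≤ X * X := by
    rw [mul_div_assoc]; exact mul_le_mul (h1.trans hX) (h3.trans hX) (by positivity) (by linarith)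
  have h6 : lam * lam / al * Real.exp (lam / al) ≤ X * X * X :=
    mul_le_mul h5 h4 (Real.exp_pos _).le (by positivity)
  have hX1 : 1 ≤ X := by linarith
  have h7 : X ≤ X ^ 3 := le_self_pow₀ hX1 (by norm_num)
  have h8 : n * lam ≤ n * X ^ 3 := by gcongr; linarith
  have h9 : n * (lam * lam / al * Real.exp (lam / al)) ≤ n * (X * X * X) := by gcongr
  have h10 : 1 / be ≤ n * X ^ 3 := by nlinarith
  rw [radVal]
  nlinarith

theorem two_le_radVal (hal : 0 < al) (hlam : al ≤ lam) (hbe : 0 < be) (hbe2 : be ≤ 1 / 2) (n : ℕ) :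
    2 ≤ radVal n lam al be := by
  have hl : 0 < lam := hal.trans_le hlam
  have h1 : 2 ≤ 1 / be := by rw [le_div_iff₀ hbe]; linarith
  have h2 : 0 ≤ 2 * n * lam + 2 * n * (lam * lam / al) * Real.exp (lam / al) := by
    have := Real.exp_pos (lam / al); positivity
  rw [radVal]; linarith

end Scale

/-- Keeps the logarithm in the sample size away from zero; for `n = 1` this needs the restriction on
`del`. -/
theorem log_div_ge {n : ℕ} {del : ℝ} (hn : 1 ≤ n) (hd : 0 < del) (hd1 : del < 1)
    (h1 : n = 1 → del ≤ 1 / 2) : Real.log 2 ≤ Real.log (n / del) := by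
  refine Real.log_le_log two_pos ?_
  rw [le_div_iff₀ hd]
  rcases eq_or_lt_of_le hn with h | h
  · have := h1 h.symm; rw [← h]; push_cast; linarith
  · have : (2 : ℝ) ≤ n := by exact_mod_cast h
    linarith

/-! ### The case with interactions -/

/-- The hypothesis computed from the learned features. -/
noncomputable def learnedHyp {n : ℕ} (z : ℕ → Example n) (m : ℕ) (lam al be eps : ℝ)
    (x : Fin n → ℤˣ) : ℝ :=
  ∑ j ∈ Finset.range (learnedFeats z m lam al be).length,
    egAcc (learnedFeats z m lam al be) (m / 2) (radVal n lam al be)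
      (etaVal eps (radVal n lam al be)) z m j / (m - (m / 2 : ℕ) : ℝ) *
      monom ((learnedFeats z m lam al be).getD j ∅) x

variable {n n₂ : ℕ} {R : SupervisedRBM n n₂} {lam al be eps del : ℝ} {m : ℕ}

theorem length_scan_le {z : ℕ → Example n} {M : ℕ} (hM : 0 < M) {th : ℝ} (hth : 0 < th) (u : Fin n)
    {k : ℕ} (hk : k ≤ n) : (scan z M (th * M) u k).2.length ≤ 2 ^ (⌊1 / th ^ 2⌋₊ + 1) := by
  rw [length_scan k hk]
  refine Nat.pow_le_pow_right two_pos ?_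
  have := card_scan_le (z := z) (u := u) hM hth k
  split_ifs <;> omega

theorem length_feats_le_pow {z : ℕ → Example n} {M : ℕ} (hM : 0 < M) {th : ℝ} (hth : 0 < th)
    (k : ℕ) : (feats z M (th * M) k).length ≤ 1 + k * 2 ^ (⌊1 / th ^ 2⌋₊ + 1) :=
  length_feats_le (fun u => length_scan_le hM hth u le_rfl) k

/-- Off the exceptional events, the excess risk is small. -/
theorem learnedHyp_risk_le (hal : 0 < al) (hlam : al ≤ lam) (hbe : 0 < be) (hbe2 : be ≤ 1 / 2)
    (heps : 0 < eps) (heps1 : eps < 1) (hmin : R.MinFerromagnetic al)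
    (hW : ∀ i j, 0 ≤ R.W i j) (hsp : ∀ i, ∑ j, R.W i j + |R.b₁ i| ≤ lam) {y : ℤˣ}
    (hs : ∀ j, ∑ i, R.W i j + |R.b₂ j + spin y * R.w j| ≤ lam) (hbal : ∀ y, be ≤ R.labelProb y)
    (hm : 2 ≤ m) {z : ℕ → Example n} {η : ℝ} (hη : 0 ≤ η)
    (hη' : 2 ^ (⌊1 / thrVal lam al be ^ 2⌋₊ + 1) * (4 * η) ≤ thrVal lam al be)
    (hnear : Near (empLaw z (m / 2)) (law R) (⌊1 / thrVal lam al be ^ 2⌋₊ + 2) η)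
    (hdev : ∑ t ∈ Finset.Ico (m / 2) m,
      (lawRisk (law R) (egHyp (learnedFeats z m lam al be) (m / 2) (radVal n lam al be)
        (etaVal eps (radVal n lam al be)) z t) - lawRisk (law R) (logOdds R) -
      (logisticLoss (egHyp (learnedFeats z m lam al be) (m / 2) (radVal n lam al be)
        (etaVal eps (radVal n lam al be)) z t (z t).1) (z t).2 -
        logisticLoss (logOdds R (z t).1) (z t).2)) ≤ eps * (m - m / 2 : ℕ) / 2)
    (hreg : 64 * radVal n lam al be ^ 2 * Real.log (2 * (learnedFeats z m lam al be).length) ≤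
      (m - m / 2 : ℕ) * eps ^ 2) (g : (Fin n → ℤˣ) → ℝ) :
    lawRisk (law R) (learnedHyp z m lam al be eps) - lawRisk (law R) g ≤ eps := by
  have hM : 0 < m / 2 := by omega
  have hMm : m / 2 < m := by omega
  have hth := thrVal_pos (be := be) hal hbe lam
  set L := learnedFeats z m lam al be with hL
  set rad := radVal n lam al be with hrad
  have hrad2 : 2 ≤ rad := two_le_radVal hal hlam hbe hbe2 n
  have h0 : ∅ ∈ L := empty_mem_feats n
  -- All members of `A` share the hidden unit `j`. Fix one of them, `u`; the others are selected for
  -- `u`, so `A` is among the subsets listed for `u`.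
  have hsel : ∀ (j : Fin n₂) (A : Finset (Fin n)), (∀ i ∈ A, R.W i j ≠ 0) → A ∈ L := by
    intro j A hA
    rcases A.eq_empty_or_nonempty with rfl | ⟨u, hu⟩
    · exact h0
    refine mem_feats u.2 (mem_scan_of_subset n le_rfl ?_)
    rw [if_pos u.2]
    intro v hv
    rw [Finset.mem_insert]
    by_cases huv : v = u
    · exact Or.inl huv
    · right
      refine mem_scan_of_near hM (law_nonneg R) hth hη hη' hnear huv fun S huS hvS => ?_
      exact lawStat_ge hW hal hlam hsp hs (hbal y) huv ((hmin u j).resolve_left (hA u hu))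
        ((hmin v j).resolve_left (hA v hv)) S huS hvS
  obtain ⟨c, hc, hrep⟩ := exists_logOdds_coeff hal hlam hbe hmin hW hsp
    (fun j => by linarith [hs j, abs_nonneg (R.b₂ j + spin y * R.w j)]) hbal h0 hsel
  have hLpos : 0 < L.length := List.length_pos_of_mem h0
  have heta : 0 < etaVal eps rad := by rw [etaVal]; positivity
  have heta1 : 2 * etaVal eps rad ≤ 1 := by
    rw [etaVal, ← mul_div_assoc, div_le_one (by positivity)]; linarith
  have key := eg_risk_le (law_nonneg R) hLpos (by linarith) heta heta1 hMm hc hrep hdev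
  have h1 := lawRisk_logOdds_le R g
  have hm' : (0 : ℝ) < (m - m / 2 : ℕ) := by exact_mod_cast (by omega : 0 < m - m / 2)
  -- The step size makes the second regret term a quarter of the allowed total, and `hreg` makes the
  -- first at most another quarter; the deviation takes the remaining half.
  have h2 : rad * Real.log (2 * L.length) / etaVal eps rad + 4 * rad * etaVal eps rad * (m - m / 2 : ℕ) ≤
      eps * (m - m / 2 : ℕ) / 2 := by
    have e1 : rad * Real.log (2 * L.length) / etaVal eps rad =
        (64 * rad ^ 2 * Real.log (2 * L.length)) / (4 * eps) := by
      rw [etaVal]; field_simp; ring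
    have e2 : 4 * rad * etaVal eps rad * (m - m / 2 : ℕ) = eps * (m - m / 2 : ℕ) / 4 := by
      rw [etaVal]; field_simp; norm_num
    have e3 : (64 * rad ^ 2 * Real.log (2 * L.length)) / (4 * eps) ≤ eps * (m - m / 2 : ℕ) / 4 := by
      rw [div_le_iff₀ (by positivity)]
      refine hreg.trans (le_of_eq (by ring))
    rw [e1, e2]; linarith
  have h3 : (m - m / 2 : ℕ) * (lawRisk (law R) (learnedHyp z m lam al be eps) -
      lawRisk (law R) (logOdds R)) ≤ (m - m / 2 : ℕ) * eps := by
    refine key.trans ?_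
    linarith
  have h4 := le_of_mul_le_mul_left h3 hm'
  linarith

/-- The sample size suffices for the structure to be learned. -/
theorem structure_failure_le (hal : 0 < al) (hlam : al ≤ lam) (hbe : 0 < be) (hbe2 : be ≤ 1 / 2)
    (hn : 1 ≤ n) (hd : 0 < del) (hd1 : del < 1) (hdn : n = 1 → del ≤ 1 / 2)
    (hm : 10 ^ 8 * (n : ℝ) ^ 2 * Real.exp (qVal lam al be) ^ 130 * Real.log (n / del) ≤ m)
    {T : ℕ} (hT : (T : ℝ) ≤ 64 * qVal lam al be) {M : ℕ} (hM : (m : ℝ) / 4 ≤ M) :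
    ((2 * n + 1) ^ (T + 2) * 2 : ℕ) *
      (2 * Real.exp (-((thrVal lam al be / (8 * 2 ^ T) * M) ^ 2 / (2 * m)))) ≤ del / 2 := by
  have hn' : (1 : ℝ) ≤ n := by exact_mod_cast hn
  set lg := Real.log (n / del) with hlg
  have hlg2 : Real.log 2 ≤ lg := log_div_ge hn hd hd1 hdn
  have hlg0 : 0 < lg := (Real.log_pos one_lt_two).trans_le hlg2
  set Y := n / del with hY
  have hYpos : 0 < Y := by positivity
  have hY2 : 2 ≤ Y := (Real.log_le_log_iff two_pos hYpos).1 hlg2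
  have hYexp : Real.exp lg = Y := Real.exp_log hYpos
  have hnY : (n : ℝ) ≤ Y := by rw [hY, le_div_iff₀ hd]; nlinarith
  have hdY : 1 / del ≤ Y := div_le_div_of_nonneg_right hn' hd.le
  have hQ := four_le_qVal hal hlam hbe hbe2
  have hth := thrVal_pos (be := be) hal hbe lam
  have hthQ := one_div_thrVal_sq (be := be) hal hbe lam
  set θ := thrVal lam al be
  set Q := qVal lam al be
  have hXQ : Q ≤ Real.exp Q := by linarith [Real.add_one_le_exp Q]
  have hTX : (4 : ℝ) ^ T ≤ Real.exp Q ^ 128 := by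
    have e1 := Real.add_one_le_exp (1 : ℝ)
    calc (4 : ℝ) ^ T = (2 ^ 2) ^ T := by norm_num
      _ ≤ (Real.exp 1 ^ 2) ^ T := by gcongr; linarith
      _ = Real.exp (2 * T) := by
          rw [← pow_mul, ← Real.exp_nat_mul]; congr 1; push_cast; ring
      _ ≤ Real.exp (128 * Q) := Real.exp_le_exp.2 (by linarith)
      _ = _ := by rw [← Real.exp_nat_mul]; norm_num
  set X := Real.exp Q
  have hX0 : 0 < X := by linarith
  have hmpos : (0 : ℝ) < m := lt_of_lt_of_le (by positivity) hm
  set D := (θ / (8 * 2 ^ T) * M) ^ 2 / (2 * m) with hD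
  have hθ2 : θ ^ 2 = 1 / (64 * Q) := by rw [← hthQ]; field_simp
  -- With `Y = n / del`, each of the `T + 2` factors `2 * n + 1` is at most `Y ^ 3`, and `8 / del`
  -- is at most `Y ^ 4`; this gives the exponent 3(T + 2) + 4.
  have hDge : (3 * T + 10) * lg ≤ D := by
    have d1 : θ ^ 2 / (64 * 4 ^ T) * m / 32 ≤ D := by
      have : (θ / (8 * 2 ^ T) * (m / 4)) ^ 2 / (2 * m) ≤ D := by rw [hD]; gcongr
      refine le_trans (le_of_eq ?_) this
      have e4 : (4 : ℝ) ^ T = 2 ^ T * 2 ^ T := by rw [← mul_pow]; norm_num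
      rw [e4]; field_simp; norm_num
    have d2 : 1 / (64 * Q) / (64 * X ^ 128) * m / 32 ≤ θ ^ 2 / (64 * 4 ^ T) * m / 32 := by
      rw [hθ2]; gcongr
    have d3 : 10 ^ 8 * X ^ 130 * lg ≤ m := by
      refine le_trans ?_ hm
      have : 1 ≤ (n : ℝ) ^ 2 := one_le_pow₀ hn'
      have h0 : 0 ≤ 10 ^ 8 * X ^ 130 * lg := by positivity
      nlinarith
    have d4 : 1 / (64 * Q) / (64 * X ^ 128) * (10 ^ 8 * X ^ 130 * lg) / 32 ≤
        1 / (64 * Q) / (64 * X ^ 128) * m / 32 := by gcongr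
    -- The constants 64, 64 and 32 multiply to 131072, and 10⁸ divided by this exceeds 762. The two
    -- spare powers of `X` absorb `Q`.
    have d5 : 762 * Q * lg ≤ 1 / (64 * Q) / (64 * X ^ 128) * (10 ^ 8 * X ^ 130 * lg) / 32 := by
      have e5 : 1 / (64 * Q) / (64 * X ^ 128) * (10 ^ 8 * X ^ 130 * lg) / 32 =
          (10 ^ 8 / 131072) * X ^ 2 / Q * lg := by
        field_simp; norm_num
      rw [e5]
      refine mul_le_mul_of_nonneg_right ?_ hlg0.le
      rw [le_div_iff₀ (by linarith)]
      nlinarith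
    have d6 : (3 * T + 10) * lg ≤ 762 * Q * lg :=
      mul_le_mul_of_nonneg_right (by linarith) hlg0.le
    linarith
  have hpow : (2 * n + 1 : ℝ) ≤ Y ^ 3 := by
    have : Y ^ 3 = Y * Y * Y := by ring
    rw [this]
    have : 2 * 2 ≤ Y * Y := mul_le_mul hY2 hY2 two_pos.le hYpos.le
    nlinarith
  have h8 : 8 / del ≤ Y ^ 4 := by
    have e1 : (2 : ℝ) ^ 3 ≤ Y ^ 3 := pow_le_pow_left₀ two_pos.le hY2 3
    calc 8 / del = 2 ^ 3 * (1 / del) := by ring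
      _ ≤ Y ^ 3 * Y := mul_le_mul e1 hdY (by positivity) (by positivity)
      _ = Y ^ 4 := by ring
  have hfin : (2 * n + 1 : ℝ) ^ (T + 2) * (8 / del) ≤ Real.exp D := by
    calc (2 * n + 1 : ℝ) ^ (T + 2) * (8 / del) ≤ (Y ^ 3) ^ (T + 2) * Y ^ 4 := by gcongr
      _ = Real.exp ((3 * T + 10) * lg) := by
          rw [← pow_mul, ← pow_add, ← hYexp, ← Real.exp_nat_mul]; congr 1; push_cast; ring
      _ ≤ _ := Real.exp_le_exp.2 hDge
  push_cast
  rw [Real.exp_neg]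
  have hE := Real.exp_pos D
  rw [← div_eq_mul_inv, ← mul_div_assoc, div_le_iff₀ hE]
  calc (2 * n + 1 : ℝ) ^ (T + 2) * 2 * 2 = (2 * n + 1 : ℝ) ^ (T + 2) * (8 / del) * (del / 2) := by
        field_simp; norm_num
    _ ≤ Real.exp D * (del / 2) := mul_le_mul_of_nonneg_right hfin (by positivity)
    _ = _ := by ring

end RBMLearn

/-! ### Failure probabilities and the success of both predictors -/

namespace RBMLearn

variable {n n₂ : ℕ} {R : SupervisedRBM n n₂} {lam al be eps del : ℝ} {m : ℕ}

theorem eps_sq_le (heps : 0 < eps) (heps1 : eps < 1) {a : ℝ} (h : a ≤ m * eps ^ 2) : a ≤ m := by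
  have h1 : eps ^ 2 ≤ 1 := pow_le_one₀ heps.le heps1.le
  have h2 : (0 : ℝ) ≤ m := Nat.cast_nonneg m
  nlinarith

/-- The lists of monomials fit into the memory. -/
theorem length_bound (hal : 0 < al) (hlam : al ≤ lam) (hbe : 0 < be) (hbe2 : be ≤ 1 / 2)
    (heps : 0 < eps) (heps1 : eps < 1) (hn : 1 ≤ n) (hd : 0 < del) (hd1 : del < 1)
    (hdn : n = 1 → del ≤ 1 / 2)
    (hm : 10 ^ 8 * (n : ℝ) ^ 2 * Real.exp (qVal lam al be) ^ 130 * Real.log (n / del) ≤ m * eps ^ 2) :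
    33 + n * 2 ^ (⌊1 / thrVal lam al be ^ 2⌋₊ + 1) ≤ m := by
  have hn' : (1 : ℝ) ≤ n := by exact_mod_cast hn
  have hm := eps_sq_le heps heps1 hm
  have hlg2 := log_div_ge hn hd hd1 hdn
  have hl2 := Real.log_two_gt_d9
  have hQ := four_le_qVal hal hlam hbe hbe2
  have hT : (⌊1 / thrVal lam al be ^ 2⌋₊ : ℝ) ≤ 64 * qVal lam al be := by
    rw [← one_div_thrVal_sq hal hbe]; exact Nat.floor_le (by positivity)
  set T := ⌊1 / thrVal lam al be ^ 2⌋₊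
  set Q := qVal lam al be
  have hX1 : 1 ≤ Real.exp Q := Real.one_le_exp (by linarith)
  have hTX : (2 : ℝ) ^ T ≤ Real.exp Q ^ 130 := by
    have e1 := Real.add_one_le_exp (1 : ℝ)
    calc (2 : ℝ) ^ T ≤ Real.exp 1 ^ T := by gcongr; linarith
      _ = Real.exp T := by rw [← Real.exp_nat_mul, mul_one]
      _ ≤ Real.exp (130 * Q) := Real.exp_le_exp.2 (by linarith)
      _ = _ := by rw [← Real.exp_nat_mul]; norm_num
  set X := Real.exp Q ^ 130
  have hX : 1 ≤ X := one_le_pow₀ hX1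
  have h1 : 10 ^ 8 * (n : ℝ) * X * (1 / 2) ≤ m := by
    refine le_trans ?_ hm
    have : (n : ℝ) ≤ n ^ 2 := le_self_pow₀ hn' two_ne_zero
    have h0 : 0 ≤ X := by linarith
    calc 10 ^ 8 * (n : ℝ) * X * (1 / 2) ≤ 10 ^ 8 * (n : ℝ) ^ 2 * X * (1 / 2) := by gcongr
      _ ≤ _ := mul_le_mul_of_nonneg_left (by linarith) (by positivity)
  have h2 : (n : ℝ) * 2 ^ (T + 1) ≤ 2 * (n * X) := by
    rw [pow_succ]; nlinarith
  have h3 : 1 ≤ n * X := by nlinarith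
  have : (33 : ℝ) + n * 2 ^ (T + 1) ≤ m := by nlinarith
  exact_mod_cast this

theorem two_div_le_exp (hn : 1 ≤ n) (hd : 0 < del) (hd1 : del < 1) (hdn : n = 1 → del ≤ 1 / 2) :
    2 / del ≤ Real.exp (2 * Real.log (n / del)) := by
  have hn' : (1 : ℝ) ≤ n := by exact_mod_cast hn
  have hY2 : 2 ≤ n / del :=
    (Real.log_le_log_iff two_pos (by positivity)).1 (log_div_ge hn hd hd1 hdn)
  have hdY : 1 / del ≤ n / del := div_le_div_of_nonneg_right hn' hd.le
  have hYexp : Real.exp (Real.log (n / del)) = n / del := Real.exp_log (by positivity)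
  calc 2 / del = 2 * (1 / del) := by ring
    _ ≤ (n / del) * (n / del) := mul_le_mul hY2 hdY (by positivity) (by positivity)
    _ = _ := by
      nth_rewrite 1 2 [← hYexp]
      rw [← Real.exp_add]; congr 1; ring

/-- Twice the logarithm in the exponent is enough, because `(n / del) ^ 2` is at least `2 / del`. -/
theorem deviation_failure_le (heps : 0 < eps) (hm : 0 < m) {rad : ℝ} (hrad : 0 < rad) (hn : 1 ≤ n)
    (hd : 0 < del) (hd1 : del < 1) (hdn : n = 1 → del ≤ 1 / 2)
    (h4 : 4000000 * (rad ^ 2 * Real.log (n / del)) ≤ m * eps ^ 2) :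
    Real.exp (-((eps * (m - m / 2 : ℕ) / 2) ^ 2 / (2 * m * (8 * rad) ^ 2))) ≤ del / 2 := by
  have hm0 : (0 : ℝ) < m := by exact_mod_cast hm
  have hm' : (m : ℝ) / 2 ≤ (m - m / 2 : ℕ) := by
    have : m ≤ 2 * (m - m / 2) := by omega
    have : (m : ℝ) ≤ 2 * (m - m / 2 : ℕ) := by exact_mod_cast this
    linarith
  have h2 := two_div_le_exp hn hd hd1 hdn
  have h3 : 0 ≤ rad ^ 2 * Real.log (n / del) :=
    mul_nonneg (sq_nonneg _) ((Real.log_nonneg one_le_two).trans (log_div_ge hn hd hd1 hdn))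
  set lg := Real.log (n / del)
  have h1 : 2 * lg ≤ (eps * (m - m / 2 : ℕ) / 2) ^ 2 / (2 * m * (8 * rad) ^ 2) := by
    have : (eps * (m / 2) / 2) ^ 2 / (2 * m * (8 * rad) ^ 2) ≤
        (eps * (m - m / 2 : ℕ) / 2) ^ 2 / (2 * m * (8 * rad) ^ 2) := by gcongr
    refine le_trans ?_ this
    rw [le_div_iff₀ (by positivity)]
    have h5 := mul_le_mul_of_nonneg_left h4 hm0.le
    have h6 := mul_nonneg hm0.le h3
    calc 2 * lg * (2 * m * (8 * rad) ^ 2) = 256 * (m * (rad ^ 2 * lg)) := by ring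
      _ ≤ 4000000 * (m * (rad ^ 2 * lg)) / 16 := by linarith
      _ ≤ m * (m * eps ^ 2) / 16 := by linarith
      _ = _ := by ring
  calc _ ≤ Real.exp (-(2 * lg)) := Real.exp_le_exp.2 (by linarith)
    _ = (Real.exp (2 * lg))⁻¹ := Real.exp_neg _
    _ ≤ (2 / del)⁻¹ := inv_anti₀ (by positivity) h2
    _ = del / 2 := by rw [inv_div]

theorem log_length_le (hn : 1 ≤ n) (hd : 0 < del) (hd1 : del < 1) (hdn : n = 1 → del ≤ 1 / 2)
    {N T : ℕ} (hN : 0 < N) (hl : N ≤ 1 + n * 2 ^ (T + 1)) :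
    Real.log (2 * N) ≤ (T + 4) * Real.log (n / del) := by
  have hn' : (1 : ℝ) ≤ n := by exact_mod_cast hn
  have hlg2 := log_div_ge hn hd hd1 hdn
  have e1 : (2 * N : ℝ) ≤ n / del * 2 ^ (T + 3) := by
    have h2 : (N : ℝ) ≤ 1 + n * 2 ^ (T + 1) := by exact_mod_cast hl
    have h3 : (n : ℝ) ≤ n / del := by rw [le_div_iff₀ hd]; nlinarith
    have h4 : (1 : ℝ) ≤ 2 ^ (T + 1) := one_le_pow₀ one_le_two
    have h5 : (2 : ℝ) ^ (T + 3) = 4 * 2 ^ (T + 1) := by ring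
    have h6 : (n : ℝ) * 2 ^ (T + 3) ≤ n / del * 2 ^ (T + 3) := by gcongr
    nlinarith
  have hN' : (0 : ℝ) < N := by exact_mod_cast hN
  refine (Real.log_le_log (by positivity) e1).trans ?_
  rw [Real.log_mul (by positivity) (by positivity), Real.log_pow]
  push_cast
  have : ((T : ℝ) + 3) * Real.log 2 ≤ (T + 3) * Real.log (n / del) := by gcongr
  linarith

/-- Two events can spoil the result: the first half of the sample misrepresents some condition on
few features, or the online losses deviate from the risks in the second half. Each has probability
at most `del / 2`. -/
theorem learned_success (hal : 0 < al) (hlam : al ≤ lam) (hbe : 0 < be) (hbe2 : be ≤ 1 / 2)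
    (heps : 0 < eps) (heps1 : eps < 1) (hn : 1 ≤ n) (hd : 0 < del) (hd1 : del < 1)
    (hdn : n = 1 → del ≤ 1 / 2) (hmin : R.MinFerromagnetic al)
    (hW : ∀ i j, 0 ≤ R.W i j) (hsp : ∀ i, ∑ j, R.W i j + |R.b₁ i| ≤ lam) {y : ℤˣ}
    (hs : ∀ j, ∑ i, R.W i j + |R.b₂ j + spin y * R.w j| ≤ lam) (hbal : ∀ y, be ≤ R.labelProb y)
    (hm : 10 ^ 8 * (n : ℝ) ^ 2 * Real.exp (qVal lam al be) ^ 130 * Real.log (n / del) ≤ m * eps ^ 2) :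
    1 - del ≤ iidProb (law R) {s : Fin m → Example n | ∀ g,
      lawRisk (law R) (learnedHyp (extend s) m lam al be eps) - lawRisk (law R) g ≤ eps} := by
  have hn' : (1 : ℝ) ≤ n := by exact_mod_cast hn
  have hlen := length_bound hal hlam hbe hbe2 heps heps1 hn hd hd1 hdn hm
  have hm33 : 33 ≤ m := by omega
  have hm0 : (0 : ℝ) < m := by exact_mod_cast (by omega : 0 < m)
  have hM : 0 < m / 2 := by omega
  have hM4 : (m : ℝ) / 4 ≤ (m / 2 : ℕ) := by
    have : m ≤ 4 * (m / 2) := by omega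
    have : (m : ℝ) ≤ 4 * (m / 2 : ℕ) := by exact_mod_cast this
    linarith
  have hm' : (m : ℝ) / 2 ≤ (m - m / 2 : ℕ) := by
    have : m ≤ 2 * (m - m / 2) := by omega
    have : (m : ℝ) ≤ 2 * (m - m / 2 : ℕ) := by exact_mod_cast this
    linarith
  have hth := thrVal_pos (be := be) hal hbe lam
  have hQ := four_le_qVal hal hlam hbe hbe2
  have hT : (⌊1 / thrVal lam al be ^ 2⌋₊ : ℝ) ≤ 64 * qVal lam al be := by
    rw [← one_div_thrVal_sq hal hbe]; exact Nat.floor_le (by positivity)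
  have hfail := structure_failure_le hal hlam hbe hbe2 hn hd hd1 hdn
    (eps_sq_le heps heps1 hm) hT hM4
  have hlg2 := log_div_ge hn hd hd1 hdn
  have hrad := radVal_le hal hlam hbe hbe2 hn
  have hrad2 := two_le_radVal hal hlam hbe hbe2 n
  set lg := Real.log (n / del) with hlg
  have hlg0 : 0 < lg := (Real.log_pos one_lt_two).trans_le hlg2
  set θ := thrVal lam al be with hθ
  set T := ⌊1 / θ ^ 2⌋₊ with hTdef
  set η := θ / (8 * 2 ^ T) with hη
  have hη0 : 0 ≤ η := by positivity
  have hη' : 2 ^ (T + 1) * (4 * η) ≤ θ := by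
    rw [hη, pow_succ]
    exact le_of_eq (by field_simp; norm_num)
  set rad := radVal n lam al be with hrd
  set Q := qVal lam al be
  have hXQ : Q ≤ Real.exp Q := by linarith [Real.add_one_le_exp Q]
  have hX1 : 1 ≤ Real.exp Q := by linarith
  set X := Real.exp Q
  have hrad3 : rad ^ 2 ≤ 25 * n ^ 2 * X ^ 6 := by
    have := pow_le_pow_left₀ (by linarith) hrad 2
    refine this.trans (le_of_eq (by ring))
  -- The constant 10⁸ is 4000000 times 25, the factor 25 coming from the square of the radius.
  have hbig : 4000000 * rad ^ 2 * X * lg ≤ m * eps ^ 2 := by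
    refine le_trans ?_ hm
    have h7 : X ^ 7 ≤ X ^ 130 := pow_le_pow_right₀ hX1 (by norm_num)
    calc 4000000 * rad ^ 2 * X * lg ≤ 4000000 * (25 * n ^ 2 * X ^ 6) * X * lg := by gcongr
      _ = 10 ^ 8 * n ^ 2 * X ^ 7 * lg := by ring
      _ ≤ _ := by gcongr
  have hbig' : 4000000 * (rad ^ 2 * lg) ≤ m * eps ^ 2 := by
    have : 0 ≤ rad ^ 2 * lg := by positivity
    nlinarith
  set E1 : Set (Fin m → Example n) := {s | ¬ Near (empLaw (extend s) (m / 2)) (law R) (T + 2) η}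
  have hE1 : iidProb (law R) E1 ≤ del / 2 :=
    (iidProb_not_near_le (law_nonneg R) (sum_law R) hM (Nat.div_le_self m 2) (T + 2) hη0).trans hfail
  set E2 : Set (Fin m → Example n) := {s | eps * (m - m / 2 : ℕ) / 2 ≤ ∑ t ∈ Finset.Ico (m / 2) m,
      (lawRisk (law R) (egHyp (learnedFeats (extend s) m lam al be) (m / 2) rad (etaVal eps rad)
        (extend s) t) - lawRisk (law R) (logOdds R) -
      (logisticLoss (egHyp (learnedFeats (extend s) m lam al be) (m / 2) rad (etaVal eps rad)
        (extend s) t (extend s t).1) (extend s t).2 -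
        logisticLoss (logOdds R (extend s t).1) (extend s t).2))} with hE2def
  have hE2 : iidProb (law R) E2 ≤ del / 2 := by
    have hu : ∀ x, |logOdds R x| ≤ rad := by
      intro x
      have h1 := abs_logOdds_le hW hbe hsp hbal x
      have h2 : 0 ≤ 2 * n * (lam * lam / al) * Real.exp (lam / al) := by
        have := Real.exp_pos (lam / al); have := hal.le.trans hlam; positivity
      rw [hrd, radVal]; linarith
    refine (eg_deviation (law_nonneg R) (sum_law R) (rad := rad) (eta := etaVal eps rad) (by linarith)
      (Lf := fun z => learnedFeats z m lam al be)
      (fun z => List.length_pos_of_mem (empty_mem_feats n)) (fun z z' h => feats_congr h n) (by omega)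
      hu (a := eps * (m - m / 2 : ℕ) / 2) (by positivity)).trans ?_
    exact deviation_failure_le heps (by omega) (by linarith) hn hd hd1 hdn hbig'
  have hsub : {s : Fin m → Example n | ∀ g,
      lawRisk (law R) (learnedHyp (extend s) m lam al be eps) - lawRisk (law R) g ≤ eps}ᶜ ⊆
      E1 ∪ E2 := by
    intro s hs'
    by_contra hcon
    rw [Set.mem_union, not_or] at hcon
    obtain ⟨c1, c2⟩ := hcon
    have c1 : Near (empLaw (extend s) (m / 2)) (law R) (T + 2) η := not_not.1 c1
    rw [hE2def, Set.mem_ofPred_eq, not_le] at c2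
    have c2 := c2.le
    refine hs' fun g => learnedHyp_risk_le hal hlam hbe hbe2 heps heps1 hmin hW hsp hs hbal
      (by omega) hη0 hη' c1 c2 ?_ g
    have hl := length_feats_le_pow (z := extend s) hM hth n
    change (learnedFeats (extend s) m lam al be).length ≤ _ at hl
    have hl0 : 0 < (learnedFeats (extend s) m lam al be).length :=
      List.length_pos_of_mem (empty_mem_feats n)
    set N := (learnedFeats (extend s) m lam al be).length
    have h1 : Real.log (2 * N) ≤ (T + 4) * lg := log_length_le hn hd hd1 hdn hl0 hl
    have h2 : ((T : ℝ) + 4) * lg ≤ 65 * X * lg := by gcongr; linarith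
    have h3 : 64 * rad ^ 2 * Real.log (2 * N) ≤ 64 * rad ^ 2 * (65 * X * lg) := by
      exact mul_le_mul_of_nonneg_left (h1.trans h2) (by positivity)
    have h4 : (m : ℝ) / 2 * eps ^ 2 ≤ (m - m / 2 : ℕ) * eps ^ 2 := by gcongr
    have h5 : 0 ≤ rad ^ 2 * X * lg := by positivity
    calc _ ≤ 64 * rad ^ 2 * (65 * X * lg) := h3
      _ ≤ (m : ℝ) / 2 * eps ^ 2 := by linarith
      _ ≤ _ := h4
  have hc := iidProb_add_compl (sum_law R) {s : Fin m → Example n | ∀ g,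
      lawRisk (law R) (learnedHyp (extend s) m lam al be eps) - lawRisk (law R) g ≤ eps}
  have := (iidProb_mono (law_nonneg R) hsub).trans (iidProb_union_le (law_nonneg R) E1 E2)
  linarith

/-! ### The case without interactions -/

/-- The constant prediction for a label that is `1` with probability `q`. -/
noncomputable def constHyp (q : ℝ) : ℝ := Real.log (q / (1 - q)) / 2

theorem lawRisk_const (v : ℝ) : lawRisk (law R) (fun _ => v) =
    R.labelProb 1 * logisticLoss v 1 + R.labelProb (-1) * logisticLoss v (-1) := by
  rw [lawRisk, Fintype.sum_prod_type, Finset.sum_comm, sum_units, SupervisedRBM.labelProb,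
    SupervisedRBM.labelProb, Finset.sum_mul, Finset.sum_mul]
  rfl

theorem logisticLoss_constHyp {q : ℝ} (h0 : 0 < q) (h1 : q < 1) :
    logisticLoss (constHyp q) 1 = -Real.log q ∧ logisticLoss (constHyp q) (-1) = -Real.log (1 - q) := by
  have h2 : 0 < 1 - q := by linarith
  constructor
  · rw [logisticLoss, constHyp, spin_one,
      show -2 * (Real.log (q / (1 - q)) / 2) * 1 = -Real.log (q / (1 - q)) by ring, Real.exp_neg,
      Real.exp_log (by positivity), ← Real.log_inv]
    congr 1; field_simp; ring
  · rw [logisticLoss, constHyp, spin_neg, spin_one,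
      show -2 * (Real.log (q / (1 - q)) / 2) * -1 = Real.log (q / (1 - q)) by ring,
      Real.exp_log (by positivity), ← Real.log_inv]
    congr 1; field_simp; ring

/-- The divergence of two laws on two points. -/
theorem binary_divergence_le {p q : ℝ} (hp0 : 0 < p) (hp1 : p < 1) (hq0 : 0 < q) (hq1 : q < 1) :
    p * (Real.log p - Real.log q) + (1 - p) * (Real.log (1 - p) - Real.log (1 - q)) ≤
      (p - q) ^ 2 / (q * (1 - q)) := by
  have hp2 : 0 < 1 - p := by linarith
  have hq2 : 0 < 1 - q := by linarith
  have h1 := Real.log_le_sub_one_of_pos (div_pos hp0 hq0)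
  have h2 := Real.log_le_sub_one_of_pos (div_pos hp2 hq2)
  rw [Real.log_div hp0.ne' hq0.ne'] at h1
  rw [Real.log_div hp2.ne' hq2.ne'] at h2
  have e : (p - q) ^ 2 / (q * (1 - q)) = p * (p / q - 1) + (1 - p) * ((1 - p) / (1 - q) - 1) := by
    field_simp; ring
  rw [e]
  exact add_le_add (mul_le_mul_of_nonneg_left h1 hp0.le) (mul_le_mul_of_nonneg_left h2 hp2.le)

theorem labelProb_pos (y : ℤˣ) : 0 < R.labelProb y :=
  Finset.sum_pos (fun x _ => obsProb_pos R x y) Finset.univ_nonempty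

/-- No hidden unit sees the features, so the odds are constant in `x` and agree with the odds of the
label probabilities. -/
theorem logOdds_of_W_eq_zero (hW : ∀ i j, R.W i j = 0) (x : Fin n → ℤˣ) :
    logOdds R x = constHyp (R.labelProb 1) := by
  have hc : ∀ x' : Fin n → ℤˣ, logOdds R x' = logOdds R x := fun x' => by
    rw [logOdds_eq, logOdds_eq]
    congr 1
    exact Finset.sum_congr rfl fun j _ => hiddenOdds_congr fun i hi => absurd (hW i j) hi
  have h1 : R.labelProb 1 = Real.exp (2 * logOdds R x) * R.labelProb (-1) := by
    rw [SupervisedRBM.labelProb, SupervisedRBM.labelProb, Finset.mul_sum]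
    refine Finset.sum_congr rfl fun x' _ => ?_
    rw [← hc x', exp_logOdds, div_mul_cancel₀ _ (obsProb_pos R _ _).ne']
  have h2 := labelProb_add (R := R)
  have h3 := labelProb_pos (R := R) (-1)
  rw [constHyp, show 1 - R.labelProb 1 = R.labelProb (-1) by linarith, h1,
    mul_div_cancel_right₀ _ h3.ne', Real.log_exp]
  ring

/-- The excess loss of a constant is a Kullback–Leibler divergence of two-point laws, which is at
most their χ² distance. -/
theorem const_risk_le (hW : ∀ i j, R.W i j = 0) {q : ℝ} (hq0 : 0 < q) (hq1 : q < 1)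
    (g : (Fin n → ℤˣ) → ℝ) :
    lawRisk (law R) (fun _ => constHyp q) - lawRisk (law R) g ≤
      (R.labelProb 1 - q) ^ 2 / (q * (1 - q)) := by
  have h1 := lawRisk_logOdds_le R g
  rw [funext (logOdds_of_W_eq_zero hW), lawRisk_const] at h1
  have h2 := labelProb_add (R := R)
  have h3 := labelProb_pos (R := R) (-1)
  have h4 := labelProb_pos (R := R) 1
  have h5 := binary_divergence_le h4 (by linarith) hq0 hq1
  obtain ⟨a1, a2⟩ := logisticLoss_constHyp h4 (by linarith)
  obtain ⟨b1, b2⟩ := logisticLoss_constHyp hq0 hq1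
  rw [a1, a2] at h1
  rw [lawRisk_const, b1, b2]
  rw [show R.labelProb (-1) = 1 - R.labelProb 1 by linarith] at h1 ⊢
  linarith

/-- Pulling the frequency towards one half keeps both predicted probabilities at least `eps / 4`, so
the χ² denominator is at least `3 * eps / 16`. Smoothing and sampling shift the probability by at
most `3 * eps / 8`, which leaves an excess of at most `3 * eps / 4`. -/
theorem const_success (heps : 0 < eps) (heps1 : eps < 1) (hn : 1 ≤ n) (hd : 0 < del) (hd1 : del < 1)
    (hdn : n = 1 → del ≤ 1 / 2) (hW : ∀ i j, R.W i j = 0)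
    (hm : 10 ^ 8 * Real.log (n / del) ≤ m * eps ^ 2) :
    1 - del ≤ iidProb (law R) {s : Fin m → Example n | ∀ g,
      lawRisk (law R) (fun _ => constHyp (freqVal eps
        (∑ t ∈ Finset.range m, bit (extend s t).2 : ℕ) m)) - lawRisk (law R) g ≤ eps} := by
  have hn' : (1 : ℝ) ≤ n := by exact_mod_cast hn
  have hlg2 := log_div_ge hn hd hd1 hdn
  set lg := Real.log (n / del) with hlg
  have hlg0 : 0 < lg := (Real.log_pos one_lt_two).trans_le hlg2
  have hm0 : (0 : ℝ) < m := lt_of_lt_of_le (by positivity) (eps_sq_le heps heps1 hm)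
  set f : Example n → ℝ := fun e => bit e.2 with hf
  have hf01 : ∀ e, 0 ≤ f e ∧ f e ≤ 1 := by
    intro e; simp only [hf, bit]; split_ifs <;> norm_num
  have hmean : ∑ e, law R e * f e = R.labelProb 1 := by
    rw [Fintype.sum_prod_type, SupervisedRBM.labelProb]
    refine Finset.sum_congr rfl fun x _ => ?_
    rw [sum_units]
    have : ¬ (-1 : ℤˣ) = 1 := by decide
    simp [hf, bit, law, this]
  have hH := hoeffding (law_nonneg R) (sum_law R) (m := m) (M := m) (by exact_mod_cast hm0) hf01
    (a := eps * m / 8) (by positivity)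
  rw [hmean] at hH
  set E : Set (Fin m → Example n) := {s | eps * m / 8 ≤ |∑ t : Fin m, if t.1 < m then
    f (s t) - R.labelProb 1 else 0|} with hE
  have hfail : 2 * Real.exp (-((eps * m / 8) ^ 2 / (2 * m))) ≤ del := by
    have h1 : 2 * lg ≤ (eps * m / 8) ^ 2 / (2 * m) := by
      have : (eps * m / 8) ^ 2 / (2 * m) = m * eps ^ 2 / 128 := by field_simp; norm_num
      rw [this]; linarith
    have h2 := two_div_le_exp hn hd hd1 hdn
    rw [← hlg] at h2
    calc _ ≤ 2 * Real.exp (-(2 * lg)) :=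
          mul_le_mul_of_nonneg_left (Real.exp_le_exp.2 (by linarith)) two_pos.le
      _ = 2 * (Real.exp (2 * lg))⁻¹ := by rw [Real.exp_neg]
      _ ≤ 2 * (2 / del)⁻¹ := by gcongr
      _ = del := by rw [inv_div]; ring
  have hsub : {s : Fin m → Example n | ∀ g,
      lawRisk (law R) (fun _ => constHyp (freqVal eps
        (∑ t ∈ Finset.range m, bit (extend s t).2 : ℕ) m)) - lawRisk (law R) g ≤ eps}ᶜ ⊆ E := by
    intro s hs
    by_contra hcon
    rw [hE, Set.mem_ofPred_eq, not_le] at hcon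
    refine hs fun g => ?_
    have e1 : (∑ t : Fin m, if t.1 < m then f (s t) - R.labelProb 1 else 0) =
        (∑ t ∈ Finset.range m, bit (extend s t).2 : ℕ) - m * R.labelProb 1 := by
      have e2 : ∀ t : Fin m, (if t.1 < m then f (s t) - R.labelProb 1 else 0) =
          f (extend s t) - R.labelProb 1 := fun t => by simp [extend]
      rw [Finset.sum_congr rfl fun t _ => e2 t,
        Fin.sum_univ_eq_sum_range (fun t => f (extend s t) - R.labelProb 1) m,
        Finset.sum_sub_distrib, Finset.sum_const, Finset.card_range, nsmul_eq_mul]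
      push_cast; rfl
    rw [e1] at hcon
    have hcle : ((∑ t ∈ Finset.range m, bit (extend s t).2 : ℕ) : ℝ) ≤ m := by
      have : ∑ t ∈ Finset.range m, bit (extend s t).2 ≤ ∑ t ∈ Finset.range m, 1 :=
        Finset.sum_le_sum fun t _ => by rw [bit]; split_ifs <;> norm_num
      rw [Finset.sum_const, Finset.card_range, smul_eq_mul, mul_one] at this
      exact_mod_cast this
    have hc0 : (0 : ℝ) ≤ (∑ t ∈ Finset.range m, bit (extend s t).2 : ℕ) := Nat.cast_nonneg _
    set c : ℝ := ((∑ t ∈ Finset.range m, bit (extend s t).2 : ℕ) : ℝ)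
    set p := R.labelProb 1
    set r := c / m with hr
    have hcr : c = r * m := by rw [hr]; field_simp
    have hr0 : 0 ≤ r := by positivity
    have hr1 : r ≤ 1 := (div_le_one hm0).2 hcle
    have hrp : |r - p| ≤ eps / 8 := by
      have e3 : c - m * p = (r - p) * m := by rw [hcr]; ring
      rw [e3, abs_mul, abs_of_pos hm0] at hcon
      nlinarith
    have hq : freqVal eps c m = (1 - eps / 2) * r + eps / 4 := rfl
    set q := freqVal eps c m
    have hq0 : eps / 4 ≤ q := by rw [hq]; nlinarith
    have hq1 : eps / 4 ≤ 1 - q := by rw [hq]; nlinarith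
    refine (const_risk_le hW (q := q) (by linarith) (by linarith) g).trans ?_
    have hqq : 3 * eps / 16 ≤ q * (1 - q) := by nlinarith [mul_nonneg (sub_nonneg.2 hq0) (sub_nonneg.2 hq1)]
    have hpq : |p - q| ≤ 3 * eps / 8 := by
      have h3 := abs_le.1 hrp
      rw [abs_le, hq]
      constructor <;> nlinarith [h3.1, h3.2]
    have hsq : (p - q) ^ 2 ≤ (3 * eps / 8) ^ 2 := by
      rw [← sq_abs]; exact pow_le_pow_left₀ (abs_nonneg _) hpq 2
    rw [div_le_iff₀ (by nlinarith)]
    nlinarith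
  have hc := iidProb_add_compl (sum_law R) {s : Fin m → Example n | ∀ g,
      lawRisk (law R) (fun _ => constHyp (freqVal eps
        (∑ t ∈ Finset.range m, bit (extend s t).2 : ℕ) m)) - lawRisk (law R) g ≤ eps}
  have := (iidProb_mono (law_nonneg R) hsub).trans (hH.trans hfail)
  linarith

/-- The zero predictor has loss log 2, below 1, and losses are nonnegative. -/
theorem zero_risk_le (heps : 1 ≤ eps) (g : (Fin n → ℤˣ) → ℝ) :
    lawRisk (law R) (fun _ => 0) - lawRisk (law R) g ≤ eps := by
  have h1 : lawRisk (law R) (fun _ => 0) = Real.log 2 := by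
    rw [lawRisk_const]
    simp only [logisticLoss, mul_zero, zero_mul, Real.exp_zero]
    rw [← add_mul, labelProb_add]; norm_num
  have h2 : 0 ≤ lawRisk (law R) g := Finset.sum_nonneg fun e _ => mul_nonneg (law_nonneg R e)
    (Real.log_nonneg (by linarith [Real.exp_pos (-2 * g e.1 * spin e.2)]))
  have h3 := Real.log_two_lt_d9
  linarith

end RBMLearn

/-! ### The theorem, by cases on ε and on the presence of interactions -/

open RBMLearn in
theorem mainTheorem6 :
    ∃ (A : RealRAM.Program) (C c₁ : ℝ) (c₂ c₃ K k : ℕ), 0 < C ∧ 0 < c₁ ∧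
      ∀ (n₁ n₂ : ℕ) (R : SupervisedRBM n₁ n₂) (lam α β B ε δ : ℝ),
        1 ≤ n₁ → 0 < α → 0 < β → 0 < B → 0 < ε → 0 < δ → δ < 1 → (n₁ = 1 → δ ≤ 1 / 2) →
        R.MinFerromagnetic α → R.CondSparse lam → R.BalancedLabel β → R.BoundedBias B →
        ∀ m : ℕ, sampleBound C c₁ c₂ c₃ n₁ lam α β ε δ ≤ m →
          ∃ out : (Fin m → (Fin n₁ → ℤˣ) × ℤˣ) → RealRAM.State,
            (∀ s, ∃ t ≤ K * m ^ k,
              RealRAM.Runs A (RealRAM.input ![lam, α, β, B, ε, δ] s) t (out s)) ∧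
            1 - δ ≤ R.sampleProb {s | ∀ g : (Fin n₁ → ℤˣ) → ℝ,
              R.risk (RealRAM.hypothesis n₁ (out s)) - R.risk g ≤ ε} := by
  obtain ⟨K, k, hrun⟩ := ArrayProg.learnProg_run
  refine ⟨ArrayProg.learnProg, 10 ^ 8, 20, 5, 10, K, k, by norm_num, by norm_num, ?_⟩
  intro n n₂ R lam al be B eps del hn hal hbe hB heps hd hd1 hdn hmin hsp hbal hbias m hm
  obtain ⟨hsp, y, hs⟩ := hsp
  have hn' : (1 : ℝ) ≤ n := by exact_mod_cast hn
  have hW : ∀ i j, 0 ≤ R.W i j := fun i j => by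
    rcases hmin i j with h | h
    · rw [h]
    · exact hal.le.trans h
  have hlam0 : 0 ≤ lam := by
    have h1 : 0 ≤ ∑ j, R.W ⟨0, hn⟩ j := Finset.sum_nonneg fun j _ => hW _ j
    linarith [hsp ⟨0, hn⟩, abs_nonneg (R.b₁ ⟨0, hn⟩)]
  -- Two label probabilities, each at least `be`, add up to 1.
  have hbe2 : be ≤ 1 / 2 := by
    have := labelProb_add (R := R)
    linarith [hbal 1, hbal (-1)]
  have hlg2 := log_div_ge hn hd hd1 hdn
  have hlg0 : 0 < Real.log (n / del) := (Real.log_pos one_lt_two).trans_le hlg2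
  rw [sampleBound, ← Real.exp_mul, div_le_iff₀ (by positivity)] at hm
  set Ex := lam * (Real.exp (20 * lam) * (1 / al) ^ 5 * (1 / be) ^ 10) with hEx
  have hEx0 : 0 ≤ Ex := by positivity
  have hm1 : 10 ^ 8 * (n : ℝ) ^ 2 * Real.log (n / del) ≤ m * eps ^ 2 := by
    refine le_trans ?_ hm
    have : 1 ≤ Real.exp Ex := Real.one_le_exp hEx0
    have h0 : 0 ≤ 10 ^ 8 * (n : ℝ) ^ 2 * Real.log (n / del) := by positivity
    nlinarith
  have hmpos : 1 ≤ m := by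
    rcases Nat.eq_zero_or_pos m with h | h
    · rw [h] at hm1
      have : 0 < 10 ^ 8 * (n : ℝ) ^ 2 * Real.log (n / del) := by positivity
      push_cast at hm1
      linarith
    · exact h
  -- In each regime it suffices to name the predictor that the run outputs and to bound its
  -- probability of success.
  have build : ∀ H : (Fin m → Example n) → (Fin n → ℤˣ) → ℝ,
      (∀ s, ∃ t ≤ K * m ^ k, ∃ τ, RealRAM.Runs ArrayProg.learnProg
        (RealRAM.input ![lam, al, be, B, eps, del] s) t τ ∧
        ∀ x, RealRAM.hypothesis n τ x = H s x) →
      1 - del ≤ iidProb (law R) {s : Fin m → Example n | ∀ g,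
        lawRisk (law R) (H s) - lawRisk (law R) g ≤ eps} →
      ∃ out : (Fin m → (Fin n → ℤˣ) × ℤˣ) → RealRAM.State,
        (∀ s, ∃ t ≤ K * m ^ k, RealRAM.Runs ArrayProg.learnProg
          (RealRAM.input ![lam, al, be, B, eps, del] s) t (out s)) ∧
        1 - del ≤ R.sampleProb {s | ∀ g : (Fin n → ℤˣ) → ℝ,
          R.risk (RealRAM.hypothesis n (out s)) - R.risk g ≤ eps} := by
    intro H h1 h2
    choose t ht out hout hx using h1
    refine ⟨out, fun s => ⟨t s, ht s, hout s⟩, ?_⟩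
    have : ∀ s, RealRAM.hypothesis n (out s) = H s := fun s => funext (hx s)
    simp only [risk_eq, this]
    exact h2
  by_cases heps1 : 1 ≤ eps
  · refine build (fun _ _ => 0) (fun s => (hrun n m lam al be B eps del s hn hmpos).1 heps1) ?_
    have h1 := iidProb_add_compl (sum_law R) {s : Fin m → Example n | ∀ g,
      lawRisk (law R) (fun _ => 0) - lawRisk (law R) g ≤ eps}
    have h2 : {s : Fin m → Example n | ∀ g,
      lawRisk (law R) (fun _ => 0) - lawRisk (law R) g ≤ eps}ᶜ = ∅ := by
      rw [Set.compl_empty_iff]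
      exact Set.eq_univ_of_forall fun s g => zero_risk_le heps1 g
    rw [h2] at h1
    have h3 : iidProb (law R) (∅ : Set (Fin m → Example n)) = 0 := by simp [iidProb]
    linarith
  rw [not_le] at heps1
  rcases lt_or_ge lam al with hlam | hlam
  · have hW0 : ∀ i j, R.W i j = 0 := by
      intro i j
      refine (hmin i j).resolve_right fun h => ?_
      have h1 := Finset.single_le_sum (f := fun j => R.W i j) (fun j _ => hW i j) (Finset.mem_univ j)
      linarith [hsp i, abs_nonneg (R.b₁ i)]
    have hnm : n ≤ m := by
      have h1 := eps_sq_le heps heps1 hm1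
      have h2 := Real.log_two_gt_d9
      have h3 : (n : ℝ) ≤ n ^ 2 := le_self_pow₀ hn' two_ne_zero
      have h4 : (n : ℝ) ≤ m := by nlinarith
      exact_mod_cast h4
    refine build (fun s _ => constHyp (freqVal eps
      (∑ t ∈ Finset.range m, bit (extend s t).2 : ℕ) m))
      (fun s => (hrun n m lam al be B eps del s hn hmpos).2.1 hnm heps1 hlam) ?_
    refine const_success heps heps1 hn hd hd1 hdn hW0 (le_trans ?_ hm1)
    have : 1 ≤ (n : ℝ) ^ 2 := one_le_pow₀ hn'
    nlinarith
  · have hm2 : 10 ^ 8 * (n : ℝ) ^ 2 * Real.exp (qVal lam al be) ^ 130 * Real.log (n / del) ≤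
        m * eps ^ 2 := by
      refine le_trans ?_ hm
      have h1 : Real.exp (qVal lam al be) ^ 130 ≤ Real.exp Ex := by
        rw [← Real.exp_nat_mul]
        refine Real.exp_le_exp.2 ?_
        push_cast
        exact qVal_le_exponent hal hlam hbe hbe2
      gcongr
    have hlen := length_bound hal hlam hbe hbe2 heps heps1 hn hd hd1 hdn hm2
    have hth := thrVal_pos (be := be) hal hbe lam
    set T := ⌊1 / thrVal lam al be ^ 2⌋₊ with hT
    have hpow : 1 ≤ 2 ^ (T + 1) := Nat.one_le_two_pow
    have hnm : n ≤ m := by nlinarith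
    have hM : 0 < m / 2 := by omega
    refine build (fun s => learnedHyp (extend s) m lam al be eps)
      (fun s => (hrun n m lam al be B eps del s hn hmpos).2.2 hnm heps1 hlam ?_ ?_) ?_
    · intro k' hk' l hl
      rw [List.length_append]
      have h1 := length_feats_le_pow (z := extend s) hM hth k'
      have h2 := length_scan_le (z := extend s) hM hth ⟨k', hk'⟩ hl
      rw [← hT] at h1 h2
      -- While unit `k'` is scanned, the list holds at most `k'` finished blocks and one partial
      -- block, so the intermediate lists also fit below `m`.
      have h3 : (k' + 1) * 2 ^ (T + 1) ≤ n * 2 ^ (T + 1) := Nat.mul_le_mul_right _ hk'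
      rw [add_mul, one_mul] at h3
      omega
    · have h1 := length_feats_le_pow (z := extend s) hM hth n
      rw [← hT] at h1
      change 32 + (feats (extend s) (m / 2) (thrVal lam al be * (m / 2 : ℕ)) n).length ≤ m
      omega
    · exact learned_success hal hlam hbe hbe2 heps heps1 hn hd hd1 hdn hmin hW hsp hs hbal hm2
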